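/- Fix $\varepsilon>0$, $\alpha>0$ and put $w(R)=R^{1-\varepsilon}(1+R)^{1+2\varepsilon}$ for $R>0$. Let $X_{w,\alpha}=L^2((0,\infty),w(R)e^{2\alpha R}\,dR)$, and let $\widehat X_{w,\alpha}$ be the Hilbert space of Hilbert–Schmidt kernels $K(R,R')$ on $X_{w,\alpha}$, with norm $$\|K\|_{HS}^2=\int_0^\infty\!\!\int_0^\infty \frac{w(R)e^{2\alpha R}}{w(R')e^{2\alpha R'}}\,|K(R,R')|^2\,dR\,dR' .$$ A kernel $K\in\widehat X_{w,\alpha}$ acts on $X_{w,\alpha}$ by $(Kx)(R)=\int_0^\infty K(R,R')x(R')\,dR'$. Let $V=V(\mathbf R,\mathbf R')$ be a potential in the class $\mathcal N_{w,\alpha}$: a real measurable symmetric function on $\mathbb R^3\times\mathbb R^3$ that depends only on $R=|\mathbf R|$, $R'=|\mathbf R'|$ and the cosine $t$ of the angle between $\mathbf R$ and $\mathbf R'$ (write $V(R,R';t)$), with $$\int_{\mathbb R^3} w(R)e^{2\alpha R}\int_{\mathbb R^3}w(R')e^{2\alpha R'}\,V(\mathbf R,\mathbf R')^2\,d\mathbf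 R'\,d\mathbf R<\infty .$$ For an integer $\ell\ge 0$ put $V_\ell(R,R')=2\pi RR'\int_{-1}^1V(R,R';t)P_\ell(t)\,dt$, where $P_\ell$ is the Legendre polynomial, and $$L_\ell(k;R,R')=\int_0^\infty V_\ell(R,R'')\,G_\ell(k;R'',R')\,dR'',$$ $$G_\ell(k;R,R')=-ik\,RR'\,j_\ell\big(k\min(R,R')\big)\,h^{(1)}_\ell\big(k\max(R,R')\big),$$ where $j_\ell,h^{(1)}_\ell$ are the spherical Bessel and Hankel functions and $G_\ell$ is extended to $k=0$ by continuity (it is entire in $k$). Let $\Pi_\alpha=\{k\in\mathbb C:\operatorname{Im}k>-\alpha\}$. Define Smithies' series (with $L=L_\ell(k)$) $$\sigma_\ell(k;g)=\sum_{n\ge 0}\sigma_n\,g^n,\qquad N_\ell(k;g)=\sum_{n\ge 0}L\,\Delta_n\,g^n ,\qquad \sigma_n=\frac{(-1)^n}{n!}\det Q_n .$$ Here $Q_n$ is the $n\times n$ matrix with zero diagonal, superdiagonal $n-1,n-2,\dots,1$, zeros above the superdiagonal, and entry $\operatorname{Tr}[L^{i-j+1}]$ at each place $(i,j)$ with $i>j$;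 and $\Delta_n$ is $\frac{(-1)^n}{n!}$ times the $(n+1)\times(n+1)$ determinant with first column $(I,L,\dots,L^n)$, first row $(I,n,0,\dots,0)$ and lower right block $Q_n$. **Theorem.** For every $\ell\geq 0$ the following hold. (i) For all $k\in\overline{\Pi}_\alpha$, the integral defining $L_\ell(k;R,R')$ converges absolutely for a.e. $R$ and all $R'>0$, $L_\ell(k)$ and its powers belong to $\widehat X_{w,\alpha}$, and for all $g\in\mathbb C$ the series $\sigma_\ell(k;g)$ and $N_\ell(k;g)$ converge, respectively in $\mathbb C$ and in $\widehat X_{w,\alpha}$. (ii) For all $(k,g)\in\overline{\Pi}_\alpha\times\mathbb C$ with $\sigma_\ell(k;g)\ne 0$, the truncated resolvent $R^{(tr)}_\ell(k;g)=N_\ell(k;g)/\sigma_\ell(k;g)$ exists as a Hilbert–Schmidt operator on $X_{w,\alpha}$, the operator $I-gL_\ell(k)$ is invertible with bounded inverse $R_\ell(k;g)=[I-gL_\ell(k)]^{-1}=I+g\,R^{(tr)}_\ell(k;g)$, and $R^{(tr)}_\ell(k;g)=L_\ell(k)+gL_\ell(k)R^{(tr)}_\ell(k;g)$. (iii) For each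 fixed $g\in\mathbb C$ the zeros of $\sigma_\ell(\cdot\,;g)$ have no accumulation point in $\Pi_\alpha$. (iv) The function $(k,g)\mapsto R^{(tr)}_\ell(k;g)$ is meromorphic in $\Pi_\alpha\times\mathbb C$ with values in $\widehat X_{w,\alpha}$, and for each fixed $g\in\mathbb C$ the function $k\mapsto R^{(tr)}_\ell(k;g)$ is holomorphic in $\{k\in\Pi_\alpha:\sigma_\ell(k;g)\neq0\}$ with values in $\widehat X_{w,\alpha}$. (v) The function $(k,g)\mapsto R_\ell(k;g)$ is meromorphic in $\Pi_\alpha\times\mathbb C$, and for each fixed $g\in\mathbb C$ the function $k\mapsto R_\ell(k;g)$ is holomorphic in $\{k\in\Pi_\alpha:\sigma_\ell(k;g)\neq0\}$, with values in the bounded operators on $X_{w,\alpha}$. (Meromorphic means: near each point it is the quotient of a holomorphic vector-valued function by a holomorphic scalar function with nowhere dense zero set.) -/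

import Mathlib

open MeasureTheory Set Filter Topology Polynomial
open scoped ENNReal

namespace NonlocalPotential

noncomputable section

/-! ### The weight, the Hilbert space `X_{w,α}` and the Hilbert–Schmidt space -/

/-- The weight `w^{(ε)}(R) = R^{1-ε} (1+R)^{1+2ε}`. -/
def weight (ε R : ℝ) : ℝ := R ^ (1 - ε) * (1 + R) ^ (1 + 2 * ε)

/-- The density `w^{(ε)}(R) e^{2αR}`. -/
def dens (ε α R : ℝ) : ℝ≥0∞ := ENNReal.ofReal (weight ε R * Real.exp (2 * α * R))

/-- Lebesgue measure on the half-line `(0, ∞)`. -/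
def halfLine : Measure ℝ := volume.restrict (Ioi 0)

/-- The measure `w^{(ε)}(R) e^{2αR} dR` on `(0, ∞)`. -/
def muX (ε α : ℝ) : Measure ℝ := halfLine.withDensity (dens ε α)

/-- The measure `(w^{(ε)}(R) e^{2αR})⁻¹ dR` on `(0, ∞)`. -/
def muInv (ε α : ℝ) : Measure ℝ := halfLine.withDensity fun R => (dens ε α R)⁻¹

/-- The Hilbert space `X_{w,α}`, with `‖x‖² = ∫₀^∞ w(R) e^{2αR} |x(R)|² dR`. -/
abbrev XSp (ε α : ℝ) : Type := Lp ℂ 2 (muX ε α)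

/-- The space of Hilbert–Schmidt kernels on `X_{w,α}`: with `μ(R) = w(R) e^{2αR}`,
`‖K‖²_HS = ∫₀^∞ ∫₀^∞ (μ(R) / μ(R')) |K(R,R')|² dR' dR`. -/
abbrev HSSp (ε α : ℝ) : Type := Lp ℂ 2 ((muX ε α).prod (muInv ε α))

lemma dens_measurable (ε α : ℝ) : Measurable (dens ε α) := by
  unfold dens weight
  fun_prop

lemma dens_ne_top (ε α R : ℝ) : dens ε α R ≠ ∞ := ENNReal.ofReal_ne_top

lemma dens_ne_zero (ε α : ℝ) {R : ℝ} (hR : 0 < R) : dens ε α R ≠ 0 := by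
  unfold dens weight
  have : 0 < R ^ (1 - ε) * (1 + R) ^ (1 + 2 * ε) * Real.exp (2 * α * R) := by positivity
  simpa using this

lemma ae_halfLine_pos : ∀ᵐ R ∂halfLine, 0 < R :=
  ae_restrict_mem measurableSet_Ioi

instance : SFinite halfLine := by unfold halfLine; infer_instance
instance (ε α : ℝ) : SFinite (muX ε α) := by unfold muX; infer_instance
instance (ε α : ℝ) : SFinite (muInv ε α) := by unfold muInv; infer_instance

lemma halfLine_ac_muX (ε α : ℝ) : halfLine ≪ muX ε α :=
  withDensity_absolutelyContinuous' (dens_measurable ε α).aemeasurable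
    (ae_halfLine_pos.mono fun _ h => dens_ne_zero ε α h)

lemma muX_ac_halfLine (ε α : ℝ) : muX ε α ≪ halfLine := withDensity_absolutelyContinuous _ _

lemma halfLine_ac_muInv (ε α : ℝ) : halfLine ≪ muInv ε α :=
  withDensity_absolutelyContinuous' (dens_measurable ε α).inv.aemeasurable
    (ae_halfLine_pos.mono fun R _ => ENNReal.inv_ne_zero.2 (dens_ne_top ε α R))

lemma muInv_ac_halfLine (ε α : ℝ) : muInv ε α ≪ halfLine := withDensity_absolutelyContinuous _ _

lemma lintegral_halfLine_eq (ε α : ℝ) (f : ℝ → ℝ≥0∞) (hf : AEMeasurable f halfLine) :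
    ∫⁻ R, f R ∂halfLine = ∫⁻ R, f R * dens ε α R ∂(muInv ε α) := by
  have h1 := lintegral_withDensity_eq_lintegral_mul₀ (μ := halfLine)
    (dens_measurable ε α).inv.aemeasurable (hf.mul (dens_measurable ε α).aemeasurable)
  have h2 : ∫⁻ R, f R * dens ε α R ∂(muInv ε α)
      = ∫⁻ R, (dens ε α R)⁻¹ * (f R * dens ε α R) ∂halfLine := by
    exact h1
  rw [h2]
  refine lintegral_congr_ae (ae_halfLine_pos.mono fun R hR => ?_)
  show f R = (dens ε α R)⁻¹ * (f R * dens ε α R)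
  rw [mul_comm, mul_assoc, ENNReal.mul_inv_cancel (dens_ne_zero ε α hR) (dens_ne_top ε α R),
    mul_one]

lemma lintegral_muX_eq (ε α : ℝ) (f : ℝ → ℝ≥0∞) (hf : AEMeasurable f halfLine) :
    ∫⁻ R, f R ∂(muX ε α) = ∫⁻ R, f R * dens ε α R ^ (2 : ℝ) ∂(muInv ε α) := by
  have h1 := lintegral_withDensity_eq_lintegral_mul₀ (μ := halfLine)
    (dens_measurable ε α).aemeasurable hf
  have h2 : ∫⁻ R, f R ∂(muX ε α) = ∫⁻ R, dens ε α R * f R ∂halfLine := by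
    exact h1
  rw [h2, lintegral_halfLine_eq ε α (fun R => dens ε α R * f R)
    ((dens_measurable ε α).aemeasurable.mul hf)]
  refine lintegral_congr fun R => ?_
  rw [ENNReal.rpow_two, sq]; ring

/-- Cauchy–Schwarz for the duality between `L²(μ dR)` and `L²(μ⁻¹ dR)`. -/
lemma schwarz (ε α : ℝ) (f g : ℝ → ℂ) (hf : AEStronglyMeasurable f halfLine)
    (hg : AEStronglyMeasurable g halfLine) :
    ∫⁻ R, ‖f R * g R‖ₑ ∂halfLine ≤ eLpNorm f 2 (muInv ε α) * eLpNorm g 2 (muX ε α) := by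
  have hgm : AEMeasurable (fun R => ‖g R‖ₑ * dens ε α R) (muInv ε α) :=
    (hg.enorm.mul (dens_measurable ε α).aemeasurable).mono_ac (muInv_ac_halfLine ε α)
  rw [lintegral_halfLine_eq ε α (fun R => ‖f R * g R‖ₑ) (hf.mul hg).enorm]
  calc ∫⁻ R, ‖f R * g R‖ₑ * dens ε α R ∂(muInv ε α)
      = ∫⁻ R, ((fun R => ‖f R‖ₑ) * fun R => ‖g R‖ₑ * dens ε α R) R ∂(muInv ε α) := by
        refine lintegral_congr fun R => ?_
        simp [mul_assoc]
    _ ≤ _ := ENNReal.lintegral_mul_le_Lp_mul_Lq _ Real.HolderConjugate.two_two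
        (hf.enorm.mono_ac (muInv_ac_halfLine ε α)) hgm
    _ = _ := by
        rw [eLpNorm_eq_lintegral_rpow_enorm_toReal (by simp) (by simp),
          eLpNorm_eq_lintegral_rpow_enorm_toReal (by simp) (by simp)]
        congr 2
        rw [lintegral_muX_eq ε α _ (hg.enorm.pow_const _)]
        refine lintegral_congr fun R => ?_
        rw [ENNReal.mul_rpow_of_nonneg _ _ (by norm_num)]
        simp

section Operator

variable {ε α : ℝ}

lemma HS_aesm (K : HSSp ε α) :
    AEStronglyMeasurable (K : ℝ × ℝ → ℂ) (halfLine.prod halfLine) :=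
  (Lp.aestronglyMeasurable K).mono_ac
    ((halfLine_ac_muX ε α).prod (halfLine_ac_muInv ε α))

lemma X_aesm (x : XSp ε α) : AEStronglyMeasurable (x : ℝ → ℂ) halfLine :=
  (Lp.aestronglyMeasurable x).mono_ac (halfLine_ac_muX ε α)

lemma HS_row_aesm (K : HSSp ε α) :
    ∀ᵐ R ∂halfLine, AEStronglyMeasurable (fun R' => (K : ℝ × ℝ → ℂ) (R, R')) halfLine :=
  (HS_aesm K).prodMk_left

lemma HS_lintegral_eq (K : HSSp ε α) :
    ∫⁻ R, eLpNorm (fun R' => (K : ℝ × ℝ → ℂ) (R, R')) 2 (muInv ε α) ^ (2 : ℝ) ∂(muX ε α)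
      = eLpNorm (K : ℝ × ℝ → ℂ) 2 ((muX ε α).prod (muInv ε α)) ^ (2 : ℝ) := by
  simp only [eLpNorm_eq_lintegral_rpow_enorm_toReal (p := 2) (by simp) (by simp)]
  simp only [← ENNReal.rpow_mul]
  norm_num
  rw [lintegral_prod]
  exact ((Lp.aestronglyMeasurable K).enorm.pow_const 2)

lemma HS_row_memLp (K : HSSp ε α) :
    ∀ᵐ R ∂halfLine, MemLp (fun R' => (K : ℝ × ℝ → ℂ) (R, R')) 2 (muInv ε α) := by
  have hfin : ∫⁻ R, eLpNorm (fun R' => (K : ℝ × ℝ → ℂ) (R, R')) 2 (muInv ε α) ^ (2 : ℝ)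
      ∂(muX ε α) ≠ ∞ := by
    rw [HS_lintegral_eq]
    exact ENNReal.rpow_ne_top_of_nonneg (by norm_num) (Lp.eLpNorm_ne_top K)
  have hm : AEMeasurable (fun R => eLpNorm (fun R' => (K : ℝ × ℝ → ℂ) (R, R')) 2
      (muInv ε α) ^ (2 : ℝ)) (muX ε α) := by
    simp only [eLpNorm_eq_lintegral_rpow_enorm_toReal (p := 2) (by simp) (by simp)]
    refine AEMeasurable.pow_const (AEMeasurable.pow_const ?_ _) _
    exact AEMeasurable.lintegral_prod_right' (f := fun p : ℝ × ℝ =>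
      ‖(K : ℝ × ℝ → ℂ) p‖ₑ ^ (2 : ℝ≥0∞).toReal)
      ((Lp.aestronglyMeasurable K).enorm.pow_const _)
  have h1 := (halfLine_ac_muX ε α).ae_le (ae_lt_top' hm hfin)
  filter_upwards [h1, HS_row_aesm K] with R hR hR'
  refine ⟨hR'.mono_ac (muInv_ac_halfLine ε α), ?_⟩
  by_contra hcon
  simp only [not_lt, top_le_iff] at hcon
  simp [hcon] at hR

/-- `(K x)(R) = ∫₀^∞ K(R,R') x(R') dR'`. -/
def kerApply (K : ℝ × ℝ → ℂ) (x : ℝ → ℂ) (R : ℝ) : ℂ := ∫ R', K (R, R') * x R' ∂halfLine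

lemma kerApply_integrable (K : HSSp ε α) (x : XSp ε α) :
    ∀ᵐ R ∂halfLine, Integrable (fun R' => (K : ℝ × ℝ → ℂ) (R, R') * x R') halfLine := by
  filter_upwards [HS_row_memLp K, HS_row_aesm K] with R hR hR'
  refine ⟨hR'.mul (X_aesm x), ?_⟩
  exact (schwarz ε α _ _ hR' (X_aesm x)).trans_lt (ENNReal.mul_lt_top hR.2 (Lp.eLpNorm_lt_top x))

lemma kerApply_eLpNorm_le (K : HSSp ε α) (x : XSp ε α) :
    eLpNorm (kerApply K x) 2 (muX ε α) ≤
      eLpNorm (K : ℝ × ℝ → ℂ) 2 ((muX ε α).prod (muInv ε α)) * eLpNorm x 2 (muX ε α) := by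
  have key : ∀ᵐ R ∂(muX ε α), ‖kerApply K x R‖ₑ ^ (2 : ℝ) ≤
      eLpNorm (fun R' => (K : ℝ × ℝ → ℂ) (R, R')) 2 (muInv ε α) ^ (2 : ℝ)
        * eLpNorm x 2 (muX ε α) ^ (2 : ℝ) := by
    filter_upwards [(muX_ac_halfLine ε α).ae_le (HS_row_aesm K)] with R hR
    rw [← ENNReal.mul_rpow_of_nonneg _ _ (by norm_num)]
    exact ENNReal.rpow_le_rpow
      ((enorm_integral_le_lintegral_enorm _).trans (schwarz ε α _ _ hR (X_aesm x))) (by norm_num)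
  have h2 : eLpNorm (kerApply K x) 2 (muX ε α) ^ (2 : ℝ) ≤
      (eLpNorm (K : ℝ × ℝ → ℂ) 2 ((muX ε α).prod (muInv ε α)) * eLpNorm x 2 (muX ε α))
        ^ (2 : ℝ) := by
    rw [ENNReal.mul_rpow_of_nonneg _ _ (by norm_num), ← HS_lintegral_eq K,
      ← lintegral_mul_const' _ _ (ENNReal.rpow_ne_top_of_nonneg (by norm_num)
        (Lp.eLpNorm_ne_top x))]
    refine le_trans (le_of_eq ?_) (lintegral_mono_ae key)
    rw [eLpNorm_eq_lintegral_rpow_enorm_toReal (by simp) (by simp), ← ENNReal.rpow_mul]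
    norm_num
  exact (ENNReal.rpow_le_rpow_iff (by norm_num)).1 h2

lemma kerApply_memLp (K : HSSp ε α) (x : XSp ε α) :
    MemLp (kerApply K x) 2 (muX ε α) := by
  refine ⟨?_, (kerApply_eLpNorm_le K x).trans_lt
    (ENNReal.mul_lt_top (Lp.eLpNorm_lt_top K) (Lp.eLpNorm_lt_top x))⟩
  have h : AEStronglyMeasurable (fun p : ℝ × ℝ => (K : ℝ × ℝ → ℂ) p * x p.2)
      (halfLine.prod halfLine) := (HS_aesm K).mul (X_aesm x).comp_snd
  exact h.integral_prod_right'.mono_ac (muX_ac_halfLine ε α)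

/-- The bounded operator on `X_{w,α}` defined by a Hilbert–Schmidt kernel `K`,
`(K x)(R) = ∫₀^∞ K(R,R') x(R') dR'`. -/
def toOp (K : HSSp ε α) : XSp ε α →L[ℂ] XSp ε α :=
  LinearMap.mkContinuous
    { toFun := fun x => (kerApply_memLp K x).toLp _
      map_add' := by
        intro x y
        rw [← MemLp.toLp_add, MemLp.toLp_eq_toLp_iff]
        filter_upwards [(muX_ac_halfLine ε α).ae_le (kerApply_integrable K x),
          (muX_ac_halfLine ε α).ae_le (kerApply_integrable K y)] with R hx hy
        simp only [kerApply, Pi.add_apply]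
        rw [← integral_add hx hy]
        refine integral_congr_ae ?_
        filter_upwards [(halfLine_ac_muX ε α).ae_le (Lp.coeFn_add x y)] with R' h
        rw [h, Pi.add_apply, mul_add]
      map_smul' := by
        intro c x
        rw [RingHom.id_apply, ← MemLp.toLp_const_smul, MemLp.toLp_eq_toLp_iff]
        refine Eventually.of_forall fun R => ?_
        simp only [kerApply, Pi.smul_apply]
        rw [← integral_smul]
        refine integral_congr_ae ?_
        filter_upwards [(halfLine_ac_muX ε α).ae_le (Lp.coeFn_smul c x)] with R' h
        rw [h, Pi.smul_apply, smul_eq_mul, smul_eq_mul]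
        ring }
    ‖K‖
    (by
      intro x
      show ‖(kerApply_memLp K x).toLp _‖ ≤ ‖K‖ * ‖x‖
      rw [Lp.norm_toLp, Lp.norm_def, Lp.norm_def, ← ENNReal.toReal_mul]
      exact ENNReal.toReal_mono
        (ENNReal.mul_ne_top (Lp.eLpNorm_ne_top K) (Lp.eLpNorm_ne_top x))
        (kerApply_eLpNorm_le K x))

end Operator

/-- `K` is the kernel of a Hilbert–Schmidt operator on `X_{w,α}`. -/
def IsHS (ε α : ℝ) (K : ℝ → ℝ → ℂ) : Prop :=
  MemLp (fun p : ℝ × ℝ => K p.1 p.2) 2 ((muX ε α).prod (muInv ε α))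

open Classical in
/-- The element of the Hilbert–Schmidt space given by a kernel (and `0` if the kernel is not
Hilbert–Schmidt). -/
def toHS (ε α : ℝ) (K : ℝ → ℝ → ℂ) : HSSp ε α :=
  if h : IsHS ε α K then MemLp.toLp _ h else 0

/-! ### The class of potentials and the partial potentials -/

/-- Three-dimensional Euclidean space. -/
abbrev E3 : Type := EuclideanSpace ℝ (Fin 3)

/-- The class `N_{w,α}`, `w = w^{(ε)}`, of rotationally invariant nonlocal potentials. Rotational
invariance: `V(x,y)` depends only on `|x|`, `|y|` and the angle between `x` and `y`. -/
structure IsPotential (ε α : ℝ) (V : E3 → E3 → ℝ) : Prop where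
  measurable : Measurable fun p : E3 × E3 => V p.1 p.2
  symm : ∀ᵐ p : E3 × E3, V p.1 p.2 = V p.2 p.1
  rotation : ∀ x y x' y' : E3, ‖x‖ = ‖x'‖ → ‖y‖ = ‖y'‖ → inner ℝ x y = inner ℝ x' y' →
    V x y = V x' y'
  finite : ∫⁻ x : E3, dens ε α ‖x‖ * ∫⁻ y : E3, dens ε α ‖y‖ * ENNReal.ofReal (V x y ^ 2) < ∞

/-- `V(R,R';t)`: the value of `V` at two vectors of lengths `R`, `R'` with angle of cosine `t`. -/
def profile (V : E3 → E3 → ℝ) (R R' t : ℝ) : ℝ :=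
  V !₂[R, 0, 0] !₂[R' * t, R' * Real.sqrt (1 - t ^ 2), 0]

/-- The Legendre polynomial `P_ℓ`, through `P_ℓ(1 - 2X) = shiftedLegendre ℓ`. -/
def legendreP (l : ℕ) (t : ℝ) : ℝ := aeval ((1 - t) / 2) (shiftedLegendre l)

/-- The partial potential `V_ℓ(R,R') = 2π R R' ∫_{-1}^{1} V(R,R';t) P_ℓ(t) dt`. -/
def partialV (V : E3 → E3 → ℝ) (l : ℕ) (R R' : ℝ) : ℝ :=
  2 * Real.pi * R * R' * ∫ t in (-1 : ℝ)..1, profile V R R' t * legendreP l t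

/-! ### The Green function and the kernel `L_ℓ(k;R,R')` -/

/-- The spherical Bessel function `j_ℓ` (Poisson's integral), an entire function. -/
def sphericalJ (l : ℕ) (z : ℂ) : ℂ :=
  z ^ l / (2 ^ (l + 1) * (l.factorial : ℂ)) *
    ∫ t in (-1 : ℝ)..1, Complex.exp (Complex.I * z * t) * (1 - (t : ℂ) ^ 2) ^ l

/-- The spherical Hankel function `h_ℓ^{(1)}`, for `z ≠ 0`. -/
def sphericalH (l : ℕ) (z : ℂ) : ℂ :=
  (-Complex.I) ^ (l + 1) * (Complex.exp (Complex.I * z) / z) *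
    ∑ m ∈ Finset.range (l + 1),
      Complex.I ^ m / ((m.factorial : ℂ) * (2 * z) ^ m) *
        (((l + m).factorial : ℂ) / ((l - m).factorial : ℂ))

/-- The Green function
`G_ℓ(k;R,R') = -i k R R' j_ℓ(k min(R,R')) h_ℓ^{(1)}(k max(R,R'))`, which is entire in `k`. At the
removable singularity `k = 0` its value is `-min(R,R')^{ℓ+1} / ((2ℓ+1) max(R,R')^ℓ)`. -/
def greenG (l : ℕ) (k : ℂ) (R R' : ℝ) : ℂ :=
  if k = 0 then
    -((min R R' : ℝ) : ℂ) ^ (l + 1) / ((2 * (l : ℂ) + 1) * ((max R R' : ℝ) : ℂ) ^ l)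
  else
    -Complex.I * k * R * R' * sphericalJ l (k * (min R R' : ℝ)) * sphericalH l (k * (max R R' : ℝ))

/-- `L_ℓ(k;R,R') = ∫₀^∞ V_ℓ(R,R'') G_ℓ(k;R'',R') dR''`. -/
def kernelL (V : E3 → E3 → ℝ) (l : ℕ) (k : ℂ) (R R' : ℝ) : ℂ :=
  ∫ R'', (partialV V l R R'' : ℂ) * greenG l k R'' R' ∂halfLine

/-! ### Smithies' modified Fredholm series of a kernel -/

/-- `kerPow K n` is the iterated kernel `K^{n+1}`. -/
def kerPow (K : ℝ → ℝ → ℂ) : ℕ → ℝ → ℝ → ℂ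
  | 0 => K
  | n + 1 => fun R R' => ∫ R'', K R R'' * kerPow K n R'' R' ∂halfLine

/-- `ρ_n = Tr[K^n] = Tr[K^{n-1} K]`, used for `n ≥ 2`. -/
def rho (K : ℝ → ℝ → ℂ) (n : ℕ) : ℂ :=
  ∫ p : ℝ × ℝ, kerPow K (n - 2) p.1 p.2 * K p.2 p.1 ∂(halfLine.prod halfLine)

/-- The `n × n` matrix with zero diagonal, superdiagonal `n-1, n-2, …, 1` and entry
`ρ_{i-j+1}` at the place `(i,j)` below the diagonal. -/
def qMatrix (K : ℝ → ℝ → ℂ) (n : ℕ) : Matrix (Fin n) (Fin n) ℂ :=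
  Matrix.of fun i j =>
    if (j : ℕ) < i then rho K (i - j + 1)
    else if (j : ℕ) = i + 1 then ((n - 1 - i : ℕ) : ℂ)
    else 0

/-- `σ_n = ((-1)^n / n!) Q_n`, where `Q_n` is the determinant of `qMatrix K n`. -/
def sigmaCoeff (K : ℝ → ℝ → ℂ) (n : ℕ) : ℂ :=
  (-1) ^ n / (n.factorial : ℂ) * (qMatrix K n).det

/-- The modified Fredholm determinant `σ(g) = ∑ σ_n g^n`. -/
def sigma (K : ℝ → ℝ → ℂ) (g : ℂ) : ℂ := ∑' n, sigmaCoeff K n * g ^ n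

/-- The polynomial `Δ_n(X)` such that `Δ_n = Δ_n(K)` as an operator: `(-1)^n / n!` times the
`(n+1) × (n+1)` determinant with first column `1, X, …, X^n`, first row `1, n, 0, …, 0`, and lower
right block `qMatrix K n`; this is `qMatrix K (n+1)` with its first column replaced. -/
def deltaPoly (K : ℝ → ℝ → ℂ) (n : ℕ) : ℂ[X] :=
  C ((-1) ^ n / (n.factorial : ℂ)) *
    (((qMatrix K (n + 1)).map C).updateCol 0 fun i => X ^ (i : ℕ)).det

/-- The kernel `N_n = K Δ_n(K)`. -/
def nCoeff (K : ℝ → ℝ → ℂ) (n : ℕ) (R R' : ℝ) : ℂ :=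
  ∑ j ∈ Finset.range (n + 1), (deltaPoly K n).coeff j * kerPow K j R R'

/-- `N(g) = ∑ N_n g^n`, a series in the Hilbert–Schmidt norm. -/
def nSeries (ε α : ℝ) (K : ℝ → ℝ → ℂ) (g : ℂ) : HSSp ε α :=
  ∑' n, g ^ n • toHS ε α (nCoeff K n)

/-! ### The resolvents -/

/-- The operator `L_ℓ(k)` as an element of the Hilbert–Schmidt space. -/
def opL (ε α : ℝ) (V : E3 → E3 → ℝ) (l : ℕ) (k : ℂ) : HSSp ε α :=
  toHS ε α (kernelL V l k)

/-- `σ_ℓ(k;g)`. -/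
def sigmaL (V : E3 → E3 → ℝ) (l : ℕ) (k g : ℂ) : ℂ := sigma (kernelL V l k) g

/-- `N_ℓ(k;g)`. -/
def nL (ε α : ℝ) (V : E3 → E3 → ℝ) (l : ℕ) (k g : ℂ) : HSSp ε α :=
  nSeries ε α (kernelL V l k) g

/-- The truncated resolvent `R_ℓ^{(tr)}(k;g) = N_ℓ(k;g) / σ_ℓ(k;g)`, for `σ_ℓ(k;g) ≠ 0`. -/
def resolventTr (ε α : ℝ) (V : E3 → E3 → ℝ) (l : ℕ) (k g : ℂ) : HSSp ε α :=
  (sigmaL V l k g)⁻¹ • nL ε α V l k g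

/-- The resolvent `R_ℓ(k;g) = [I - g L_ℓ(k)]⁻¹`, where `I - g L_ℓ(k)` is invertible. -/
def fullResolvent (ε α : ℝ) (V : E3 → E3 → ℝ) (l : ℕ) (k g : ℂ) : XSp ε α →L[ℂ] XSp ε α :=
  Ring.inverse (1 - g • toOp (opL ε α V l k))

/-- The open half-plane `Π_α = {Im k > -α}`. -/
def halfPlane (α : ℝ) : Set ℂ := {k | -α < k.im}

/-- A vector-valued function is meromorphic on an open set `U ⊆ ℂ²` if near every point of `U` it
is the quotient `h / s` of a holomorphic vector-valued function `h` by a holomorphic scalar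
function `s` whose zero set is nowhere dense (wherever `s` does not vanish). -/
def IsMeromorphicOn {E : Type*} [NormedAddCommGroup E] [NormedSpace ℂ E]
    (f : ℂ × ℂ → E) (U : Set (ℂ × ℂ)) : Prop :=
  ∀ p ∈ U, ∃ W : Set (ℂ × ℂ), IsOpen W ∧ p ∈ W ∧ ∃ (h : ℂ × ℂ → E) (s : ℂ × ℂ → ℂ),
    DifferentiableOn ℂ h W ∧ DifferentiableOn ℂ s W ∧
    W ⊆ closure {q ∈ W | s q ≠ 0} ∧
    ∀ q ∈ W, s q ≠ 0 → f q = (s q)⁻¹ • h q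

end

end NonlocalPotential

open NonlocalPotential

namespace NonlocalPotential

noncomputable section

/-! ### Recurrences for Smithies' coefficients -/

/-! Smithies' coefficients are a regularised Fredholm determinant. Put `ρ_n = Tr L^n` for `n ≥ 2`
and `ρ_0 = ρ_1 = 0`. Expanding the determinants gives `n σ_n = -∑ ρ_i σ_{n-i}` and `Δ_n = ∑ σ_{n-j}
L^j`; formally `σ(g) = exp(-∑ ρ_m g^m / m)`. For a matrix `M` this is `det(1 - gM) exp(g tr M)`,
where the exponential removes the trace of `M`, a quantity that the Hilbert–Schmidt norm does not
control.

Convergence rests on one estimate. For matrices, `|det(1 - A) exp(tr A)| ≤ exp(‖A‖² / 2)` in the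
Hilbert–Schmidt norm (`norm_det_mul_exp_trace_le`). Cauchy's estimate bounds each `σ_n` on
finite-rank kernels, and density and continuity extend the bound to every Hilbert–Schmidt kernel
(`TraceAlgebra.norm_sig_le`). The derivative of `σ_{n+2}` in direction `b` is `-Tr(N_n b)`
(`TraceAlgebra.hasDerivAt_sig`), so a second Cauchy estimate together with duality bounds `N_n`
(`TraceAlgebra.norm_num_le`). Hence `σ` and `N` are entire on the product of the Hilbert–Schmidt
space with `ℂ`. Since `N = σ L + g L N` and `L` commutes with `N`, the operator `1 + g N / σ` is a
two-sided inverse of `1 - g L` wherever `σ ≠ 0`.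

For the concrete kernel, write `μ = w e^{2αR}` and split `L_ℓ(k) = (V_ℓ μ)(G_ℓ(k) / μ)`. The first
factor is Hilbert–Schmidt by the definition of the class of potentials, spherical coordinates and
Cauchy–Schwarz in `t`. On `Im k ≥ -α` one has `|G_ℓ(k;R,R')| ≤ C √(RR') e^{α(R+R')}` with `C`
independent of `k` (`exists_norm_greenE_le`, `exponent_le`), so the second factor has a fixed
Hilbert–Schmidt majorant (`exists_norm_greenK_le`). Pointwise holomorphy in `k` therefore becomes
holomorphy in norm (`differentiableOn_toLp`), and composition with the entire maps `σ` and `N` gives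
holomorphy in `(k,g)`.

Along `k = in` the Green factor tends to zero by dominated convergence, so `σ` tends to `1` and is
not identically zero on the connected half-plane. The identity theorem isolates its zeros for each
fixed `g`, which also makes its zero set nowhere dense in `(k,g)`. -/

/-- The power sums `ρ_n` of the modified theory, with `ρ_0 = ρ_1 = 0`. -/
def rhoSeq (K : ℝ → ℝ → ℂ) (n : ℕ) : ℂ := if n < 2 then 0 else rho K n

lemma sigmaCoeff_zero (K : ℝ → ℝ → ℂ) : sigmaCoeff K 0 = 1 := by
  simp [sigmaCoeff]

section

variable {A : Type*} [CommRing A] [Algebra ℂ A]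

/-- The determinant of `qMatrix K (n+1)` with first column replaced by `v`. -/
def colDet (K : ℝ → ℝ → ℂ) (n : ℕ) (v : ℕ → A) : A :=
  (((qMatrix K (n + 1)).map (algebraMap ℂ A)).updateCol 0 fun i => v i).det

lemma qMatrix_succ_succ (K : ℝ → ℝ → ℂ) (n : ℕ) (i j : Fin n) :
    qMatrix K (n + 1) i.succ j.succ = qMatrix K n i j := by
  simp [qMatrix, Nat.sub_sub, add_comm 1]

lemma colDet_zero (K : ℝ → ℝ → ℂ) (v : ℕ → A) : colDet K 0 v = v 0 := by
  simp [colDet]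

/-- Laplace expansion along the top row, whose only possibly nonzero entries are `v 0` and the
superdiagonal entry `n + 1`. Deleting the top row and the first or second column reproduces a matrix
of the same kind, one size smaller. -/
lemma colDet_succ (K : ℝ → ℝ → ℂ) (n : ℕ) (v : ℕ → A) :
    colDet K (n + 1) v = v 0 * algebraMap ℂ A (qMatrix K (n + 1)).det
      - (n + 1 : A) * colDet K n (fun i => v (i + 1)) := by
  unfold colDet
  rw [Matrix.det_succ_row_zero, Fin.sum_univ_succ, Fin.sum_univ_succ]
  have hz : ∀ i : Fin n, (-1 : A) ^ (i.succ.succ : ℕ)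
      * (((qMatrix K (n + 1 + 1)).map (algebraMap ℂ A)).updateCol 0 fun i => v i) 0 i.succ.succ
      * ((((qMatrix K (n + 1 + 1)).map (algebraMap ℂ A)).updateCol 0 fun i => v i).submatrix
          Fin.succ i.succ.succ.succAbove).det = 0 := by
    intro i
    have : (((qMatrix K (n + 1 + 1)).map (algebraMap ℂ A)).updateCol 0 fun i => v i) 0
        i.succ.succ = 0 := by
      rw [Matrix.updateCol_ne (Fin.succ_ne_zero _)]
      simp [qMatrix]
    rw [this]; ring
  rw [Finset.sum_eq_zero fun i _ => hz i, add_zero, sub_eq_add_neg]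
  congr 1
  · have h1 : (((qMatrix K (n + 1 + 1)).map (algebraMap ℂ A)).updateCol 0 fun i => v i).submatrix
        Fin.succ (Fin.succAbove 0) = (algebraMap ℂ A).mapMatrix (qMatrix K (n + 1)) := by
      ext i j
      simp [qMatrix_succ_succ]
    rw [h1, ← RingHom.map_det]
    simp
  · have h1 : (((qMatrix K (n + 1 + 1)).map (algebraMap ℂ A)).updateCol 0 fun i => v i).submatrix
        Fin.succ (Fin.succAbove (Fin.succ 0)) =
        ((qMatrix K (n + 1)).map (algebraMap ℂ A)).updateCol 0 fun i => v (i + 1) := by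
      ext i j
      refine Fin.cases ?_ (fun j => ?_) j
      · simp
      · have h2 : Fin.succAbove (Fin.succ 0 : Fin (n + 1 + 1)) j.succ = j.succ.succ := by
          rw [Fin.succ_succAbove_succ]; simp
        rw [Matrix.submatrix_apply, h2, Matrix.updateCol_ne (Fin.succ_ne_zero _),
          Matrix.updateCol_ne (Fin.succ_ne_zero _), Matrix.map_apply, Matrix.map_apply,
          qMatrix_succ_succ]
    rw [h1]
    have h3 : (((qMatrix K (n + 1 + 1)).map (algebraMap ℂ A)).updateCol 0 fun i => v i) 0
        (Fin.succ 0) = (n + 1 : A) := by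
      rw [Matrix.updateCol_ne (Fin.succ_ne_zero _)]
      simp [qMatrix]
    rw [h3]; simp; ring

/-- Iterating the expansion turns the determinant into a convolution with the `σ`'s. The free column
serves two purposes: the column of power sums gives the recursion for `σ_n`, and the column of
powers of `X` gives `Δ_n`. -/
lemma colDet_eq (K : ℝ → ℝ → ℂ) (n : ℕ) (v : ℕ → A) :
    algebraMap ℂ A ((-1) ^ n / (n.factorial : ℂ)) * colDet K n v =
      ∑ p ∈ Finset.HasAntidiagonal.antidiagonal n, v p.1 * algebraMap ℂ A (sigmaCoeff K p.2) := by
  induction n generalizing v with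
  | zero => simp [colDet_zero, sigmaCoeff_zero]
  | succ n ih =>
    rw [Finset.Nat.sum_antidiagonal_succ, ← ih fun i => v (i + 1), colDet_succ, sigmaCoeff,
      map_mul, mul_sub]
    have h : algebraMap ℂ A ((-1) ^ (n + 1) / ((n + 1).factorial : ℂ)) * (n + 1 : A) =
        - algebraMap ℂ A ((-1) ^ n / (n.factorial : ℂ)) := by
      have : (n + 1 : A) = algebraMap ℂ A (n + 1) := by simp
      rw [this, ← map_mul, ← map_neg]
      congr 1
      rw [Nat.factorial_succ]
      have h1 : (n.factorial : ℂ) ≠ 0 := by exact_mod_cast n.factorial_ne_zero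
      have h2 : (n + 1 : ℂ) ≠ 0 := by exact_mod_cast n.succ_ne_zero
      push_cast
      field_simp
      ring
    rw [← mul_assoc _ (n + 1 : A), h]
    ring

end

/-- Newton's identities with first power sum zero. -/
lemma sigmaCoeff_rec (K : ℝ → ℝ → ℂ) (n : ℕ) :
    (n : ℂ) * sigmaCoeff K n =
      -∑ p ∈ Finset.HasAntidiagonal.antidiagonal n, rhoSeq K p.1 * sigmaCoeff K p.2 := by
  cases n with
  | zero => simp [rhoSeq]
  | succ n =>
    have h := colDet_eq (A := ℂ) K n fun i => rhoSeq K (i + 1)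
    -- The first column of `qMatrix K (n + 1)` is already `(ρ_1, …, ρ_{n+1})`; the zero diagonal
    -- agrees with the convention `ρ_1 = 0`.
    have h1 : colDet (A := ℂ) K n (fun i => rhoSeq K (i + 1)) = (qMatrix K (n + 1)).det := by
      unfold colDet
      congr 1
      ext i j
      refine Fin.cases ?_ (fun j => ?_) j
      · refine Fin.cases ?_ (fun i => ?_) i
        · simp [rhoSeq, qMatrix]
        · simp [rhoSeq, qMatrix]
      · rw [Matrix.updateCol_ne (Fin.succ_ne_zero _)]; simp
    rw [h1] at h
    simp only [Algebra.algebraMap_self, RingHom.id_apply] at h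
    rw [Finset.Nat.sum_antidiagonal_succ, ← h, sigmaCoeff, Nat.factorial_succ]
    have h1 : (n.factorial : ℂ) ≠ 0 := by exact_mod_cast n.factorial_ne_zero
    have h2 : (n + 1 : ℂ) ≠ 0 := by exact_mod_cast n.succ_ne_zero
    simp only [rhoSeq]
    push_cast
    field_simp
    simp
    ring

lemma deltaPoly_coeff (K : ℝ → ℝ → ℂ) {n j : ℕ} (hj : j ≤ n) :
    (deltaPoly K n).coeff j = sigmaCoeff K (n - j) := by
  have h : deltaPoly K n = _ := colDet_eq (A := ℂ[X]) K n fun i => X ^ i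
  rw [h, Polynomial.finsetSum_coeff, Finset.sum_eq_single (j, n - j)]
  · simp [Polynomial.algebraMap_eq]
  · rintro ⟨a, b⟩ hab hne
    rw [Finset.HasAntidiagonal.mem_antidiagonal] at hab
    rw [Polynomial.algebraMap_eq, mul_comm, Polynomial.coeff_C_mul_X_pow, if_neg]
    rintro rfl
    exact hne (by simp; omega)
  · intro hn
    exact (hn (by simp; omega)).elim

lemma nCoeff_eq (K : ℝ → ℝ → ℂ) (n : ℕ) (R R' : ℝ) :
    nCoeff K n R R' = ∑ p ∈ Finset.HasAntidiagonal.antidiagonal n, sigmaCoeff K p.2 * kerPow K p.1 R R' := by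
  rw [Finset.Nat.sum_antidiagonal_eq_sum_range_succ_mk, nCoeff]
  refine Finset.sum_congr rfl fun j hj => ?_
  rw [deltaPoly_coeff K (Nat.lt_succ_iff.1 (Finset.mem_range.1 hj))]

end

end NonlocalPotential

namespace NonlocalPotential

noncomputable section

/-! ### The modified determinant of a matrix -/

/-- Cauchy's estimate for the coefficients of an everywhere convergent power series. -/
lemma norm_coeff_le_of_hasSum {c : ℕ → ℂ} {f : ℂ → ℂ} (h : ∀ g, HasSum (fun n => c n * g ^ n) (f g))
    {r C : ℝ} (hr : 0 < r) (hC : ∀ g, ‖g‖ = r → ‖f g‖ ≤ C) (n : ℕ) : ‖c n‖ ≤ C / r ^ n := by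
  have hf : HasFPowerSeriesOnBall f (FormalMultilinearSeries.ofScalars ℂ c) 0 ⊤ := by
    refine ⟨?_, by simp, fun {y} _ => ?_⟩
    · refine le_of_eq (Eq.symm ?_)
      refine ENNReal.eq_top_of_forall_nnreal_le fun s => ?_
      refine FormalMultilinearSeries.le_radius_of_tendsto (l := 0) _ ?_
      have := (h (s : ℝ)).summable.tendsto_atTop_zero.norm
      simpa [FormalMultilinearSeries.ofScalars_norm] using this
    · simpa [FormalMultilinearSeries.ofScalars_apply_eq, mul_comm] using h y
  have hd : Differentiable ℂ f := by
    have := hf.differentiableOn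
    simpa [differentiableOn_univ] using this
  have h1 : (n.factorial : ℂ) * c n = iteratedDeriv n f 0 := by
    have := hf.factorial_smul (1 : ℂ) n
    rw [iteratedDeriv_eq_iteratedFDeriv, ← this]
    simp
  have h2 := Complex.norm_iteratedDeriv_le_of_forall_mem_sphere_norm_le n (c := 0) (C := C) hr
    hd.diffContOnCl fun z hz => hC z (by simpa using hz)
  rw [← h1, norm_mul, Complex.norm_natCast, mul_div_assoc] at h2
  exact le_of_mul_le_mul_left h2 (by exact_mod_cast n.factorial_pos)

section

variable {ι : Type*} [Fintype ι] [DecidableEq ι]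

open Matrix ComplexOrder in
-- On each eigenvalue this is `λ ≤ e^{λ-1}`, with `λ ≥ 0` so that absolute values do no harm.
lemma det_le_exp_trace_sub_one {P : Matrix ι ι ℂ} (hP : P.PosSemidef) :
    ‖P.det‖ ≤ Real.exp (P.trace.re - Fintype.card ι) := by
  rw [hP.1.det_eq_prod_eigenvalues, hP.1.trace_eq_sum_eigenvalues, norm_prod]
  calc ∏ i, ‖(hP.1.eigenvalues i : ℂ)‖ ≤ ∏ i, Real.exp (hP.1.eigenvalues i - 1) := by
        refine Finset.prod_le_prod (fun _ _ => norm_nonneg _) fun i _ => ?_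
        rw [Complex.norm_real, Real.norm_of_nonneg (hP.eigenvalues_nonneg i)]
        linarith [Real.add_one_le_exp (hP.1.eigenvalues i - 1)]
    _ = _ := by
        rw [← Real.exp_sum]
        congr 1
        simp [Finset.sum_sub_distrib]

open Matrix ComplexOrder in
/-- The Hilbert–Schmidt bound for the modified determinant `det (1 - A) exp (tr A)`. -/
lemma norm_det_mul_exp_trace_le (A : Matrix ι ι ℂ) :
    ‖(1 - A).det * Complex.exp A.trace‖ ≤ Real.exp ((∑ i, ∑ j, ‖A i j‖ ^ 2) / 2) := by
  -- The positive matrix `(1 - A)(1 - A)ᴴ` has determinant `|det(1 - A)|²`, and its trace exceeds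
  -- the dimension by `‖A‖² - 2 Re tr A`; the factor `exp(tr A)` cancels the last term.
  have h1 := det_le_exp_trace_sub_one (posSemidef_self_mul_conjTranspose (1 - A))
  have h2 : ((1 - A) * (1 - A)ᴴ).trace.re - Fintype.card ι
      = - 2 * A.trace.re + ∑ i, ∑ j, ‖A i j‖ ^ 2 := by
    have h3 : (A * Aᴴ).trace.re = ∑ i, ∑ j, ‖A i j‖ ^ 2 := by
      simp only [Matrix.trace, Matrix.diag_apply, Matrix.mul_apply, Matrix.conjTranspose_apply,
        Complex.re_sum]
      refine Finset.sum_congr rfl fun i _ => Finset.sum_congr rfl fun j _ => ?_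
      rw [Complex.star_def, Complex.mul_conj, Complex.normSq_eq_norm_sq, Complex.ofReal_re]
    have h4 : (1 - A) * (1 - A)ᴴ = 1 - A - Aᴴ + A * Aᴴ := by
      rw [Matrix.conjTranspose_sub, Matrix.conjTranspose_one]; noncomm_ring
    rw [h4, Matrix.trace_add, Matrix.trace_sub, Matrix.trace_sub, Matrix.trace_conjTranspose,
      Matrix.trace_one, Complex.add_re, h3]
    simp
    ring
  rw [h2, Matrix.det_mul, norm_mul, Matrix.det_conjTranspose, norm_star] at h1
  rw [norm_mul, Complex.norm_exp]
  refine le_of_sq_le_sq ?_ (Real.exp_pos _).le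
  calc (‖(1 - A).det‖ * Real.exp A.trace.re) ^ 2
      = (‖(1 - A).det‖ * ‖(1 - A).det‖) * Real.exp (2 * A.trace.re) := by
        rw [two_mul, Real.exp_add]; ring
    _ ≤ Real.exp (-2 * A.trace.re + ∑ i, ∑ j, ‖A i j‖ ^ 2) * Real.exp (2 * A.trace.re) := by
        gcongr
    _ = _ := by
        rw [← Real.exp_add, ← Real.exp_nat_mul]
        congr 1
        push_cast
        ring

open Matrix in
-- Jacobi's formula for the logarithmic derivative of `det(1 - xM)`. The argument `x` lies in an
-- arbitrary commutative `ℂ`-algebra so that it can be the formal variable, with the Neumann series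
-- as the inverse `B`. The linear coefficient in `Y` of `det(1 - (x + Y)M) = det(1 - xM) det(1 - Y B
-- M)` gives it.
lemma aeval_derivative_charpolyRev {R : Type*} [CommRing R] [Algebra ℂ R] (M : Matrix ι ι ℂ) (x : R)
    (B : Matrix ι ι R) (hB : (1 - x • M.map (algebraMap ℂ R)) * B = 1) :
    aeval x (derivative M.charpolyRev) =
      - (aeval x M.charpolyRev * (B * M.map (algebraMap ℂ R)).trace) := by
  set N : Matrix ι ι R := M.map (algebraMap ℂ R) with hN
  have hB' : B * (1 - x • N) = 1 := mul_eq_one_comm.1 hB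
  -- `det (1 - (x + Y) N)` as a polynomial in `Y`
  have key : taylor x (M.charpolyRev.map (algebraMap ℂ R)) =
      C (1 - x • N).det * (1 + (X : R[X]) • (-(B * N)).map C).det := by
    have e1 : taylor x (M.charpolyRev.map (algebraMap ℂ R)) =
        (1 - (X + C x : R[X]) • N.map C).det := by
      rw [charpolyRev]
      change (taylorAlgHom x : R[X] →+* R[X]) ((mapRingHom (algebraMap ℂ R)) _) = _
      rw [RingHom.map_det, RingHom.map_det]
      congr 1
      ext1 i j
      by_cases hij : i = j
      · subst hij; simp [hN, taylor_mul]; ring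
      · simp [hN, taylor_mul, hij]; ring
    have e2 : (1 - (X + C x : R[X]) • N.map C) =
        (1 - x • N).map C * (1 + (X : R[X]) • (-(B * N)).map C) := by
      have e3 : (1 - x • N).map C * (-(B * N)).map C = - N.map C := by
        rw [← Matrix.map_mul, Matrix.mul_neg, ← Matrix.mul_assoc, hB, Matrix.one_mul]
        ext i j; simp
      rw [Matrix.mul_add, Matrix.mul_one, Matrix.mul_smul, e3]
      ext1 i j
      by_cases hij : i = j
      · subst hij; simp; ring
      · simp [hij]; ring
    rw [e1, e2, Matrix.det_mul]
    congr 1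
    exact (RingHom.map_det C _).symm
  have h0 : aeval x M.charpolyRev = (1 - x • N).det := by
    have := congrArg (fun p => p.eval 0) key
    simp only [taylor_eval, zero_add, eval_mul, eval_C, eval_map_algebraMap] at this
    rw [this, ← coe_evalRingHom, RingHom.map_det]
    have h5 : (evalRingHom (0 : R)).mapMatrix (1 + (X : R[X]) • (-(B * N)).map C) = 1 := by
      ext1 i j
      by_cases hij : i = j
      · subst hij; simp
      · simp [hij]
    rw [h5, det_one, mul_one]
  have h1 := congrArg (fun p => p.coeff 1) key
  simp only [taylor_coeff_one, coeff_C_mul, coeff_det_one_add_X_smul_one, trace_neg] at h1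
  rw [derivative_map, eval_map_algebraMap] at h1
  rw [h1, h0]; ring

/-- The formal power series of `det (1 - g M) exp (g tr M)`. -/
def detSeries (M : Matrix ι ι ℂ) : PowerSeries ℂ :=
  (M.charpolyRev : PowerSeries ℂ) * PowerSeries.rescale M.trace (PowerSeries.exp ℂ)

lemma constantCoeff_detSeries (M : Matrix ι ι ℂ) : PowerSeries.coeff 0 (detSeries M) = 1 := by
  have : M.charpolyRev.coeff 0 = 1 := by
    rw [Polynomial.coeff_zero_eq_eval_zero, Matrix.eval_charpolyRev]
  simp [detSeries, PowerSeries.coeff_mul, this]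

/-- The logarithmic derivative of `det(1 - gM)` is `-∑ tr(M^{n+1}) g^n`; the exponential factor
contributes `tr M` and so deletes exactly the term `n = 0`. -/
lemma derivative_detSeries (M : Matrix ι ι ℂ) :
    PowerSeries.derivative ℂ (detSeries M) =
      - (PowerSeries.mk (fun n => if n = 0 then 0 else (M ^ (n + 1)).trace)) * detSeries M := by
  -- The Neumann series `∑ M^n g^n`, the formal inverse of `1 - gM`.
  set B : Matrix ι ι (PowerSeries ℂ) := Matrix.of fun i j => PowerSeries.mk fun n => (M ^ n) i j
  have hB : (1 - (PowerSeries.X : PowerSeries ℂ) • M.map (algebraMap ℂ (PowerSeries ℂ))) * B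
      = 1 := by
    rw [sub_mul, one_mul, Matrix.smul_mul]
    ext i j n
    cases n with
    | zero => by_cases hij : i = j <;> simp [B, Matrix.one_apply, hij]
    | succ n =>
      rw [Matrix.sub_apply, Matrix.smul_apply, map_sub, smul_eq_mul, PowerSeries.coeff_succ_X_mul,
        Matrix.mul_apply, map_sum]
      have h1 : ∀ k, PowerSeries.coeff n ((M.map (algebraMap ℂ (PowerSeries ℂ))) i k * B k j)
          = M i k * (M ^ n) k j := by
        intro k
        simp [B]
      simp only [h1]
      rw [← Matrix.mul_apply, ← pow_succ']
      by_cases hij : i = j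
      · subst hij; simp [B, PowerSeries.coeff_one]
      · simp [B, hij]
  have h := aeval_derivative_charpolyRev M PowerSeries.X B hB
  have h2 : ∀ p : ℂ[X], aeval (PowerSeries.X : PowerSeries ℂ) p = (p : PowerSeries ℂ) := by
    intro p
    induction p using Polynomial.induction_on' with
    | add p q hp hq => simp [hp, hq]
    | monomial n a =>
      rw [aeval_monomial]
      ext m
      simp [PowerSeries.coeff_X_pow, PowerSeries.coeff_monomial]
  rw [h2, h2] at h
  have h3 : (B * M.map (algebraMap ℂ (PowerSeries ℂ))).trace
      = PowerSeries.mk fun n => (M ^ (n + 1)).trace := by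
    ext n
    simp only [Matrix.trace, Matrix.diag_apply, Matrix.mul_apply, map_sum, PowerSeries.coeff_mk,
      pow_succ]
    refine Finset.sum_congr rfl fun i _ => Finset.sum_congr rfl fun j _ => ?_
    simp [B]
  have h4 : PowerSeries.derivative ℂ (PowerSeries.rescale M.trace (PowerSeries.exp ℂ))
      = PowerSeries.C M.trace * PowerSeries.rescale M.trace (PowerSeries.exp ℂ) := by
    ext n
    rw [PowerSeries.coeff_derivative, PowerSeries.coeff_C_mul, PowerSeries.coeff_rescale,
      PowerSeries.coeff_rescale, PowerSeries.coeff_exp, PowerSeries.coeff_exp, Nat.factorial_succ]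
    have h1 : (n.factorial : ℂ) ≠ 0 := by exact_mod_cast n.factorial_ne_zero
    have h2 : (n + 1 : ℂ) ≠ 0 := by exact_mod_cast n.succ_ne_zero
    simp
    field_simp
    ring
  have h5 : (PowerSeries.mk fun n => (M ^ (n + 1)).trace) = PowerSeries.C M.trace +
      PowerSeries.mk (fun n => if n = 0 then 0 else (M ^ (n + 1)).trace) := by
    ext n
    cases n with
    | zero => simp
    | succ n => simp
  rw [detSeries, Derivation.leibniz, h4, PowerSeries.derivative_coe, h, h3, h5]
  simp only [smul_eq_mul]
  ring

/-- Cauchy product of the polynomial `det(1 - gM)` with the exponential series. An everywhere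
convergent series is what Cauchy's coefficient estimate requires. -/
lemma hasSum_detSeries (M : Matrix ι ι ℂ) (g : ℂ) :
    HasSum (fun n => PowerSeries.coeff n (detSeries M) * g ^ n)
      ((1 - g • M).det * Complex.exp (g • M).trace) := by
  have h1 : HasSum (fun n => M.charpolyRev.coeff n * g ^ n) (1 - g • M).det := by
    have e : (1 - g • M).det = M.charpolyRev.eval g := by
      rw [Matrix.charpolyRev, ← coe_evalRingHom, RingHom.map_det]
      congr 1
      ext1 i j
      by_cases hij : i = j
      · subst hij; simp [mul_comm (M i i)]
      · simp [hij, mul_comm (M i j)]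
    rw [e, Polynomial.eval_eq_sum_range]
    refine hasSum_sum_of_ne_finset_zero fun n hn => ?_
    rw [Polynomial.coeff_eq_zero_of_natDegree_lt (by simpa using hn), zero_mul]
  have h2 : HasSum (fun n => PowerSeries.coeff n (PowerSeries.rescale M.trace (PowerSeries.exp ℂ))
      * g ^ n) (Complex.exp (g • M).trace) := by
    have := NormedSpace.expSeries_div_hasSum_exp (g * M.trace)
    rw [← Complex.exp_eq_exp_ℂ] at this
    rw [Matrix.trace_smul, smul_eq_mul]
    have e : (fun n => PowerSeries.coeff n (PowerSeries.rescale M.trace (PowerSeries.exp ℂ)) * g ^ n)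
        = fun n => (g * M.trace) ^ n / (n.factorial : ℂ) := by
      ext n
      rw [PowerSeries.coeff_rescale, PowerSeries.coeff_exp]
      simp
      ring
    rw [e]
    exact this
  have s1 := h1.summable.norm
  have s2 := h2.summable.norm
  have h3 := summable_norm_sum_mul_antidiagonal_of_summable_norm s1 s2
  have h4 := tsum_mul_tsum_eq_tsum_sum_antidiagonal_of_summable_norm s1 s2
  rw [h1.tsum_eq, h2.tsum_eq] at h4
  rw [h4]
  have e : (fun n => PowerSeries.coeff n (detSeries M) * g ^ n) = fun n =>
      ∑ p ∈ Finset.HasAntidiagonal.antidiagonal n, M.charpolyRev.coeff p.1 * g ^ p.1 *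
        (PowerSeries.coeff p.2 (PowerSeries.rescale M.trace (PowerSeries.exp ℂ)) * g ^ p.2) := by
    ext n
    rw [detSeries, PowerSeries.coeff_mul, Finset.sum_mul]
    refine Finset.sum_congr rfl fun p hp => ?_
    rw [← Finset.HasAntidiagonal.mem_antidiagonal.1 hp, pow_add, Polynomial.coeff_coe]
    ring
  rw [e]
  exact h3.of_norm.hasSum

end

end

end NonlocalPotential

namespace NonlocalPotential

noncomputable section

/-! ### Differentiability of series -/

section Series

variable {E F : Type*} [NormedAddCommGroup E] [NormedSpace ℂ E] [NormedAddCommGroup F]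
  [NormedSpace ℂ F]

/-- One-variable Cauchy estimate on the complex line `t ↦ x + t v`, with the circle `|t| = 1/‖v‖`
lying on the unit sphere about `x`. -/
lemma norm_fderiv_le_of_norm_le {f : E → F} (hf : Differentiable ℂ f) {x : E} {M : ℝ}
    (hM : ∀ y, ‖y - x‖ ≤ 1 → ‖f y‖ ≤ M) : ‖fderiv ℂ f x‖ ≤ M := by
  have hM0 : 0 ≤ M := (norm_nonneg _).trans (hM x (by simp))
  refine ContinuousLinearMap.opNorm_le_bound _ hM0 fun v => ?_
  rcases eq_or_ne v 0 with rfl | hv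
  · simp
  have hv' : 0 < ‖v‖ := norm_pos_iff.2 hv
  have hl : ∀ t : ℂ, HasDerivAt (fun t : ℂ => f (x + t • v)) (fderiv ℂ f (x + t • v) v) t := by
    intro t
    have h1 : HasDerivAt (fun t : ℂ => x + t • v) v t := by
      simpa using ((hasDerivAt_id t).smul_const v).const_add x
    exact (hf _).hasFDerivAt.comp_hasDerivAt t h1
  have h := Complex.norm_deriv_le_of_forall_mem_sphere_norm_le (c := 0) (R := ‖v‖⁻¹) (C := M)
    (f := fun t : ℂ => f (x + t • v)) (by positivity)
    (Differentiable.diffContOnCl fun t => (hl t).differentiableAt) fun z hz => hM _ (by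
      have : ‖z‖ = ‖v‖⁻¹ := by simpa using hz
      rw [add_sub_cancel_left, norm_smul, this, inv_mul_cancel₀ hv'.ne'])
  rw [(hl 0).deriv] at h
  simpa using h

/-- Weierstrass' theorem on a Banach space: a summable majorant for the terms on bounded sets
majorises their derivatives as well, by Cauchy's estimate. -/
lemma differentiable_tsum_of_norm_le [CompleteSpace F] {f : ℕ → E → F}
    (hf : ∀ n, Differentiable ℂ (f n))
    (hb : ∀ R : ℝ, ∃ u : ℕ → ℝ, Summable u ∧ ∀ n x, ‖x‖ ≤ R → ‖f n x‖ ≤ u n) :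
    Differentiable ℂ fun x => ∑' n, f n x := by
  intro x
  -- One unit of radius is for the ball about `x` on which the series is differentiated, one for
  -- Cauchy's estimate at its points.
  obtain ⟨u, hu, hbu⟩ := hb (‖x‖ + 2)
  have key := hasFDerivAt_tsum_of_isPreconnected (𝕜 := ℂ) (f := f) (f' := fun n => fderiv ℂ (f n))
    (x₀ := x) (x := x) hu (Metric.isOpen_ball (x := x) (ε := 1))
    (convex_ball x 1).isPreconnected (fun n y _ => (hf n y).hasFDerivAt)
    (fun n y hy => norm_fderiv_le_of_norm_le (hf n) fun z hz => hbu n z (by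
      rw [Metric.mem_ball, dist_eq_norm] at hy
      have e : z = (z - y) + (y - x) + x := by abel
      rw [e]
      linarith [norm_add₃_le (a := z - y) (b := y - x) (c := x)]))
    (Metric.mem_ball_self one_pos)
    (Summable.of_norm_bounded hu fun n => hbu n x (by linarith)) (Metric.mem_ball_self one_pos)
  exact key.differentiableAt

end Series

/-! ### The recursion of the modified determinant -/

/-- The coefficients of `exp (-∑ r_m g^m / m)`. -/
def smithies (r : ℕ → ℂ) : ℕ → ℂ
  | 0 => 1
  | n + 1 => -(1 / ((n : ℂ) + 1)) * ∑ i : Fin (n + 1), r (n + 1 - i) * smithies r i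

lemma sum_fin_eq_sum_antidiagonal {u : ℕ → ℂ} (v : ℕ → ℂ) (hu : u 0 = 0) (n : ℕ) :
    ∑ i : Fin (n + 1), u (n + 1 - i) * v i =
      ∑ p ∈ Finset.HasAntidiagonal.antidiagonal (n + 1), u p.1 * v p.2 := by
  rw [Finset.Nat.sum_antidiagonal_succ, hu, zero_mul, zero_add,
    ← Finset.Nat.sum_antidiagonal_swap, Finset.Nat.sum_antidiagonal_eq_sum_range_succ_mk,
    Finset.sum_range]
  refine Finset.sum_congr rfl fun i _ => ?_
  have : n + 1 - (i : ℕ) = n - i + 1 := by omega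
  simp [this]

lemma smithies_rec {r : ℕ → ℂ} (hr : r 0 = 0) (n : ℕ) :
    (n : ℂ) * smithies r n =
      -∑ p ∈ Finset.HasAntidiagonal.antidiagonal n, r p.1 * smithies r p.2 := by
  cases n with
  | zero => simp [hr]
  | succ n =>
    rw [← sum_fin_eq_sum_antidiagonal _ hr, smithies]
    have h2 : (n + 1 : ℂ) ≠ 0 := by exact_mod_cast n.succ_ne_zero
    push_cast
    field_simp

/-- The recursion and the initial value determine the sequence. Smithies' determinants and the
Taylor coefficients of `det(1 - gM) exp(g tr M)` are both identified in this way. -/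
lemma eq_smithies {r c : ℕ → ℂ} (hr : r 0 = 0) (h0 : c 0 = 1)
    (hc : ∀ n : ℕ, (n : ℂ) * c n =
      -∑ p ∈ Finset.HasAntidiagonal.antidiagonal n, r p.1 * c p.2) (n : ℕ) :
    c n = smithies r n := by
  induction n using Nat.strong_induction_on with
  | _ n ih =>
    cases n with
    | zero => rw [h0, smithies]
    | succ n =>
      have h2 : (n + 1 : ℂ) ≠ 0 := by exact_mod_cast n.succ_ne_zero
      have h3 := hc (n + 1)
      rw [← sum_fin_eq_sum_antidiagonal _ hr,
        Finset.sum_congr rfl fun (i : Fin (n + 1)) _ => by rw [ih i i.2]] at h3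
      rw [smithies]
      push_cast at h3
      field_simp
      linear_combination h3

/-- The recursion as the differential equation `X S' = -R S`, whose formal solution is `S = exp(-∑
r_m g^m / m)`. -/
lemma powerSeries_smithies {r : ℕ → ℂ} (hr : r 0 = 0) :
    PowerSeries.X * PowerSeries.derivative ℂ (PowerSeries.mk (smithies r)) =
      - (PowerSeries.mk r * PowerSeries.mk (smithies r)) := by
  ext n
  have h : PowerSeries.coeff n (-(PowerSeries.mk r * PowerSeries.mk (smithies r)))
      = n * smithies r n := by
    rw [map_neg, PowerSeries.coeff_mul, smithies_rec hr]
    simp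
  rw [h]
  cases n with
  | zero => simp
  | succ n =>
    rw [PowerSeries.coeff_succ_X_mul, PowerSeries.coeff_derivative, PowerSeries.coeff_mk]
    push_cast; ring

/-- Formally `S = exp(-∑ r_m g^m / m)`, so when each `r_m` varies at rate `m t_m` the series `S`
varies at rate `-T S`. The proof differentiates the recursion and checks that the coefficients of
`-T S` obey the result. -/
lemma hasDerivAt_smithies {r : ℕ → ℂ → ℂ} {t : ℕ → ℂ} {x : ℂ} (hr0 : ∀ z, r 0 z = 0)
    (ht : t 0 = 0) (hr : ∀ m : ℕ, HasDerivAt (r m) (m * t m) x) (n : ℕ) :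
    HasDerivAt (fun z => smithies (fun m => r m z) n)
      (-∑ p ∈ Finset.HasAntidiagonal.antidiagonal n, t p.1 * smithies (fun m => r m x) p.2) x := by
  set s : ℕ → ℂ := smithies fun m => r m x with hs
  set s' : ℕ → ℂ := fun n => -∑ p ∈ Finset.HasAntidiagonal.antidiagonal n, t p.1 * s p.2 with hs'
  induction n using Nat.strong_induction_on with
  | _ n ih =>
    cases n with
    | zero => simpa [smithies, ht] using hasDerivAt_const x (1 : ℂ)
    | succ n =>
      have h1 : HasDerivAt (fun z => smithies (fun m => r m z) (n + 1))
          (-(1 / ((n : ℂ) + 1)) * ∑ i : Fin (n + 1),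
            (((n + 1 - i : ℕ) : ℂ) * t (n + 1 - i) * s i + r (n + 1 - i) x * s' i)) x := by
        simp only [smithies]
        refine HasDerivAt.const_mul _ ?_
        refine HasDerivAt.fun_sum fun i _ => ?_
        exact (hr _).mul (ih i i.2)
      convert h1 using 1
      rw [Finset.sum_add_distrib,
        sum_fin_eq_sum_antidiagonal (u := fun m => (m : ℂ) * t m) s (by simp),
        sum_fin_eq_sum_antidiagonal (u := fun m => r m x) s' (hr0 x)]
      -- the identity `X (T S)' = X T' S - R (T S)` of formal power series
      have hS := powerSeries_smithies (r := fun m => r m x) (hr0 x)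
      set S : PowerSeries ℂ := PowerSeries.mk (smithies fun m => r m x) with hSd
      set R : PowerSeries ℂ := PowerSeries.mk fun m => r m x with hRd
      set T : PowerSeries ℂ := PowerSeries.mk t with hTd
      have hX : ∀ (f : PowerSeries ℂ) (m : ℕ),
          PowerSeries.coeff m (PowerSeries.X * PowerSeries.derivative ℂ f)
            = m * PowerSeries.coeff m f := by
        intro f m
        cases m with
        | zero => simp
        | succ m =>
          rw [PowerSeries.coeff_succ_X_mul, PowerSeries.coeff_derivative]
          push_cast; ring
      have key : PowerSeries.X * PowerSeries.derivative ℂ (T * S) =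
          (PowerSeries.X * PowerSeries.derivative ℂ T) * S - R * (T * S) := by
        rw [Derivation.leibniz, smul_eq_mul, smul_eq_mul]
        -- The equation `X S' = -R S` replaces the derivative of `S` in Leibniz' rule for `T S`.
        linear_combination T * hS
      have hTS : ∀ m, PowerSeries.coeff m (T * S) = - s' m := by
        intro m
        rw [PowerSeries.coeff_mul, hs']
        simp [hTd, hSd, hs]
      have key2 := congrArg (PowerSeries.coeff (n + 1)) key
      rw [hX, map_sub, hTS, PowerSeries.coeff_mul, PowerSeries.coeff_mul _ R] at key2
      simp only [hTS, hX, hRd] at key2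
      simp only [hTd, hSd, PowerSeries.coeff_mk] at key2
      have h2 : (n + 1 : ℂ) ≠ 0 := by exact_mod_cast n.succ_ne_zero
      change s' (n + 1) = _
      simp only [mul_neg, Finset.sum_neg_distrib] at key2
      push_cast at key2 ⊢
      rw [← hs] at key2
      field_simp
      linear_combination -key2

/-! ### Smithies' theory in an algebra with a trace -/

/-- The iterated power `a^{n+1}` for a bilinear product. -/
def powSucc {E : Type*} [NormedAddCommGroup E] [NormedSpace ℂ E] (mul : E →L[ℂ] E →L[ℂ] E) (a : E) :
    ℕ → E
  | 0 => a
  | n + 1 => mul a (powSucc mul a n)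

/-- A Banach space with the structure of the Hilbert–Schmidt operators: a product, the bilinear
form `tr a b = Tr (a b)`, and a dense set of elements that behave like matrices. -/
structure TraceAlgebra (E : Type) [NormedAddCommGroup E] [NormedSpace ℂ E] where
  mul : E →L[ℂ] E →L[ℂ] E
  tr : E →L[ℂ] E →L[ℂ] ℂ
  mul_assoc : ∀ a b c, mul (mul a b) c = mul a (mul b c)
  tr_comm : ∀ a b, tr a b = tr b a
  tr_mul : ∀ a b c, tr (mul a b) c = tr a (mul b c)
  exists_dual : ∀ a, ∃ b, ‖b‖ ≤ 1 ∧ ‖a‖ ≤ ‖tr a b‖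
  dense_matrix : Dense {a : E | ∃ (ι : Type) (_ : Fintype ι) (_ : DecidableEq ι) (M : Matrix ι ι ℂ),
    ∑ i, ∑ j, ‖M i j‖ ^ 2 ≤ ‖a‖ ^ 2 ∧ ∀ n, tr (powSucc mul a n) a = (M ^ (n + 2)).trace}

namespace TraceAlgebra

variable {E : Type} [NormedAddCommGroup E] [NormedSpace ℂ E] (T : TraceAlgebra E)

/-- `a^{n+1}`. -/
abbrev pow (a : E) (n : ℕ) : E := powSucc T.mul a n

/-- `Tr a^n` for `n ≥ 2`, and `0` for `n < 2`. -/
def rho (a : E) (n : ℕ) : ℂ := if n < 2 then 0 else T.tr (T.pow a (n - 2)) a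

/-- The coefficients of the modified determinant. -/
def sig (a : E) (n : ℕ) : ℂ := smithies (T.rho a) n

/-- The coefficients of the numerator of the truncated resolvent. -/
def num (a : E) (n : ℕ) : E :=
  ∑ p ∈ Finset.HasAntidiagonal.antidiagonal n, T.sig a p.2 • T.pow a p.1

lemma rho_zero (a : E) : T.rho a 0 = 0 := by simp [rho]

lemma sig_zero (a : E) : T.sig a 0 = 1 := by simp [sig, smithies]

lemma mul_pow_pow (a : E) (j k : ℕ) : T.mul (T.pow a j) (T.pow a k) = T.pow a (j + k + 1) := by
  induction j with
  | zero => simp [pow, powSucc]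
  | succ j ih =>
    have h : T.pow a (j + 1) = T.mul a (T.pow a j) := rfl
    rw [h, T.mul_assoc, ih, show j + 1 + k + 1 = (j + k + 1) + 1 by ring]
    rfl

lemma num_zero (a : E) : T.num a 0 = a := by simp [num, sig_zero, pow, powSucc]

/-- The resolvent equation `N = σ a + g a N`, coefficient by coefficient. -/
lemma num_succ (a : E) (n : ℕ) : T.num a (n + 1) = T.sig a (n + 1) • a + T.mul a (T.num a n) := by
  rw [num, Finset.Nat.sum_antidiagonal_succ, num, map_sum]
  congr 1
  refine Finset.sum_congr rfl fun p _ => ?_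
  rw [map_smul]
  rfl

lemma mul_num_comm (a : E) (n : ℕ) : T.mul (T.num a n) a = T.mul a (T.num a n) := by
  rw [num, map_sum, map_sum, sum_apply]
  refine Finset.sum_congr rfl fun p _ => ?_
  rw [map_smul, map_smul, smul_apply]
  congr 1
  exact (T.mul_pow_pow a p.1 0).trans (by rfl)

lemma differentiable_pow (n : ℕ) : Differentiable ℂ fun a => T.pow a n := by
  induction n with
  | zero => exact differentiable_id
  | succ n ih => exact (T.mul.differentiable.clm_apply ih)

lemma differentiable_rho (n : ℕ) : Differentiable ℂ fun a => T.rho a n := by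
  unfold rho
  split_ifs
  · exact differentiable_const _
  · exact (T.tr.differentiable.comp (T.differentiable_pow _)).clm_apply differentiable_id

lemma differentiable_sig (n : ℕ) : Differentiable ℂ fun a => T.sig a n := by
  induction n using Nat.strong_induction_on with
  | _ n ih =>
    cases n with
    | zero => simp only [sig_zero]; exact differentiable_const _
    | succ n =>
      simp only [sig, smithies]
      refine Differentiable.const_mul ?_ _
      exact Differentiable.fun_sum fun i _ => (T.differentiable_rho _).mul (ih i i.2)

lemma differentiable_num (n : ℕ) : Differentiable ℂ fun a => T.num a n := by
  unfold num
  exact Differentiable.fun_sum fun p _ => (T.differentiable_sig _).smul (T.differentiable_pow _)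

/-! ### Directional derivatives of the coefficients. -/

/-- The derivative of `a^{n+1}` in the direction `b`. -/
def dpow (a b : E) : ℕ → E
  | 0 => b
  | n + 1 => T.mul b (T.pow a n) + T.mul a (dpow a b n)

lemma hasDerivAt_pow (a b : E) (n : ℕ) :
    HasDerivAt (fun t : ℂ => T.pow (a + t • b) n) (T.dpow a b n) 0 := by
  have hl : HasDerivAt (fun t : ℂ => a + t • b) b 0 := by
    simpa using ((hasDerivAt_id (0 : ℂ)).smul_const b).const_add a
  induction n with
  | zero => exact hl
  | succ n ih =>
    have := (T.mul.hasFDerivAt.comp_hasDerivAt (0 : ℂ) hl).clm_apply ih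
    simp only [Function.comp, zero_smul, add_zero] at this
    exact this

/-- By cyclicity of the trace, the `j + 1` terms of Leibniz' rule all have the same trace against a
power of `a`. -/
lemma tr_dpow_pow (a b : E) (j k : ℕ) :
    T.tr (T.dpow a b j) (T.pow a k) = (j + 1) * T.tr (T.pow a (j + k)) b := by
  induction j generalizing k with
  | zero => simp [dpow, T.tr_comm b]
  | succ j ih =>
    rw [dpow, map_add, add_apply, T.tr_mul b, T.mul_pow_pow,
      T.tr_comm (T.mul a _), ← T.tr_mul]
    have h : T.mul (T.pow a k) a = T.pow a (k + 1) := T.mul_pow_pow a k 0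
    rw [h, T.tr_comm _ (T.dpow a b j), ih, T.tr_comm b,
      show j + (k + 1) = j + k + 1 by ring, show j + 1 + k = j + k + 1 by ring]
    push_cast; ring

lemma hasDerivAt_rho (a b : E) (n : ℕ) :
    HasDerivAt (fun t : ℂ => T.rho (a + t • b) n)
      (n * (if n < 2 then 0 else T.tr (T.pow a (n - 2)) b)) 0 := by
  unfold rho
  split_ifs with h
  · simpa using hasDerivAt_const (0 : ℂ) (0 : ℂ)
  · have hl : HasDerivAt (fun t : ℂ => a + t • b) b 0 := by
      simpa using ((hasDerivAt_id (0 : ℂ)).smul_const b).const_add a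
    obtain ⟨m, rfl⟩ := Nat.exists_eq_add_of_le (not_lt.1 h)
    have h1 := (T.tr.hasFDerivAt.comp_hasDerivAt (0 : ℂ) (T.hasDerivAt_pow a b m)).clm_apply hl
    have h2 := T.tr_dpow_pow a b m 0
    have h3 : T.pow a 0 = a := rfl
    rw [h3, add_zero] at h2
    rw [add_tsub_cancel_left]
    have e : T.tr (T.dpow a b m) (a + (0 : ℂ) • b) + T.tr (T.pow (a + (0 : ℂ) • b) m) b
        = ((2 + m : ℕ) : ℂ) * T.tr (T.pow a m) b := by
      rw [zero_smul, add_zero, h2]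
      push_cast; ring
    rw [← e]
    exact h1

/-- The numerator is the gradient of the determinant for the trace form. A bound on `σ_{n+2}` near
`a` thus controls `N_n`, with no separate determinant inequality for the numerator. The shift by two
comes from the absence of `ρ_0` and `ρ_1`. -/
lemma hasDerivAt_sig (a b : E) (n : ℕ) :
    HasDerivAt (fun t : ℂ => T.sig (a + t • b) (n + 2)) (-T.tr (T.num a n) b) 0 := by
  have h := hasDerivAt_smithies (r := fun m t => T.rho (a + t • b) m)
    (t := fun m => if m < 2 then 0 else T.tr (T.pow a (m - 2)) b) (x := 0)
    (fun z => T.rho_zero _) (by simp) (fun m => T.hasDerivAt_rho a b m) (n + 2)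
  rw [Finset.Nat.sum_antidiagonal_succ, Finset.Nat.sum_antidiagonal_succ] at h
  have e : T.tr (T.num a n) b = ∑ p ∈ Finset.HasAntidiagonal.antidiagonal n,
      T.tr (T.pow a p.1) b * T.sig a p.2 := by
    rw [num, map_sum, sum_apply]
    simp [mul_comm]
  rw [e]
  simpa [sig] using h

/-- Both sides are continuous in `a`, so the dense set of matrix-like elements suffices. There the
`σ_n` are the Taylor coefficients of `det(1 - gM) exp(g tr M)`, which is at most `exp(r²‖a‖²/2)` on
`|g| = r`. -/
lemma norm_sig_le (a : E) (n : ℕ) {r : ℝ} (hr : 0 < r) :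
    ‖T.sig a n‖ ≤ Real.exp ((r * ‖a‖) ^ 2 / 2) / r ^ n := by
  have hcl : IsClosed {a : E | ‖T.sig a n‖ ≤ Real.exp ((r * ‖a‖) ^ 2 / 2) / r ^ n} :=
    isClosed_le (T.differentiable_sig n).continuous.norm (by fun_prop)
  refine hcl.closure_subset_iff.2 ?_ (T.dense_matrix a)
  rintro a ⟨ι, _, _, M, hM, htr⟩
  -- Only traces of `M^n` with `n ≥ 2` enter the recursion, and these agree with the traces of the
  -- powers of `a`.
  have h1 : PowerSeries.coeff n (detSeries M) = T.sig a n := by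
    refine eq_smithies (c := fun n => PowerSeries.coeff n (detSeries M)) (T.rho_zero a)
      (constantCoeff_detSeries M) (fun n => ?_) n
    cases n with
    | zero => simp [rho_zero]
    | succ n =>
      have h := congrArg (PowerSeries.coeff n) (derivative_detSeries M)
      rw [PowerSeries.coeff_derivative, neg_mul, map_neg, PowerSeries.coeff_mul] at h
      rw [Finset.Nat.sum_antidiagonal_succ, T.rho_zero, zero_mul, zero_add, mul_comm]
      push_cast
      rw [h]
      congr 1
      refine Finset.sum_congr rfl fun p _ => ?_
      rw [PowerSeries.coeff_mk]
      congr 1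
      rcases p with ⟨i, j⟩
      cases i with
      | zero => simp [rho]
      | succ i => simp [rho, htr]
  show ‖T.sig a n‖ ≤ _
  rw [← h1]
  refine norm_coeff_le_of_hasSum (hasSum_detSeries M) hr (fun g hg => ?_) n
  refine (norm_det_mul_exp_trace_le (g • M)).trans (Real.exp_le_exp.2 ?_)
  have : ∑ i, ∑ j, ‖(g • M) i j‖ ^ 2 = r ^ 2 * ∑ i, ∑ j, ‖M i j‖ ^ 2 := by
    simp [Finset.mul_sum, mul_pow, hg]
  rw [this, mul_pow]
  gcongr

/-- Choose `b` in the unit ball detecting the norm of `N_n`; then `Tr(N_n b)` is, up to sign, the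
derivative of `σ_{n+2}` along `a + t b`. On the circle `|t| = 1` the argument has norm at most `‖a‖
+ 1`. -/
lemma norm_num_le (a : E) (n : ℕ) {r : ℝ} (hr : 0 < r) :
    ‖T.num a n‖ ≤ Real.exp ((r * (‖a‖ + 1)) ^ 2 / 2) / r ^ (n + 2) := by
  obtain ⟨b, hb, hab⟩ := T.exists_dual (T.num a n)
  refine hab.trans ?_
  have h := T.hasDerivAt_sig a b n
  rw [← norm_neg, ← h.deriv]
  have h1 := Complex.norm_deriv_le_of_forall_mem_sphere_norm_le (c := 0) (R := 1)
    (C := Real.exp ((r * (‖a‖ + 1)) ^ 2 / 2) / r ^ (n + 2))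
    (f := fun t : ℂ => T.sig (a + t • b) (n + 2)) one_pos
    (((T.differentiable_sig _).comp (by fun_prop :
      Differentiable ℂ fun t : ℂ => a + t • b)).diffContOnCl) fun z hz => ?_
  · simpa using h1
  · refine (T.norm_sig_le _ _ hr).trans ?_
    have : ‖a + z • b‖ ≤ ‖a‖ + 1 := by
      refine (norm_add_le _ _).trans ?_
      rw [norm_smul, show ‖z‖ = 1 by simpa using hz, one_mul]
      linarith
    gcongr

/-! ### The determinant and the numerator as entire functions of the pair `(a, g)`. -/

/-- `σ(a; g)`. -/
def sigma (p : E × ℂ) : ℂ := ∑' n, T.sig p.1 n * p.2 ^ n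

/-- `N(a; g)`. -/
def numer (p : E × ℂ) : E := ∑' n, p.2 ^ n • T.num p.1 n

lemma exists_bound_sig (R : ℝ) : ∃ u : ℕ → ℝ, Summable u ∧
    ∀ n, ∀ p : E × ℂ, ‖p‖ ≤ R → ‖T.sig p.1 n * p.2 ^ n‖ ≤ u n := by
  -- The Cauchy radius is twice the bound used for `|g|`, so the terms decay like `2^{-n}`. The
  -- absolute value covers negative `R`.
  set r : ℝ := 2 * (|R| + 1) with hr
  have hr0 : 0 < r := by positivity
  refine ⟨fun n => Real.exp ((r * |R|) ^ 2 / 2) * (1 / 2) ^ n,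
    (summable_geometric_two).mul_left _, fun n p hp => ?_⟩
  have h1 : ‖p.1‖ ≤ |R| := (norm_fst_le p).trans (hp.trans (le_abs_self R))
  have h2 : ‖p.2‖ ≤ |R| + 1 := by linarith [(norm_snd_le p).trans (hp.trans (le_abs_self R))]
  rw [norm_mul, norm_pow]
  calc ‖T.sig p.1 n‖ * ‖p.2‖ ^ n
      ≤ (Real.exp ((r * |R|) ^ 2 / 2) / r ^ n) * (|R| + 1) ^ n := by
        refine mul_le_mul ((T.norm_sig_le p.1 n hr0).trans ?_) (by gcongr) (by positivity)
          (by positivity)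
        gcongr
    _ = _ := by
        rw [hr, mul_pow 2]
        have : (|R| + 1) ^ n ≠ 0 := by positivity
        field_simp
        rw [← mul_pow]; norm_num

lemma exists_bound_num (R : ℝ) : ∃ u : ℕ → ℝ, Summable u ∧
    ∀ n, ∀ p : E × ℂ, ‖p‖ ≤ R → ‖p.2 ^ n • T.num p.1 n‖ ≤ u n := by
  set r : ℝ := 2 * (|R| + 1) with hr
  have hr0 : 0 < r := by positivity
  refine ⟨fun n => Real.exp ((r * (|R| + 1)) ^ 2 / 2) * (1 / 2) ^ n,
    (summable_geometric_two).mul_left _, fun n p hp => ?_⟩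
  have h1 : ‖p.1‖ ≤ |R| := (norm_fst_le p).trans (hp.trans (le_abs_self R))
  have h2 : ‖p.2‖ ≤ |R| + 1 := by linarith [(norm_snd_le p).trans (hp.trans (le_abs_self R))]
  rw [norm_smul, norm_pow]
  calc ‖p.2‖ ^ n * ‖T.num p.1 n‖
      ≤ (|R| + 1) ^ n * (Real.exp ((r * (|R| + 1)) ^ 2 / 2) / r ^ n) := by
        refine mul_le_mul (by gcongr) ((T.norm_num_le p.1 n hr0).trans ?_) (by positivity)
          (by positivity)
        -- With `r ≥ 1`, the denominator `r^{n+2}` may be weakened to `r^n`.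
        have hr1 : 1 ≤ r := by rw [hr]; linarith [abs_nonneg R]
        gcongr
        exact Nat.le_add_right n 2
    _ = _ := by
        rw [hr, mul_pow 2]
        have : (|R| + 1) ^ n ≠ 0 := by positivity
        field_simp
        rw [← mul_pow]; norm_num

lemma summable_sigma (a : E) (g : ℂ) : Summable fun n => T.sig a n * g ^ n := by
  obtain ⟨u, hu, h⟩ := T.exists_bound_sig ‖(a, g)‖
  exact Summable.of_norm_bounded hu fun n => h n (a, g) le_rfl

lemma differentiable_sigma : Differentiable ℂ T.sigma :=
  differentiable_tsum_of_norm_le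
    (fun n => ((T.differentiable_sig n).comp differentiable_fst).mul (differentiable_snd.pow n))
    T.exists_bound_sig

lemma sigma_zero_left (g : ℂ) : T.sigma (0, g) = 1 := by
  have h : ∀ n, T.rho (0 : E) n = 0 := by
    intro n
    simp [rho]
  rw [sigma, tsum_eq_single 0]
  · simp [sig_zero]
  · intro n hn
    obtain ⟨m, rfl⟩ := Nat.exists_eq_succ_of_ne_zero hn
    simp [sig, smithies, h]

variable [CompleteSpace E]

lemma summable_numer (a : E) (g : ℂ) : Summable fun n => g ^ n • T.num a n := by
  obtain ⟨u, hu, h⟩ := T.exists_bound_num ‖(a, g)‖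
  exact Summable.of_norm_bounded hu fun n => h n (a, g) le_rfl

lemma differentiable_numer : Differentiable ℂ T.numer :=
  differentiable_tsum_of_norm_le
    (fun n => (differentiable_snd.pow n).smul ((T.differentiable_num n).comp differentiable_fst))
    T.exists_bound_num

/-- Divided by `σ`, this is the resolvent equation for `N / σ`; it is the sum over `n` of
`num_succ`. -/
lemma numer_eq (a : E) (g : ℂ) :
    T.numer (a, g) = T.sigma (a, g) • a + g • T.mul a (T.numer (a, g)) := by
  have h1 : ∑' n, (T.sig a n * g ^ n) • a = T.sigma (a, g) • a :=
    (T.summable_sigma a g).tsum_smul_const a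
  have h2 : T.mul a (T.numer (a, g)) = ∑' n, g ^ n • T.mul a (T.num a n) := by
    rw [numer, ContinuousLinearMap.map_tsum _ (T.summable_numer a g)]
    simp
  have s2 : Summable fun n => g ^ n • T.mul a (T.num a n) := by
    have := (T.mul a).summable (T.summable_numer a g)
    simpa using this
  have s1 := (T.summable_sigma a g).smul_const a
  rw [← h1, h2, ← tsum_const_smul'' g, numer, (T.summable_numer a g).tsum_eq_zero_add,
    s1.tsum_eq_zero_add, add_assoc,
    ← ((summable_nat_add_iff 1).2 s1).tsum_add (s2.const_smul g)]
  congr 1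
  · simp [num_zero, sig_zero]
  · refine tsum_congr fun n => ?_
    rw [num_succ, smul_add, smul_smul, smul_smul, mul_comm, pow_succ' g n]

lemma mul_numer_comm (a : E) (g : ℂ) : T.mul (T.numer (a, g)) a = T.mul a (T.numer (a, g)) := by
  have h := T.summable_numer a g
  have h1 : T.mul (T.numer (a, g)) a = T.mul.flip a (T.numer (a, g)) := rfl
  rw [h1, numer, ContinuousLinearMap.map_tsum _ h, ContinuousLinearMap.map_tsum _ h]
  simp [mul_num_comm]

end TraceAlgebra

end

end NonlocalPotential

namespace NonlocalPotential

noncomputable section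

/-! ### The composition of kernels -/

variable {ε α : ℝ}

instance : SigmaFinite halfLine := by unfold halfLine; infer_instance

lemma muX_prod_ac : (muX ε α).prod (muInv ε α) ≪ halfLine.prod halfLine :=
  (muX_ac_halfLine ε α).prod (muInv_ac_halfLine ε α)

lemma ac_muX_prod : halfLine.prod halfLine ≪ (muX ε α).prod (muInv ε α) :=
  (halfLine_ac_muX ε α).prod (halfLine_ac_muInv ε α)

/-- The kernel of the product of two integral operators. -/
def compFn (f g : ℝ × ℝ → ℂ) (p : ℝ × ℝ) : ℂ := ∫ s, f (p.1, s) * g (s, p.2) ∂halfLine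

lemma aestronglyMeasurable_comp_integrand {f g : ℝ × ℝ → ℂ}
    (hf : AEStronglyMeasurable f (halfLine.prod halfLine))
    (hg : AEStronglyMeasurable g (halfLine.prod halfLine)) :
    AEStronglyMeasurable (fun q : (ℝ × ℝ) × ℝ => f (q.1.1, q.2) * g (q.2, q.1.2))
      ((halfLine.prod halfLine).prod halfLine) := by
  have h1 : Measure.QuasiMeasurePreserving (Prod.map Prod.fst id : (ℝ × ℝ) × ℝ → ℝ × ℝ)
      ((halfLine.prod halfLine).prod halfLine) (halfLine.prod halfLine) :=
    MeasureTheory.QuasiMeasurePreserving.prodMap Measure.quasiMeasurePreserving_fst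
      (Measure.QuasiMeasurePreserving.id _)
  have h2 : Measure.QuasiMeasurePreserving (Prod.map Prod.snd id : (ℝ × ℝ) × ℝ → ℝ × ℝ)
      ((halfLine.prod halfLine).prod halfLine) (halfLine.prod halfLine) :=
    MeasureTheory.QuasiMeasurePreserving.prodMap Measure.quasiMeasurePreserving_snd
      (Measure.QuasiMeasurePreserving.id _)
  exact (hf.comp_quasiMeasurePreserving h1).mul (hg.prod_swap.comp_quasiMeasurePreserving h2)

lemma aestronglyMeasurable_compFn {f g : ℝ × ℝ → ℂ}
    (hf : AEStronglyMeasurable f (halfLine.prod halfLine))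
    (hg : AEStronglyMeasurable g (halfLine.prod halfLine)) :
    AEStronglyMeasurable (compFn f g) (halfLine.prod halfLine) :=
  (aestronglyMeasurable_comp_integrand hf hg).integral_prod_right'

/-- A null set of the plane has null rows and null columns for almost every pair of coordinates, so
composition descends to classes modulo null sets. -/
lemma compFn_congr {f f' g g' : ℝ × ℝ → ℂ} (hf : f =ᵐ[halfLine.prod halfLine] f')
    (hg : g =ᵐ[halfLine.prod halfLine] g') :
    compFn f g =ᵐ[halfLine.prod halfLine] compFn f' g' := by
  have h1 := Measure.quasiMeasurePreserving_fst (μ := halfLine) (ν := halfLine) |>.ae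
    (Measure.ae_ae_of_ae_prod hf)
  have hs : ∀ᵐ p : ℝ × ℝ ∂halfLine.prod halfLine, g p.swap = g' p.swap :=
    Measure.measurePreserving_swap.quasiMeasurePreserving.ae hg
  have h2 := Measure.quasiMeasurePreserving_snd (μ := halfLine) (ν := halfLine) |>.ae
    (Measure.ae_ae_of_ae_prod hs)
  filter_upwards [h1, h2] with p hp1 hp2
  refine integral_congr_ae ?_
  filter_upwards [hp1, hp2] with s h3 h4
  simp only [Prod.swap_prod_mk] at h4
  rw [h3, h4]

/-- The norm of the row `K(R,·)`. -/
def rowNorm (ε α : ℝ) (f : ℝ × ℝ → ℂ) (R : ℝ) : ℝ≥0∞ :=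
  eLpNorm (fun s => f (R, s)) 2 (muInv ε α)

/-- The norm of the column `K(·,R')`. -/
def colNorm (ε α : ℝ) (f : ℝ × ℝ → ℂ) (R' : ℝ) : ℝ≥0∞ :=
  eLpNorm (fun s => f (s, R')) 2 (muX ε α)

lemma two_ne_zero_top : (2 : ℝ≥0∞) ≠ 0 ∧ (2 : ℝ≥0∞) ≠ ∞ := by simp

lemma eLpNorm_two_sq {β : Type*} {m : MeasurableSpace β} (μ : Measure β) (f : β → ℂ) :
    eLpNorm f 2 μ ^ (2 : ℝ) = ∫⁻ x, ‖f x‖ₑ ^ (2 : ℝ) ∂μ := by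
  rw [eLpNorm_eq_lintegral_rpow_enorm_toReal two_ne_zero_top.1 two_ne_zero_top.2,
    ← ENNReal.rpow_mul]
  norm_num

lemma lintegral_rowNorm {f : ℝ × ℝ → ℂ}
    (hf : AEStronglyMeasurable f ((muX ε α).prod (muInv ε α))) :
    ∫⁻ R, rowNorm ε α f R ^ (2 : ℝ) ∂(muX ε α) =
      eLpNorm f 2 ((muX ε α).prod (muInv ε α)) ^ (2 : ℝ) := by
  simp only [rowNorm, eLpNorm_two_sq]
  rw [lintegral_prod _ (hf.enorm.pow_const _)]

lemma lintegral_colNorm {f : ℝ × ℝ → ℂ}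
    (hf : AEStronglyMeasurable f ((muX ε α).prod (muInv ε α))) :
    ∫⁻ R, colNorm ε α f R ^ (2 : ℝ) ∂(muInv ε α) =
      eLpNorm f 2 ((muX ε α).prod (muInv ε α)) ^ (2 : ℝ) := by
  simp only [colNorm, eLpNorm_two_sq]
  rw [lintegral_prod_symm _ (hf.enorm.pow_const _)]

/-- Cauchy–Schwarz with dual weights: rows of kernels lie in `L²(μ⁻¹ dR)`, columns in `L²(μ dR)`.
The product form of the bound gives both submultiplicativity of the norm and almost everywhere
absolute convergence of the composition integral. -/
lemma lintegral_comp_le {f g : ℝ × ℝ → ℂ}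
    (hf : AEStronglyMeasurable f (halfLine.prod halfLine))
    (hg : AEStronglyMeasurable g (halfLine.prod halfLine)) :
    ∀ᵐ p ∂halfLine.prod halfLine, ∫⁻ s, ‖f (p.1, s) * g (s, p.2)‖ₑ ∂halfLine ≤
      rowNorm ε α f p.1 * colNorm ε α g p.2 := by
  have h1 := Measure.quasiMeasurePreserving_fst (μ := halfLine) (ν := halfLine) |>.ae hf.prodMk_left
  have h2 := Measure.quasiMeasurePreserving_snd (μ := halfLine) (ν := halfLine) |>.ae
    hg.prod_swap.prodMk_left
  filter_upwards [h1, h2] with p hp1 hp2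
  exact schwarz ε α _ _ hp1 hp2

lemma aemeasurable_rowNorm {f : ℝ × ℝ → ℂ}
    (hf : AEStronglyMeasurable f ((muX ε α).prod (muInv ε α))) :
    AEMeasurable (rowNorm ε α f) (muX ε α) := by
  unfold rowNorm
  simp only [eLpNorm_eq_lintegral_rpow_enorm_toReal two_ne_zero_top.1 two_ne_zero_top.2]
  refine AEMeasurable.pow_const ?_ _
  exact AEMeasurable.lintegral_prod_right' (f := fun p : ℝ × ℝ => ‖f p‖ₑ ^ (2 : ℝ≥0∞).toReal)
    (hf.enorm.pow_const _)

lemma aemeasurable_colNorm {f : ℝ × ℝ → ℂ}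
    (hf : AEStronglyMeasurable f ((muX ε α).prod (muInv ε α))) :
    AEMeasurable (colNorm ε α f) (muInv ε α) := by
  unfold colNorm
  simp only [eLpNorm_eq_lintegral_rpow_enorm_toReal two_ne_zero_top.1 two_ne_zero_top.2]
  refine AEMeasurable.pow_const ?_ _
  exact AEMeasurable.lintegral_prod_left' (f := fun p : ℝ × ℝ => ‖f p‖ₑ ^ (2 : ℝ≥0∞).toReal)
    (hf.enorm.pow_const _)

lemma eLpNorm_compFn_le {f g : ℝ × ℝ → ℂ}
    (hf : AEStronglyMeasurable f ((muX ε α).prod (muInv ε α)))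
    (hg : AEStronglyMeasurable g ((muX ε α).prod (muInv ε α))) :
    eLpNorm (compFn f g) 2 ((muX ε α).prod (muInv ε α)) ≤
      eLpNorm f 2 ((muX ε α).prod (muInv ε α)) * eLpNorm g 2 ((muX ε α).prod (muInv ε α)) := by
  refine (ENNReal.rpow_le_rpow_iff (z := 2) (by norm_num)).1 ?_
  rw [ENNReal.mul_rpow_of_nonneg _ _ (by norm_num), ← lintegral_rowNorm hf, ← lintegral_colNorm hg,
    eLpNorm_two_sq, ← lintegral_prod_mul ((aemeasurable_rowNorm hf).pow_const _)
      ((aemeasurable_colNorm hg).pow_const _)]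
  refine lintegral_mono_ae (muX_prod_ac.ae_le ?_)
  filter_upwards [lintegral_comp_le (ε := ε) (α := α) (hf.mono_ac ac_muX_prod)
    (hg.mono_ac ac_muX_prod)] with p hp
  rw [← ENNReal.mul_rpow_of_nonneg _ _ (by norm_num)]
  exact ENNReal.rpow_le_rpow ((enorm_integral_le_lintegral_enorm _).trans hp) (by norm_num)

lemma memLp_compFn {f g : ℝ × ℝ → ℂ} (hf : MemLp f 2 ((muX ε α).prod (muInv ε α)))
    (hg : MemLp g 2 ((muX ε α).prod (muInv ε α))) :
    MemLp (compFn f g) 2 ((muX ε α).prod (muInv ε α)) :=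
  ⟨(aestronglyMeasurable_compFn (hf.1.mono_ac ac_muX_prod) (hg.1.mono_ac ac_muX_prod)).mono_ac
      muX_prod_ac,
    (eLpNorm_compFn_le hf.1 hg.1).trans_lt (ENNReal.mul_lt_top hf.2 hg.2)⟩

lemma ae_integrable_comp {f g : ℝ × ℝ → ℂ} (hf : MemLp f 2 ((muX ε α).prod (muInv ε α)))
    (hg : MemLp g 2 ((muX ε α).prod (muInv ε α))) :
    ∀ᵐ p ∂halfLine.prod halfLine, Integrable (fun s => f (p.1, s) * g (s, p.2)) halfLine := by
  have hf' := hf.1.mono_ac ac_muX_prod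
  have hg' := hg.1.mono_ac ac_muX_prod
  have h1 : ∀ᵐ R ∂muX ε α, rowNorm ε α f R ^ (2 : ℝ) < ∞ := by
    refine ae_lt_top' ((aemeasurable_rowNorm hf.1).pow_const _) ?_
    rw [lintegral_rowNorm hf.1]
    exact ENNReal.rpow_ne_top_of_nonneg (by norm_num) hf.2.ne
  have h2 : ∀ᵐ R ∂muInv ε α, colNorm ε α g R ^ (2 : ℝ) < ∞ := by
    refine ae_lt_top' ((aemeasurable_colNorm hg.1).pow_const _) ?_
    rw [lintegral_colNorm hg.1]
    exact ENNReal.rpow_ne_top_of_nonneg (by norm_num) hg.2.ne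
  have h3 := Measure.quasiMeasurePreserving_fst (μ := halfLine) (ν := halfLine) |>.ae
    ((halfLine_ac_muX ε α).ae_le h1)
  have h4 := Measure.quasiMeasurePreserving_snd (μ := halfLine) (ν := halfLine) |>.ae
    ((halfLine_ac_muInv ε α).ae_le h2)
  filter_upwards [lintegral_comp_le (ε := ε) (α := α) hf' hg', h3, h4,
    (aestronglyMeasurable_comp_integrand hf' hg').prodMk_left] with p hp hp3 hp4 hm
  refine ⟨hm, hp.trans_lt (ENNReal.mul_lt_top ?_ ?_)⟩
  · exact (ENNReal.rpow_lt_top_iff_of_pos (by norm_num)).1 hp3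
  · exact (ENNReal.rpow_lt_top_iff_of_pos (by norm_num)).1 hp4

/-- The product of two Hilbert–Schmidt kernels. -/
def comp (a b : HSSp ε α) : HSSp ε α := (memLp_compFn (Lp.memLp a) (Lp.memLp b)).toLp _

lemma coeFn_comp (a b : HSSp ε α) : comp a b =ᵐ[halfLine.prod halfLine] compFn a b :=
  ac_muX_prod.ae_le (MemLp.coeFn_toLp _)

lemma norm_comp_le (a b : HSSp ε α) : ‖comp a b‖ ≤ ‖a‖ * ‖b‖ := by
  rw [comp, Lp.norm_toLp, Lp.norm_def, Lp.norm_def, ← ENNReal.toReal_mul]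
  exact ENNReal.toReal_mono (ENNReal.mul_ne_top (Lp.eLpNorm_ne_top a) (Lp.eLpNorm_ne_top b))
    (eLpNorm_compFn_le (Lp.aestronglyMeasurable a) (Lp.aestronglyMeasurable b))

lemma HS_ext {a b : HSSp ε α} (h : a =ᵐ[halfLine.prod halfLine] b) : a = b :=
  Lp.ext (muX_prod_ac.ae_le h)

lemma HS_coeFn_add (a b : HSSp ε α) :
    (a + b : HSSp ε α) =ᵐ[halfLine.prod halfLine] fun p => a p + b p :=
  ac_muX_prod.ae_le (Lp.coeFn_add a b)

lemma HS_coeFn_smul (c : ℂ) (a : HSSp ε α) :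
    (c • a : HSSp ε α) =ᵐ[halfLine.prod halfLine] fun p => c * a p :=
  ac_muX_prod.ae_le (Lp.coeFn_smul c a)

/-- The product of Hilbert–Schmidt kernels as a bounded bilinear map. -/
def compL (ε α : ℝ) : HSSp ε α →L[ℂ] HSSp ε α →L[ℂ] HSSp ε α :=
  LinearMap.mkContinuous₂
    (LinearMap.mk₂ ℂ (comp (ε := ε) (α := α))
      (by
        intro a b c
        refine HS_ext ?_
        filter_upwards [coeFn_comp (a + b) c, HS_coeFn_add (comp a c) (comp b c), coeFn_comp a c,
          coeFn_comp b c, compFn_congr (HS_coeFn_add a b) (EventuallyEq.refl _ c),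
          ae_integrable_comp (Lp.memLp a) (Lp.memLp c),
          ae_integrable_comp (Lp.memLp b) (Lp.memLp c)] with p h1 h2 h3 h4 h5 h6 h7
        rw [h1, h2, h3, h4, h5]
        simp only [compFn]
        rw [← integral_add h6 h7]
        simp only [add_mul])
      (by
        intro c a b
        refine HS_ext ?_
        filter_upwards [coeFn_comp (c • a) b, HS_coeFn_smul c (comp a b), coeFn_comp a b,
          compFn_congr (HS_coeFn_smul c a) (EventuallyEq.refl _ b)] with p h1 h2 h3 h5
        rw [h1, h2, h3, h5]
        simp only [compFn]
        rw [← integral_const_mul]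
        simp only [mul_assoc])
      (by
        intro c a b
        refine HS_ext ?_
        filter_upwards [coeFn_comp c (a + b), HS_coeFn_add (comp c a) (comp c b), coeFn_comp c a,
          coeFn_comp c b, compFn_congr (EventuallyEq.refl _ c) (HS_coeFn_add a b),
          ae_integrable_comp (Lp.memLp c) (Lp.memLp a),
          ae_integrable_comp (Lp.memLp c) (Lp.memLp b)] with p h1 h2 h3 h4 h5 h6 h7
        rw [h1, h2, h3, h4, h5]
        simp only [compFn]
        rw [← integral_add h6 h7]
        simp only [mul_add])
      (by
        intro c a b
        refine HS_ext ?_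
        filter_upwards [coeFn_comp a (c • b), HS_coeFn_smul c (comp a b), coeFn_comp a b,
          compFn_congr (EventuallyEq.refl _ a) (HS_coeFn_smul c b)] with p h1 h2 h3 h5
        rw [h1, h2, h3, h5]
        simp only [compFn]
        rw [← integral_const_mul]
        simp only [mul_left_comm]))
    1 (fun a b => by simpa using norm_comp_le a b)

lemma compL_apply (a b : HSSp ε α) : compL ε α a b = comp a b := rfl

/-! ### The adjoint kernel and the trace form -/

/-- The adjoint kernel. -/
def adjFn (ε α : ℝ) (f : ℝ × ℝ → ℂ) (p : ℝ × ℝ) : ℂ :=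
  starRingEnd ℂ (f p.swap) * ((dens ε α p.2).toReal / (dens ε α p.1).toReal : ℝ)

lemma muX_prod_eq : (muX ε α).prod (muInv ε α) =
    (halfLine.prod halfLine).withDensity fun p => dens ε α p.1 * (dens ε α p.2)⁻¹ :=
  prod_withDensity (dens_measurable ε α) (dens_measurable ε α).inv

lemma ae_pos_prod : ∀ᵐ p : ℝ × ℝ ∂halfLine.prod halfLine, 0 < p.1 ∧ 0 < p.2 := by
  filter_upwards [Measure.quasiMeasurePreserving_fst.ae ae_halfLine_pos,
    Measure.quasiMeasurePreserving_snd.ae ae_halfLine_pos] with p h1 h2 using ⟨h1, h2⟩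

lemma measurable_ratio : Measurable fun p : ℝ × ℝ => dens ε α p.1 * (dens ε α p.2)⁻¹ :=
  ((dens_measurable ε α).comp measurable_fst).mul ((dens_measurable ε α).comp measurable_snd).inv

lemma dens_toReal_pos {R : ℝ} (hR : 0 < R) : 0 < (dens ε α R).toReal :=
  ENNReal.toReal_pos (dens_ne_zero ε α hR) (dens_ne_top ε α R)

lemma integral_muX_prod (f : ℝ × ℝ → ℂ) : ∫ p, f p ∂((muX ε α).prod (muInv ε α)) =
    ∫ p, (((dens ε α p.1).toReal / (dens ε α p.2).toReal : ℝ) : ℂ) * f p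
      ∂(halfLine.prod halfLine) := by
  rw [muX_prod_eq, integral_withDensity_eq_integral_toReal_smul measurable_ratio]
  · refine integral_congr_ae (Eventually.of_forall fun p => ?_)
    simp [ENNReal.toReal_mul, ENNReal.toReal_inv, div_eq_mul_inv]
  · filter_upwards [ae_pos_prod] with p hp
    exact ENNReal.mul_lt_top (dens_ne_top ε α _).lt_top
      (ENNReal.inv_lt_top.2 (pos_iff_ne_zero.2 (dens_ne_zero ε α hp.2)))

/-- The squared ratio of densities in the adjoint turns the weight `μ(R)/μ(R')` into that of the
swapped variables. -/
lemma eLpNorm_adjFn {f : ℝ × ℝ → ℂ} (hf : AEStronglyMeasurable f (halfLine.prod halfLine)) :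
    eLpNorm (adjFn ε α f) 2 ((muX ε α).prod (muInv ε α)) =
      eLpNorm f 2 ((muX ε α).prod (muInv ε α)) := by
  have hd : Measurable fun p : ℝ × ℝ => ((dens ε α p.2).toReal / (dens ε α p.1).toReal : ℝ) :=
    ((dens_measurable ε α).comp measurable_snd).ennreal_toReal.div
      ((dens_measurable ε α).comp measurable_fst).ennreal_toReal
  have ha : AEStronglyMeasurable (adjFn ε α f) (halfLine.prod halfLine) := by
    refine AEStronglyMeasurable.mul ?_ (Complex.measurable_ofReal.comp hd).aestronglyMeasurable
    exact Complex.continuous_conj.comp_aestronglyMeasurable hf.prod_swap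
  have h : eLpNorm (adjFn ε α f) 2 ((muX ε α).prod (muInv ε α)) ^ (2 : ℝ) =
      eLpNorm f 2 ((muX ε α).prod (muInv ε α)) ^ (2 : ℝ) := by
    rw [eLpNorm_two_sq, eLpNorm_two_sq, muX_prod_eq,
      lintegral_withDensity_eq_lintegral_mul₀ measurable_ratio.aemeasurable (ha.enorm.pow_const _),
      lintegral_withDensity_eq_lintegral_mul₀ measurable_ratio.aemeasurable (hf.enorm.pow_const _),
      ← lintegral_prod_swap]
    refine lintegral_congr_ae ?_
    filter_upwards [ae_pos_prod] with p hp
    simp only [Pi.mul_apply, adjFn, Prod.fst_swap, Prod.snd_swap, Prod.swap_swap, enorm_mul,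
      RCLike.enorm_conj]
    have e : ‖(((dens ε α p.1).toReal / (dens ε α p.2).toReal : ℝ) : ℂ)‖ₑ =
        dens ε α p.1 * (dens ε α p.2)⁻¹ := by
      rw [← ofReal_norm, Complex.norm_real, Real.norm_of_nonneg (by positivity),
        ENNReal.ofReal_div_of_pos (dens_toReal_pos hp.2), ENNReal.ofReal_toReal (dens_ne_top ε α _),
        ENNReal.ofReal_toReal (dens_ne_top ε α _), div_eq_mul_inv]
    rw [e, ENNReal.mul_rpow_of_nonneg _ _ (by norm_num), ENNReal.rpow_two, ENNReal.rpow_two]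
    have h1 := ENNReal.mul_inv_cancel (dens_ne_zero ε α hp.1) (dens_ne_top ε α p.1)
    have h2 := ENNReal.mul_inv_cancel (dens_ne_zero ε α hp.2) (dens_ne_top ε α p.2)
    calc _ = (dens ε α p.1 * (dens ε α p.1)⁻¹) * (dens ε α p.2 * (dens ε α p.2)⁻¹) *
          (dens ε α p.1 * (dens ε α p.2)⁻¹ * ‖f p‖ₑ ^ 2) := by ring
      _ = _ := by rw [h1, h2, one_mul, one_mul]
  exact ENNReal.rpow_left_injective (by norm_num : (2 : ℝ) ≠ 0) h

lemma memLp_adjFn (a : HSSp ε α) : MemLp (adjFn ε α a) 2 ((muX ε α).prod (muInv ε α)) := by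
  have hd : Measurable fun p : ℝ × ℝ => ((dens ε α p.2).toReal / (dens ε α p.1).toReal : ℝ) :=
    ((dens_measurable ε α).comp measurable_snd).ennreal_toReal.div
      ((dens_measurable ε α).comp measurable_fst).ennreal_toReal
  have ha : AEStronglyMeasurable (adjFn ε α a) (halfLine.prod halfLine) := by
    refine AEStronglyMeasurable.mul ?_ (Complex.measurable_ofReal.comp hd).aestronglyMeasurable
    exact Complex.continuous_conj.comp_aestronglyMeasurable (HS_aesm a).prod_swap
  refine ⟨ha.mono_ac muX_prod_ac, ?_⟩
  rw [eLpNorm_adjFn (HS_aesm a)]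
  exact Lp.eLpNorm_lt_top a

/-- The adjoint of a Hilbert–Schmidt kernel. -/
def adj (a : HSSp ε α) : HSSp ε α := (memLp_adjFn a).toLp _

lemma coeFn_adj (a : HSSp ε α) : adj a =ᵐ[halfLine.prod halfLine] adjFn ε α a :=
  ac_muX_prod.ae_le (MemLp.coeFn_toLp _)

lemma norm_adj (a : HSSp ε α) : ‖adj a‖ = ‖a‖ := by
  rw [adj, Lp.norm_toLp, Lp.norm_def, eLpNorm_adjFn (HS_aesm a)]

/-- The bilinear form `Tr (a b)`. -/
def trForm (a b : HSSp ε α) : ℂ := ∫ p, a p * b p.swap ∂(halfLine.prod halfLine)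

/-- The weight of the inner product cancels the ratio of densities in the adjoint. Linearity in `a`
and Cauchy–Schwarz are thereby inherited from the Hilbert space. -/
lemma trForm_eq_inner (a b : HSSp ε α) : trForm a b = inner ℂ (adj b) a := by
  rw [L2.inner_def, integral_muX_prod, trForm]
  refine integral_congr_ae ?_
  filter_upwards [coeFn_adj b, ae_pos_prod] with p h1 hp
  have h3 := (dens_toReal_pos (ε := ε) (α := α) hp.1).ne'
  have h4 := (dens_toReal_pos (ε := ε) (α := α) hp.2).ne'
  have h5 : (((dens ε α p.1).toReal / (dens ε α p.2).toReal : ℝ) : ℂ) *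
      (((dens ε α p.2).toReal / (dens ε α p.1).toReal : ℝ) : ℂ) = 1 := by
    rw [← Complex.ofReal_mul]
    rw [div_mul_div_comm, mul_comm, div_self (mul_ne_zero h4 h3), Complex.ofReal_one]
  rw [h1, RCLike.inner_apply, adjFn, map_mul, Complex.conj_conj, Complex.conj_ofReal]
  calc a p * b p.swap = (a p * b p.swap) * 1 := by ring
    _ = _ := by rw [← h5]; ring

lemma trForm_comm (a b : HSSp ε α) : trForm a b = trForm b a := by
  rw [trForm, trForm, ← integral_prod_swap]
  simp [mul_comm]

lemma norm_trForm_le (a b : HSSp ε α) : ‖trForm a b‖ ≤ ‖a‖ * ‖b‖ := by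
  rw [trForm_eq_inner, mul_comm, ← norm_adj b]
  exact norm_inner_le_norm _ _

/-- `Tr (a b)` as a bounded bilinear form. -/
def trL (ε α : ℝ) : HSSp ε α →L[ℂ] HSSp ε α →L[ℂ] ℂ :=
  LinearMap.mkContinuous₂
    (LinearMap.mk₂ ℂ (trForm (ε := ε) (α := α))
      (fun a b c => by simp only [trForm_eq_inner, inner_add_right])
      (fun c a b => by simp only [trForm_eq_inner, inner_smul_right, smul_eq_mul])
      (fun a b c => by
        rw [trForm_comm, trForm_comm a b, trForm_comm a c]
        simp only [trForm_eq_inner, inner_add_right])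
      (fun c a b => by
        rw [trForm_comm, trForm_comm a b]
        simp only [trForm_eq_inner, inner_smul_right, smul_eq_mul]))
    1 (fun a b => by simpa using norm_trForm_le a b)

lemma trL_apply (a b : HSSp ε α) : trL ε α a b = trForm a b := rfl

lemma adj_adj (a : HSSp ε α) : adj (adj a) = a := by
  refine HS_ext ?_
  have h : ∀ᵐ p : ℝ × ℝ ∂halfLine.prod halfLine, adj a p.swap = adjFn ε α a p.swap :=
    Measure.measurePreserving_swap.quasiMeasurePreserving.ae (coeFn_adj a)
  filter_upwards [coeFn_adj (adj a), h, ae_pos_prod] with p h1 h2 hp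
  have h3 := (dens_toReal_pos (ε := ε) (α := α) hp.1).ne'
  have h4 := (dens_toReal_pos (ε := ε) (α := α) hp.2).ne'
  have h3' : (((dens ε α p.1).toReal : ℝ) : ℂ) ≠ 0 := by exact_mod_cast h3
  have h4' : (((dens ε α p.2).toReal : ℝ) : ℂ) ≠ 0 := by exact_mod_cast h4
  rw [h1, adjFn, h2, adjFn]
  simp only [Prod.swap_swap, Prod.fst_swap, Prod.snd_swap, map_mul, Complex.conj_conj,
    Complex.conj_ofReal]
  push_cast
  field_simp

/-- The witness is the normalised adjoint, since `Tr(a a*) = ‖a‖²`. -/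
lemma exists_dual_trForm (a : HSSp ε α) : ∃ b, ‖b‖ ≤ 1 ∧ ‖a‖ ≤ ‖trForm a b‖ := by
  rcases eq_or_ne a 0 with rfl | ha
  · exact ⟨0, by simp, by simp⟩
  have hn : 0 < ‖a‖ := norm_pos_iff.2 ha
  refine ⟨((‖a‖⁻¹ : ℝ) : ℂ) • adj a, ?_, ?_⟩
  · rw [norm_smul, norm_adj, Complex.norm_real, norm_inv, norm_norm, inv_mul_cancel₀ hn.ne']
  · rw [trForm_comm, ← trL_apply, map_smul, smul_apply, trL_apply, trForm_comm, trForm_eq_inner,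
      adj_adj, norm_smul, Complex.norm_real, norm_inv, norm_norm, inner_self_eq_norm_sq_to_K]
    simp only [Complex.coe_algebraMap, norm_pow, Complex.norm_real, norm_norm]
    rw [sq, ← mul_assoc, inv_mul_cancel₀ hn.ne', one_mul]

end

end NonlocalPotential

namespace NonlocalPotential

noncomputable section

/-! ### Kernels of rank one -/

variable {ε α : ℝ}

instance : SigmaFinite (muX ε α) :=
  SigmaFinite.withDensity_of_ne_top' (dens_ne_top ε α)

instance : SigmaFinite (muInv ε α) :=
  SigmaFinite.withDensity_of_ne_top (ae_halfLine_pos.mono fun _ h =>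
    ENNReal.inv_ne_top.2 (dens_ne_zero ε α h))

/-- The kernel of `z ↦ ⟪y, z⟫ x`. -/
def rankOneFn (ε α : ℝ) (x y : ℝ → ℂ) (p : ℝ × ℝ) : ℂ :=
  x p.1 * (starRingEnd ℂ (y p.2) * ((dens ε α p.2).toReal : ℂ))

lemma eLpNorm_mul_dens {y : ℝ → ℂ} (hy : AEStronglyMeasurable y halfLine) :
    eLpNorm (fun s => starRingEnd ℂ (y s) * ((dens ε α s).toReal : ℂ)) 2 (muInv ε α) =
      eLpNorm y 2 (muX ε α) := by
  refine ENNReal.rpow_left_injective (by norm_num : (2 : ℝ) ≠ 0) ?_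
  simp only [eLpNorm_two_sq]
  rw [lintegral_muX_eq ε α _ (hy.enorm.pow_const _)]
  refine lintegral_congr fun R => ?_
  rw [enorm_mul, RCLike.enorm_conj, ENNReal.mul_rpow_of_nonneg _ _ (by norm_num)]
  congr 2
  rw [← ofReal_norm, Complex.norm_real, Real.norm_of_nonneg ENNReal.toReal_nonneg,
    ENNReal.ofReal_toReal (dens_ne_top ε α R)]

lemma aesm_mul_dens {y : ℝ → ℂ} (hy : AEStronglyMeasurable y halfLine) :
    AEStronglyMeasurable (fun s => starRingEnd ℂ (y s) * ((dens ε α s).toReal : ℂ)) halfLine :=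
  (Complex.continuous_conj.comp_aestronglyMeasurable hy).mul
    (Complex.measurable_ofReal.comp (dens_measurable ε α).ennreal_toReal).aestronglyMeasurable

lemma eLpNorm_prod_mul {β γ : Type*} [MeasurableSpace β] [MeasurableSpace γ] {μ : Measure β}
    {ν : Measure γ} [SFinite μ] [SFinite ν] {f : β → ℂ} {g : γ → ℂ}
    (hf : AEStronglyMeasurable f μ) (hg : AEStronglyMeasurable g ν) :
    eLpNorm (fun p : β × γ => f p.1 * g p.2) 2 (μ.prod ν) = eLpNorm f 2 μ * eLpNorm g 2 ν := by
  refine ENNReal.rpow_left_injective (by norm_num : (2 : ℝ) ≠ 0) ?_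
  simp only [ENNReal.mul_rpow_of_nonneg _ _ (by norm_num : (0 : ℝ) ≤ 2), eLpNorm_two_sq, enorm_mul]
  exact lintegral_prod_mul (hf.enorm.pow_const _) (hg.enorm.pow_const _)

lemma memLp_rankOneFn (x y : XSp ε α) :
    MemLp (rankOneFn ε α x y) 2 ((muX ε α).prod (muInv ε α)) := by
  have hx := X_aesm x
  have hy := aesm_mul_dens (ε := ε) (α := α) (X_aesm y)
  refine ⟨(hx.comp_fst.mul hy.comp_snd).mono_ac muX_prod_ac, ?_⟩
  unfold rankOneFn
  rw [eLpNorm_prod_mul (hx.mono_ac (muX_ac_halfLine ε α)) (hy.mono_ac (muInv_ac_halfLine ε α)),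
    eLpNorm_mul_dens (X_aesm y)]
  exact ENNReal.mul_lt_top (Lp.eLpNorm_lt_top x) (Lp.eLpNorm_lt_top y)

/-- The kernel of `z ↦ ⟪y, z⟫ x` as an element of the Hilbert–Schmidt space. -/
def rankOne (x y : XSp ε α) : HSSp ε α := (memLp_rankOneFn x y).toLp _

lemma coeFn_rankOne (x y : XSp ε α) :
    rankOne x y =ᵐ[halfLine.prod halfLine] rankOneFn ε α x y :=
  ac_muX_prod.ae_le (MemLp.coeFn_toLp _)

lemma integral_muX (f : ℝ → ℂ) :
    ∫ R, f R ∂muX ε α = ∫ R, ((dens ε α R).toReal : ℂ) * f R ∂halfLine := by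
  rw [muX, integral_withDensity_eq_integral_toReal_smul (dens_measurable ε α)]
  · simp
  · exact Eventually.of_forall fun R => (dens_ne_top ε α R).lt_top

lemma integral_muInv (f : ℝ → ℂ) :
    ∫ R, ((dens ε α R).toReal : ℂ) * f R ∂muInv ε α = ∫ R, f R ∂halfLine := by
  have hm : Measurable fun R => (dens ε α R)⁻¹ := (dens_measurable ε α).inv
  rw [muInv, integral_withDensity_eq_integral_toReal_smul hm]
  · refine integral_congr_ae (ae_halfLine_pos.mono fun R hR => ?_)
    have h3 : (((dens ε α R).toReal : ℝ) : ℂ) ≠ 0 := by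
      exact_mod_cast (dens_toReal_pos (ε := ε) (α := α) hR).ne'
    simp only [ENNReal.toReal_inv, Complex.real_smul]
    push_cast
    field_simp
  · exact ae_halfLine_pos.mono fun R hR =>
      ENNReal.inv_lt_top.2 (pos_iff_ne_zero.2 (dens_ne_zero ε α hR))

lemma coeFn_toOp (a : HSSp ε α) (x : XSp ε α) : toOp a x =ᵐ[halfLine] kerApply a x :=
  (halfLine_ac_muX ε α).ae_le (MemLp.coeFn_toLp (kerApply_memLp a x))

lemma X_ext {x y : XSp ε α} (h : x =ᵐ[halfLine] y) : x = y :=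
  Lp.ext ((muX_ac_halfLine ε α).ae_le h)

lemma X_coeFn_smul (c : ℂ) (x : XSp ε α) :
    (c • x : XSp ε α) =ᵐ[halfLine] fun R => c * x R :=
  (halfLine_ac_muX ε α).ae_le (Lp.coeFn_smul c x)

lemma kerApply_congr {a b : ℝ × ℝ → ℂ} (h : a =ᵐ[halfLine.prod halfLine] b) (x : ℝ → ℂ) :
    kerApply a x =ᵐ[halfLine] kerApply b x := by
  filter_upwards [Measure.ae_ae_of_ae_prod h] with R hR
  exact integral_congr_ae (hR.mono fun s hs => by simp only [hs])

/-- Rank-one kernels read off the matrix entries of an operator through the Hilbert–Schmidt inner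
product. The density in `rankOneFn` compensates the weight `μ⁻¹` in the second variable. -/
lemma inner_rankOne (x y : XSp ε α) (a : HSSp ε α) :
    inner ℂ (rankOne x y) a = inner ℂ x (toOp a y) := by
  rw [L2.inner_def, integral_prod _ (L2.integrable_inner _ _), L2.inner_def]
  refine integral_congr_ae ((muX_ac_halfLine ε α).ae_le ?_)
  filter_upwards [coeFn_toOp a y, Measure.ae_ae_of_ae_prod (coeFn_rankOne x y)] with R h1 h2
  rw [h1]
  have h3 : ∫ s, inner ℂ (rankOne x y (R, s)) (a (R, s)) ∂muInv ε α =
      ∫ s, ((dens ε α s).toReal : ℂ) * (starRingEnd ℂ (x R) * (a (R, s) * y s)) ∂muInv ε α := by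
    refine integral_congr_ae ((muInv_ac_halfLine ε α).ae_le (h2.mono fun s hs => ?_))
    simp only
    rw [hs, RCLike.inner_apply, rankOneFn]
    simp only [map_mul, Complex.conj_conj, Complex.conj_ofReal]
    ring
  rw [h3, integral_muInv, integral_const_mul, RCLike.inner_apply, kerApply, mul_comm]

lemma toOp_rankOne (x y z : XSp ε α) : toOp (rankOne x y) z = (inner ℂ y z : ℂ) • x := by
  refine X_ext ?_
  filter_upwards [coeFn_toOp (rankOne x y) z, kerApply_congr (coeFn_rankOne x y) z,
    X_coeFn_smul (inner ℂ y z) x] with R h1 h2 h3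
  rw [h1, h2, h3, kerApply, L2.inner_def, integral_muX, ← integral_mul_const]
  refine integral_congr_ae (Eventually.of_forall fun s => ?_)
  simp only [rankOneFn, RCLike.inner_apply]
  ring

lemma comp_rankOne (a : HSSp ε α) (x y : XSp ε α) :
    comp a (rankOne x y) = rankOne (toOp a x) y := by
  refine HS_ext ?_
  filter_upwards [coeFn_comp a (rankOne x y), compFn_congr (EventuallyEq.refl _ a)
    (coeFn_rankOne x y), coeFn_rankOne (toOp a x) y,
    Measure.quasiMeasurePreserving_fst.ae (coeFn_toOp a x)] with p h1 h2 h3 h4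
  rw [h1, h2, h3, compFn, rankOneFn, h4, kerApply, ← integral_mul_const]
  refine integral_congr_ae (Eventually.of_forall fun s => ?_)
  simp only [rankOneFn]
  ring

lemma trForm_rankOne (a : HSSp ε α) (x y : XSp ε α) :
    trForm a (rankOne x y) = inner ℂ y (toOp a x) := by
  have h : adj (rankOne x y) = rankOne y x := by
    refine HS_ext ?_
    have h : ∀ᵐ p : ℝ × ℝ ∂halfLine.prod halfLine, rankOne x y p.swap = rankOneFn ε α x y p.swap :=
      Measure.measurePreserving_swap.quasiMeasurePreserving.ae (coeFn_rankOne x y)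
    filter_upwards [coeFn_adj (rankOne x y), h, coeFn_rankOne y x, ae_pos_prod] with p h1 h2 h3 hp
    have h3' : (((dens ε α p.1).toReal : ℝ) : ℂ) ≠ 0 := by
      exact_mod_cast (dens_toReal_pos (ε := ε) (α := α) hp.1).ne'
    rw [h1, adjFn, h2, h3]
    simp only [rankOneFn, Prod.fst_swap, Prod.snd_swap, map_mul, Complex.conj_conj,
      Complex.conj_ofReal]
    push_cast
    field_simp
  rw [trForm_eq_inner, h, inner_rankOne]

/-! ### A kernel is determined by its operator; density of finite-rank kernels. -/

lemma setIntegral_prod_eq_zero {a : HSSp ε α} (h : ∀ y, toOp a y = 0) {A B : Set ℝ}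
    (hA : MeasurableSet A) (hB : MeasurableSet B) (hA' : muX ε α A ≠ ∞) (hB' : muInv ε α B ≠ ∞) :
    ∫ p in A ×ˢ B, a p ∂((muX ε α).prod (muInv ε α)) = 0 := by
  set x : XSp ε α := indicatorConstLp 2 hA hA' 1
  -- Dividing by the density makes the rank-one kernel of `1_A` and `y₀` equal to the indicator of
  -- `A × B`, so that the integral over the rectangle is a matrix entry of the zero operator.
  set y₀ : ℝ → ℂ := B.indicator fun s => (((dens ε α s).toReal⁻¹ : ℝ) : ℂ)
  have hy₀ : MemLp y₀ 2 (muX ε α) := by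
    have hm : Measurable y₀ := Measurable.indicator
      (Complex.measurable_ofReal.comp (dens_measurable ε α).ennreal_toReal.inv) hB
    refine ⟨hm.aestronglyMeasurable, ?_⟩
    rw [← eLpNorm_mul_dens hm.aestronglyMeasurable]
    have h1 : eLpNorm (fun s => starRingEnd ℂ (y₀ s) * ((dens ε α s).toReal : ℂ)) 2 (muInv ε α)
        ≤ eLpNorm (B.indicator fun _ => (1 : ℂ)) 2 (muInv ε α) := by
      refine eLpNorm_mono_ae ((muInv_ac_halfLine ε α).ae_le (ae_halfLine_pos.mono fun s hs => ?_))
      have h3' : (((dens ε α s).toReal : ℝ) : ℂ) ≠ 0 := by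
        exact_mod_cast (dens_toReal_pos (ε := ε) (α := α) hs).ne'
      by_cases hsB : s ∈ B
      · simp [y₀, hsB, h3']
      · simp [y₀, hsB]
    exact h1.trans_lt (memLp_indicator_const 2 hB 1 (Or.inr hB')).2
  have h0 := inner_rankOne x (hy₀.toLp _) a
  rw [h, inner_zero_right, L2.inner_def] at h0
  rw [← integral_indicator (hA.prod hB), ← h0]
  refine integral_congr_ae (muX_prod_ac.ae_le ?_)
  have hx : x =ᵐ[halfLine] A.indicator fun _ => (1 : ℂ) :=
    (halfLine_ac_muX ε α).ae_le indicatorConstLp_coeFn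
  have hy : hy₀.toLp _ =ᵐ[halfLine] y₀ := (halfLine_ac_muX ε α).ae_le hy₀.coeFn_toLp
  filter_upwards [coeFn_rankOne x (hy₀.toLp _), Measure.quasiMeasurePreserving_fst.ae hx,
    Measure.quasiMeasurePreserving_snd.ae hy, ae_pos_prod] with p h1 h2 h3 hp
  have h3' : (((dens ε α p.2).toReal : ℝ) : ℂ) ≠ 0 := by
    exact_mod_cast (dens_toReal_pos (ε := ε) (α := α) hp.2).ne'
  rw [h1, rankOneFn, h2, h3]
  by_cases hp1 : p.1 ∈ A <;> by_cases hp2 : p.2 ∈ B <;>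
    simp [Set.indicator, hp1, hp2, y₀, h3']

/-- The integrals of the kernel over finite rectangles vanish. On each member of a σ-finite
exhaustion by rectangles, a π-λ argument extends this to all measurable sets, so the kernel vanishes
almost everywhere. -/
lemma toOp_injective {a : HSSp ε α} (h : ∀ y, toOp a y = 0) : a = 0 := by
  set m := (muX ε α).prod (muInv ε α)
  set S : ℕ → Set (ℝ × ℝ) := fun n =>
    spanningSets (muX ε α) n ×ˢ spanningSets (muInv ε α) n
  have hSm : ∀ n, MeasurableSet (S n) := fun n =>
    (measurableSet_spanningSets _ n).prod (measurableSet_spanningSets _ n)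
  have hSfin : ∀ n, m (S n) < ∞ := by
    intro n
    rw [Measure.prod_prod]
    exact ENNReal.mul_lt_top (measure_spanningSets_lt_top _ n) (measure_spanningSets_lt_top _ n)
  have hint : ∀ n, IntegrableOn a (S n) m := fun n => by
    have : IsFiniteMeasure (m.restrict (S n)) := ⟨by simpa using hSfin n⟩
    exact ((Lp.memLp a).restrict (S n)).integrable (by norm_num)
  have key : ∀ n, ∀ s, MeasurableSet s → ∫ p in s, a p ∂(m.restrict (S n)) = 0 := by
    intro n s hs
    induction s, hs using MeasurableSpace.induction_on_inter generateFrom_prod.symm isPiSystem_prod with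
    | empty => simp
    | basic t ht =>
      obtain ⟨A, hA, B, hB, rfl⟩ := ht
      replace hA : MeasurableSet A := hA
      replace hB : MeasurableSet B := hB
      rw [Measure.restrict_restrict (hA.prod hB), Set.prod_inter_prod]
      refine setIntegral_prod_eq_zero h (hA.inter (measurableSet_spanningSets _ n))
        (hB.inter (measurableSet_spanningSets _ n)) ?_ ?_
      · exact (measure_mono Set.inter_subset_right |>.trans_lt
          (measure_spanningSets_lt_top _ n)).ne
      · exact (measure_mono Set.inter_subset_right |>.trans_lt
          (measure_spanningSets_lt_top _ n)).ne
    | compl t ht ih =>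
      have h1 := integral_add_compl ht (hint n)
      rw [ih, zero_add] at h1
      rw [h1]
      have := setIntegral_prod_eq_zero h (measurableSet_spanningSets (muX ε α) n)
        (measurableSet_spanningSets (muInv ε α) n) (measure_spanningSets_lt_top _ n).ne
        (measure_spanningSets_lt_top _ n).ne
      exact this
    | iUnion f hd hf ih =>
      rw [integral_iUnion hf hd (hint n).integrableOn]
      simp [ih]
  have hz : ∀ n, ∀ᵐ p ∂m, p ∈ S n → a p = 0 := fun n =>
    (ae_restrict_iff' (hSm n)).1
      (Integrable.ae_eq_zero_of_forall_setIntegral_eq_zero (hint n) fun s hs _ => key n s hs)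
  refine Lp.ext ?_
  filter_upwards [ae_all_iff.2 hz, Lp.coeFn_zero ℂ 2 m] with p hp h0
  rw [h0, Pi.zero_apply]
  have h1 : p.1 ∈ ⋃ n, spanningSets (muX ε α) n := by rw [iUnion_spanningSets]; trivial
  have h2 : p.2 ∈ ⋃ n, spanningSets (muInv ε α) n := by rw [iUnion_spanningSets]; trivial
  obtain ⟨i, hi⟩ := Set.mem_iUnion.1 h1
  obtain ⟨j, hj⟩ := Set.mem_iUnion.1 h2
  exact hp (max i j) ⟨monotone_spanningSets _ (le_max_left i j) hi,
    monotone_spanningSets _ (le_max_right i j) hj⟩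

lemma norm_toOp_le (a : HSSp ε α) : ‖toOp a‖ ≤ ‖a‖ :=
  LinearMap.mkContinuous_norm_le _ (norm_nonneg a) _

/-- `toOp` as a bounded linear map. -/
def toOpL (ε α : ℝ) : HSSp ε α →L[ℂ] XSp ε α →L[ℂ] XSp ε α :=
  LinearMap.mkContinuous
    { toFun := toOp
      map_add' := by
        intro a b
        refine ContinuousLinearMap.ext fun x => X_ext ?_
        have h : (toOp a x + toOp b x : XSp ε α) =ᵐ[halfLine] fun R => toOp a x R + toOp b x R :=
          (halfLine_ac_muX ε α).ae_le (Lp.coeFn_add _ _)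
        rw [add_apply]
        filter_upwards [coeFn_toOp (a + b) x, kerApply_congr (HS_coeFn_add a b) x, h,
          coeFn_toOp a x, coeFn_toOp b x, kerApply_integrable a x, kerApply_integrable b x]
          with R h1 h2 h3 h4 h5 h6 h7
        rw [h1, h2, h3, h4, h5]
        simp only [kerApply]
        rw [← integral_add h6 h7]
        simp only [add_mul]
      map_smul' := by
        intro c a
        refine ContinuousLinearMap.ext fun x => X_ext ?_
        rw [RingHom.id_apply, smul_apply]
        filter_upwards [coeFn_toOp (c • a) x, kerApply_congr (HS_coeFn_smul c a) x,
          X_coeFn_smul c (toOp a x), coeFn_toOp a x] with R h1 h2 h3 h4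
        rw [h1, h2, h3, h4]
        simp only [kerApply]
        rw [← integral_const_mul]
        simp only [mul_assoc] }
    1 (fun a => by
      rw [one_mul]
      exact norm_toOp_le a)

lemma toOpL_apply (a : HSSp ε α) : toOpL ε α a = toOp a := rfl

lemma toOp_inj {a b : HSSp ε α} (h : toOp a = toOp b) : a = b := by
  rw [← sub_eq_zero]
  refine toOp_injective fun y => ?_
  rw [← toOpL_apply, map_sub, toOpL_apply, toOpL_apply, h, sub_self, zero_apply]

/-- A kernel orthogonal to these has all matrix entries zero in the basis, hence the zero operator,
hence is zero. -/
lemma dense_span_rankOne {ι : Type*} (e : HilbertBasis ι ℂ (XSp ε α)) :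
    Dense (Submodule.span ℂ (Set.range fun p : ι × ι => rankOne (e p.1) (e p.2)) :
      Set (HSSp ε α)) := by
  rw [Submodule.dense_iff_topologicalClosure_eq_top, Submodule.topologicalClosure_eq_top_iff,
    Submodule.eq_bot_iff]
  intro a ha
  have hz : ∀ z : XSp ε α, (∀ i, inner ℂ (e i) z = 0) → z = 0 := by
    intro z hz
    refine e.repr.injective ?_
    ext i
    rw [e.repr_apply_apply, hz i]
    simp
  have h1 : ∀ j, toOp a (e j) = 0 := by
    intro j
    refine hz _ fun i => ?_
    rw [← inner_rankOne]
    exact (Submodule.mem_orthogonal _ _).1 ha _ (Submodule.subset_span ⟨(i, j), rfl⟩)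
  have h2 : toOp a = 0 := by
    refine ContinuousLinearMap.ext_on (s := Set.range e) ?_ ?_
    · rw [Submodule.dense_iff_topologicalClosure_eq_top]
      exact e.dense_span
    · rintro _ ⟨j, rfl⟩
      simpa using h1 j
  exact toOp_injective fun y => by rw [h2]; rfl

/-- Both sides are continuous and linear in `b`, so rank-one `b` suffices, where `comp_rankOne`
decides. This replaces a Fubini argument in three variables; associativity of `comp` then follows
from injectivity of `toOp`. -/
lemma toOp_comp (a b : HSSp ε α) : toOp (comp a b) = toOp a ∘L toOp b := by
  obtain ⟨w, e, -⟩ := exists_hilbertBasis ℂ (XSp ε α)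
  have h : (toOpL ε α).comp (compL ε α a) =
      (ContinuousLinearMap.compL ℂ (XSp ε α) (XSp ε α) (XSp ε α) (toOp a)).comp (toOpL ε α) := by
    refine ContinuousLinearMap.ext_on (dense_span_rankOne e) ?_
    rintro _ ⟨p, rfl⟩
    refine ContinuousLinearMap.ext fun z => ?_
    rw [ContinuousLinearMap.comp_apply, ContinuousLinearMap.comp_apply, compL_apply, toOpL_apply,
      toOpL_apply, ContinuousLinearMap.compL_apply, ContinuousLinearMap.comp_apply, comp_rankOne,
      toOp_rankOne, toOp_rankOne, map_smul]
  have h2 := DFunLike.congr_fun h b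
  rwa [ContinuousLinearMap.comp_apply, ContinuousLinearMap.comp_apply, compL_apply, toOpL_apply,
    toOpL_apply, ContinuousLinearMap.compL_apply] at h2

lemma comp_assoc (a b c : HSSp ε α) : comp (comp a b) c = comp a (comp b c) :=
  toOp_inj (ContinuousLinearMap.ext fun y => by
    rw [toOp_comp, toOp_comp, toOp_comp, toOp_comp, ContinuousLinearMap.comp_apply,
      ContinuousLinearMap.comp_apply, ContinuousLinearMap.comp_apply,
      ContinuousLinearMap.comp_apply])

/-- The same density argument: for rank-one `c` built from `x` and `y`, both sides are `⟪y, a b x⟫`.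
-/
lemma trForm_comp (a b c : HSSp ε α) : trForm (comp a b) c = trForm a (comp b c) := by
  obtain ⟨w, e, -⟩ := exists_hilbertBasis ℂ (XSp ε α)
  have h : trL ε α (comp a b) = (trL ε α a).comp (compL ε α b) := by
    refine ContinuousLinearMap.ext_on (dense_span_rankOne e) ?_
    rintro _ ⟨p, rfl⟩
    rw [ContinuousLinearMap.comp_apply, compL_apply, trL_apply, trL_apply, comp_rankOne,
      trForm_rankOne, trForm_rankOne, toOp_comp, ContinuousLinearMap.comp_apply]
  have h2 := DFunLike.congr_fun h c
  rwa [ContinuousLinearMap.comp_apply, compL_apply, trL_apply, trL_apply] at h2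

lemma comp_rankOne_rankOne (x y x' y' : XSp ε α) :
    comp (rankOne x y) (rankOne x' y') = (inner ℂ y x' : ℂ) • rankOne x y' := by
  refine toOp_inj (ContinuousLinearMap.ext fun z => ?_)
  rw [toOp_comp, ContinuousLinearMap.comp_apply, toOp_rankOne, toOp_rankOne, ← toOpL_apply,
    map_smul, smul_apply, toOpL_apply, toOp_rankOne, inner_smul_right, smul_smul, mul_comm]

/-! ### Kernels given by finite matrices. -/

/-- The kernel with matrix `M` in an orthonormal family. -/
def matKernel {ι : Type*} [Fintype ι] (e : ι → XSp ε α) (M : Matrix ι ι ℂ) : HSSp ε α :=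
  ∑ p : ι × ι, M p.1 p.2 • rankOne (e p.1) (e p.2)

lemma orthonormal_rankOne {ι : Type*} {e : ι → XSp ε α} (he : Orthonormal ℂ e) :
    Orthonormal ℂ fun p : ι × ι => rankOne (e p.1) (e p.2) := by
  classical
  rw [orthonormal_iff_ite]
  rintro ⟨i, j⟩ ⟨i', j'⟩
  have h := orthonormal_iff_ite.1 he
  rw [inner_rankOne, toOp_rankOne, inner_smul_right, h, h]
  by_cases h1 : i = i' <;> by_cases h2 : j = j' <;> simp [h1, h2, eq_comm]

section

variable {ι : Type*} [Fintype ι] [DecidableEq ι] {e : ι → XSp ε α}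

lemma comp_matKernel (he : Orthonormal ℂ e) (M N : Matrix ι ι ℂ) :
    comp (matKernel e M) (matKernel e N) = matKernel e (M * N) := by
  have h := orthonormal_iff_ite.1 he
  have h1 : comp (matKernel e M) (matKernel e N) = ∑ p : ι × ι, ∑ q : ι × ι,
      (M p.1 p.2 * N q.1 q.2) • comp (rankOne (e p.1) (e p.2)) (rankOne (e q.1) (e q.2)) := by
    rw [← compL_apply, matKernel, matKernel, map_sum, Finset.sum_comm]
    refine Finset.sum_congr rfl fun q _ => ?_
    rw [map_sum, sum_apply]
    refine Finset.sum_congr rfl fun p _ => ?_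
    rw [map_smul, map_smul, smul_apply, compL_apply, smul_smul, mul_comm]
  rw [h1]
  simp only [comp_rankOne_rankOne, h, matKernel, Fintype.sum_prod_type, Matrix.mul_apply,
    Finset.sum_smul, ite_smul, one_smul, zero_smul, smul_ite, smul_zero]
  refine Finset.sum_congr rfl fun i _ => ?_
  rw [Finset.sum_comm (f := fun j' j => (M i j * N j j') • rankOne (e i) (e j'))]
  refine Finset.sum_congr rfl fun j _ => ?_
  rw [Finset.sum_comm]
  simp

lemma trForm_matKernel (he : Orthonormal ℂ e) (M N : Matrix ι ι ℂ) :
    trForm (matKernel e M) (matKernel e N) = (M * N).trace := by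
  have h := orthonormal_iff_ite.1 he
  have h1 : trForm (matKernel e M) (matKernel e N) = ∑ p : ι × ι, ∑ q : ι × ι,
      (M p.1 p.2 * N q.1 q.2) * trForm (rankOne (e p.1) (e p.2)) (rankOne (e q.1) (e q.2)) := by
    rw [← trL_apply, matKernel, matKernel, map_sum, Finset.sum_comm]
    refine Finset.sum_congr rfl fun q _ => ?_
    rw [map_sum, sum_apply]
    refine Finset.sum_congr rfl fun p _ => ?_
    rw [map_smul, map_smul, smul_apply, trL_apply, smul_eq_mul, smul_eq_mul, ← mul_assoc,
      mul_comm (M _ _)]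
  rw [h1]
  simp only [trForm_rankOne, toOp_rankOne, inner_smul_right, h, Fintype.sum_prod_type]
  simp [Matrix.trace, Matrix.mul_apply]

omit [DecidableEq ι] in
lemma norm_matKernel_sq (he : Orthonormal ℂ e) (M : Matrix ι ι ℂ) :
    ‖matKernel e M‖ ^ 2 = ∑ i, ∑ j, ‖M i j‖ ^ 2 := by
  have h := (orthonormal_rankOne he).inner_sum (fun p => M p.1 p.2) (fun p => M p.1 p.2) Finset.univ
  have h1 : ((‖matKernel e M‖ ^ 2 : ℝ) : ℂ) = ((∑ i, ∑ j, ‖M i j‖ ^ 2 : ℝ) : ℂ) := by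
    rw [Complex.ofReal_pow]
    refine (inner_self_eq_norm_sq_to_K (𝕜 := ℂ) (matKernel e M)).symm.trans (h.trans ?_)
    rw [Fintype.sum_prod_type]
    push_cast
    refine Finset.sum_congr rfl fun i _ => Finset.sum_congr rfl fun j _ => ?_
    rw [Complex.conj_mul']
  exact_mod_cast h1

lemma powSucc_matKernel (he : Orthonormal ℂ e) (M : Matrix ι ι ℂ) (n : ℕ) :
    powSucc (compL ε α) (matKernel e M) n = matKernel e (M ^ (n + 1)) := by
  induction n with
  | zero => simp [powSucc]
  | succ n ih => rw [powSucc, ih, compL_apply, comp_matKernel he, pow_succ' M (n + 1)]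

end

/-- A finite combination of rank-one kernels of basis vectors involves finitely many of them, so it
is the kernel of a matrix in that orthonormal family, with the same norm and the same traces of
powers. -/
lemma dense_matKernel (ε α : ℝ) : Dense {a : HSSp ε α |
    ∃ (ι : Type) (_ : Fintype ι) (_ : DecidableEq ι) (M : Matrix ι ι ℂ),
      ∑ i, ∑ j, ‖M i j‖ ^ 2 ≤ ‖a‖ ^ 2 ∧
        ∀ n, trL ε α (powSucc (compL ε α) a n) a = (M ^ (n + 2)).trace} := by
  classical
  obtain ⟨w, e, -⟩ := exists_hilbertBasis ℂ (XSp ε α)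
  refine (dense_span_rankOne e).mono ?_
  intro a ha
  obtain ⟨c, rfl⟩ := Finsupp.mem_span_range_iff_exists_finsupp.1 (SetLike.mem_coe.1 ha)
  set s : Finset w := c.support.image Prod.fst ∪ c.support.image Prod.snd with hs
  set M : Matrix s s ℂ := Matrix.of fun i j => c (i, j)
  have he : Orthonormal ℂ fun i : s => e i := e.orthonormal.comp _ Subtype.val_injective
  have hM : (c.sum fun i x => x • rankOne (e i.1) (e i.2)) = matKernel (fun i : s => e i) M := by
    have h1 : c.support ⊆ s ×ˢ s := by
      intro p hp
      rw [Finset.mem_product]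
      exact ⟨Finset.mem_union_left _ (Finset.mem_image_of_mem _ hp),
        Finset.mem_union_right _ (Finset.mem_image_of_mem _ hp)⟩
    rw [Finsupp.sum_of_support_subset c h1 _ (by simp), Finset.sum_product, matKernel,
      Fintype.sum_prod_type, ← Finset.sum_coe_sort s]
    refine Finset.sum_congr rfl fun i _ => ?_
    rw [← Finset.sum_coe_sort s]
    rfl
  rw [hM]
  refine ⟨s, inferInstance, inferInstance, M, (norm_matKernel_sq he M).ge, fun n => ?_⟩
  rw [powSucc_matKernel he, trL_apply, trForm_matKernel he, ← pow_succ]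

/-- The Hilbert–Schmidt kernels on `X_{w,α}`. -/
def hsAlgebra (ε α : ℝ) : TraceAlgebra (HSSp ε α) where
  mul := compL ε α
  tr := trL ε α
  mul_assoc := comp_assoc
  tr_comm := trForm_comm
  tr_mul := trForm_comp
  exists_dual := exists_dual_trForm
  dense_matrix := dense_matKernel ε α

end

end NonlocalPotential

namespace NonlocalPotential

noncomputable section

/-! ### Smithies' series of a Hilbert–Schmidt kernel -/

variable {ε α : ℝ} {K : ℝ → ℝ → ℂ}

lemma toHS_eq (h : IsHS ε α K) : toHS ε α K = MemLp.toLp _ h := dif_pos h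

lemma coeFn_toHS (h : IsHS ε α K) :
    toHS ε α K =ᵐ[halfLine.prod halfLine] fun p => K p.1 p.2 := by
  rw [toHS_eq h]
  exact ac_muX_prod.ae_le (MemLp.coeFn_toLp h)

lemma toHS_eq_of_ae {a : HSSp ε α} (h : a =ᵐ[halfLine.prod halfLine] fun p => K p.1 p.2) :
    toHS ε α K = a := by
  have hK : IsHS ε α K := (memLp_congr_ae (muX_prod_ac.ae_le h)).1 (Lp.memLp a)
  exact HS_ext ((coeFn_toHS hK).trans h.symm)

lemma coeFn_pow (h : IsHS ε α K) (n : ℕ) :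
    (hsAlgebra ε α).pow (toHS ε α K) n =ᵐ[halfLine.prod halfLine] fun p => kerPow K n p.1 p.2 := by
  induction n with
  | zero => exact coeFn_toHS h
  | succ n ih => exact (coeFn_comp _ _).trans (compFn_congr (coeFn_toHS h) ih)

lemma isHS_kerPow (h : IsHS ε α K) (n : ℕ) : IsHS ε α (kerPow K n) :=
  (memLp_congr_ae (muX_prod_ac.ae_le (coeFn_pow h n))).1 (Lp.memLp _)

lemma rhoSeq_eq (h : IsHS ε α K) (n : ℕ) : rhoSeq K n = (hsAlgebra ε α).rho (toHS ε α K) n := by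
  unfold rhoSeq TraceAlgebra.rho
  split_ifs with hn
  · rfl
  · refine integral_congr_ae ?_
    have h2 : ∀ᵐ p : ℝ × ℝ ∂halfLine.prod halfLine, toHS ε α K p.swap = K p.2 p.1 :=
      Measure.measurePreserving_swap.quasiMeasurePreserving.ae (coeFn_toHS h)
    filter_upwards [coeFn_pow h (n - 2), h2] with p h3 h4
    rw [h3, h4]

/-- The determinants of a pointwise kernel and the abstract coefficients obey the same recursion.
This carries the abstract bounds over to the concrete series. -/
lemma sigmaCoeff_eq (h : IsHS ε α K) (n : ℕ) :
    sigmaCoeff K n = (hsAlgebra ε α).sig (toHS ε α K) n := by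
  refine eq_smithies (TraceAlgebra.rho_zero _ _) (sigmaCoeff_zero K) (fun n => ?_) n
  rw [sigmaCoeff_rec]
  simp only [rhoSeq_eq h]

lemma HS_coeFn_sum {ι : Type*} (s : Finset ι) (f : ι → HSSp ε α) :
    (∑ i ∈ s, f i : HSSp ε α) =ᵐ[halfLine.prod halfLine] fun p => ∑ i ∈ s, f i p := by
  classical
  induction s using Finset.induction_on with
  | empty =>
    simp only [Finset.sum_empty]
    exact ac_muX_prod.ae_le (Lp.coeFn_zero ℂ 2 ((muX ε α).prod (muInv ε α)))
  | insert i s hi ih =>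
    rw [Finset.sum_insert hi]
    filter_upwards [HS_coeFn_add (f i) (∑ i ∈ s, f i), ih] with p h1 h2
    rw [h1, h2, Finset.sum_insert hi]

lemma toHS_nCoeff (h : IsHS ε α K) (n : ℕ) :
    toHS ε α (nCoeff K n) = (hsAlgebra ε α).num (toHS ε α K) n := by
  refine toHS_eq_of_ae ((HS_coeFn_sum _ _).trans ?_)
  have h1 : ∀ᵐ p ∂halfLine.prod halfLine, ∀ j, (hsAlgebra ε α).pow (toHS ε α K) j p =
      kerPow K j p.1 p.2 := ae_all_iff.2 (coeFn_pow h)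
  have h2 : ∀ᵐ p ∂halfLine.prod halfLine, ∀ q : ℕ × ℕ,
      ((hsAlgebra ε α).sig (toHS ε α K) q.2 • (hsAlgebra ε α).pow (toHS ε α K) q.1 : HSSp ε α) p =
      (hsAlgebra ε α).sig (toHS ε α K) q.2 * (hsAlgebra ε α).pow (toHS ε α K) q.1 p :=
    ae_all_iff.2 fun q => HS_coeFn_smul _ _
  filter_upwards [h1, h2] with p hp1 hp2
  rw [nCoeff_eq]
  refine Finset.sum_congr rfl fun q _ => ?_
  rw [hp2, hp1, sigmaCoeff_eq h]

lemma sigma_eq (h : IsHS ε α K) (g : ℂ) :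
    sigma K g = (hsAlgebra ε α).sigma (toHS ε α K, g) := by
  simp only [sigma, TraceAlgebra.sigma, sigmaCoeff_eq h]

lemma nSeries_eq (h : IsHS ε α K) (g : ℂ) :
    nSeries ε α K g = (hsAlgebra ε α).numer (toHS ε α K, g) := by
  simp only [nSeries, TraceAlgebra.numer, toHS_nCoeff h]

/-- The resolvent equation yields the right inverse; commutation of `L` and `R` makes it two-sided.
-/
lemma resolvent_mul_eq_one {A : Type*} [Ring A] [Algebra ℂ A] {L R : A} {g : ℂ}
    (h1 : R = L + g • (L * R)) (h2 : L * R = R * L) :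
    (1 - g • L) * (1 + g • R) = 1 ∧ (1 + g • R) * (1 - g • L) = 1 := by
  have h3 : g • R = g • L + g • (g • (L * R)) := by rw [← smul_add, ← h1]
  constructor
  · rw [sub_mul, one_mul, mul_add, mul_one, smul_mul_smul_comm, ← smul_smul, h3]
    abel
  · rw [add_mul, one_mul, mul_sub, mul_one, smul_mul_smul_comm, ← smul_smul, ← h2, h3]
    abel

/-- The truncated resolvent of an element of the Hilbert–Schmidt space. -/
lemma resolvent_of_sigma_ne_zero (a : HSSp ε α) {g : ℂ}
    (hs : (hsAlgebra ε α).sigma (a, g) ≠ 0) :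
    IsUnit (1 - g • toOp a) ∧
    Ring.inverse (1 - g • toOp a) =
      1 + g • toOp (((hsAlgebra ε α).sigma (a, g))⁻¹ • (hsAlgebra ε α).numer (a, g)) ∧
    toOp (((hsAlgebra ε α).sigma (a, g))⁻¹ • (hsAlgebra ε α).numer (a, g)) = toOp a + g •
      (toOp a ∘L toOp (((hsAlgebra ε α).sigma (a, g))⁻¹ • (hsAlgebra ε α).numer (a, g))) := by
  set R : HSSp ε α := ((hsAlgebra ε α).sigma (a, g))⁻¹ • (hsAlgebra ε α).numer (a, g) with hR
  have e1 : R = a + g • comp a R := by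
    have := (hsAlgebra ε α).numer_eq a g
    conv_lhs => rw [hR, this]
    rw [smul_add, smul_smul, inv_mul_cancel₀ hs, one_smul, smul_comm, ← map_smul, ← hR]
    rfl
  have e2 : comp a R = comp R a := by
    have := (hsAlgebra ε α).mul_numer_comm a g
    rw [← compL_apply, ← compL_apply, hR, map_smul, map_smul, smul_apply]
    exact congrArg _ this.symm
  have h1 : toOp R = toOp a + g • (toOp a ∘L toOp R) := by
    conv_lhs => rw [e1]
    rw [← toOpL_apply, map_add, map_smul, toOpL_apply, toOpL_apply, toOp_comp]
  have h2 : toOp a ∘L toOp R = toOp R ∘L toOp a := by rw [← toOp_comp, ← toOp_comp, e2]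
  obtain ⟨h3, h4⟩ := resolvent_mul_eq_one (A := XSp ε α →L[ℂ] XSp ε α) h1 h2
  refine ⟨⟨⟨_, _, h3, h4⟩, rfl⟩, ?_, h1⟩
  exact Ring.inverse_unit ⟨_, _, h3, h4⟩

end

end NonlocalPotential

namespace NonlocalPotential

noncomputable section

/-! ### The Green function -/

/-- The integral `∫ e^{izt} p(t) dt` over `[-1,1]`. -/
def expInt (p : ℂ[X]) (z : ℂ) : ℂ := ∫ t in (-1 : ℝ)..1, Complex.exp (Complex.I * z * t) * p.eval (t : ℂ)

lemma differentiable_expInt (p : ℂ[X]) : Differentiable ℂ (expInt p) := by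
  intro z
  have hc : ∀ z : ℂ, Continuous fun t : ℝ => Complex.exp (Complex.I * z * t) * p.eval (t : ℂ) := by
    intro z; fun_prop
  have hd : Continuous fun q : ℂ × ℝ =>
      (Complex.I * q.2) * Complex.exp (Complex.I * q.1 * q.2) * p.eval (q.2 : ℂ) := by fun_prop
  obtain ⟨C, hC⟩ := ((isCompact_closedBall z 1).prod (isCompact_Icc (a := (-1 : ℝ)) (b := 1))).exists_bound_of_continuousOn
    hd.continuousOn
  refine (intervalIntegral.hasDerivAt_integral_of_dominated_loc_of_deriv_le (𝕜 := ℂ)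
    (F := fun z t => Complex.exp (Complex.I * z * t) * p.eval (t : ℂ))
    (F' := fun z t => (Complex.I * t) * Complex.exp (Complex.I * z * t) * p.eval (t : ℂ))
    (bound := fun _ => C) (Metric.ball_mem_nhds z one_pos)
    (Eventually.of_forall fun z => (hc z).aestronglyMeasurable)
    ((hc z).intervalIntegrable _ _) ?_ (Eventually.of_forall fun t ht x hx => ?_)
    (by simp) (Eventually.of_forall fun t _ x _ => ?_)).2.differentiableAt
  · exact Continuous.aestronglyMeasurable (by fun_prop)
  · refine hC (x, t) ⟨Metric.ball_subset_closedBall hx, ?_⟩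
    rw [Set.uIoc_of_le (by norm_num)] at ht
    exact ⟨ht.1.le, ht.2⟩
  · have h1 : HasDerivAt (fun z : ℂ => Complex.I * z * t) (Complex.I * t) x := by
      simpa using ((hasDerivAt_id x).const_mul Complex.I).mul_const (t : ℂ)
    have := (h1.cexp).mul_const (p.eval (t : ℂ))
    rwa [mul_comm (Complex.exp _) (Complex.I * t)] at this

lemma norm_exp_le {z : ℂ} {t : ℝ} (ht : |t| ≤ 1) :
    ‖Complex.exp (Complex.I * z * t)‖ ≤ Real.exp |z.im| := by
  rw [Complex.norm_exp]
  refine Real.exp_le_exp.2 ?_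
  have : (Complex.I * z * t).re = -(z.im * t) := by simp
  rw [this]
  refine (neg_le_abs _).trans ?_
  rw [abs_mul]
  exact mul_le_of_le_one_right (abs_nonneg _) ht

/-- Integration by parts; the boundary terms vanish because `p(±1) = 0`. -/
lemma mul_expInt {p : ℂ[X]} (h1 : p.eval 1 = 0) (h2 : p.eval (-1) = 0) (z : ℂ) :
    z * expInt p z = Complex.I * expInt (derivative p) z := by
  have hd : ∀ t ∈ Set.uIcc (-1 : ℝ) 1, HasDerivAt
      (fun t : ℝ => Complex.exp (Complex.I * z * t) * p.eval (t : ℂ))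
      ((Complex.I * z) * (Complex.exp (Complex.I * z * t) * p.eval (t : ℂ)) +
        Complex.exp (Complex.I * z * t) * (derivative p).eval (t : ℂ)) t := by
    intro t _
    have e1 : HasDerivAt (fun w : ℂ => Complex.I * z * w) (Complex.I * z) (t : ℂ) := by
      simpa using (hasDerivAt_id (t : ℂ)).const_mul (Complex.I * z)
    have := (e1.cexp.mul (p.hasDerivAt (t : ℂ))).comp_ofReal
    convert this using 1
    · rfl
    · ring
  have hc1 : Continuous fun t : ℝ =>
      (Complex.I * z) * (Complex.exp (Complex.I * z * t) * p.eval (t : ℂ)) := by fun_prop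
  have hc2 : Continuous fun t : ℝ =>
      Complex.exp (Complex.I * z * t) * (derivative p).eval (t : ℂ) := by fun_prop
  have h := intervalIntegral.integral_eq_sub_of_hasDerivAt hd
    ((hc1.add hc2).intervalIntegrable _ _)
  rw [intervalIntegral.integral_add (hc1.intervalIntegrable _ _) (hc2.intervalIntegrable _ _),
    intervalIntegral.integral_const_mul] at h
  simp only [Complex.ofReal_one, Complex.ofReal_neg, h1, h2, mul_zero, sub_zero] at h
  change Complex.I * z * expInt p z + expInt (derivative p) z = 0 at h
  have hI := Complex.I_mul_I
  linear_combination (-Complex.I) * h + (z * expInt p z) * hI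

/-- Each integration by parts gains a power of `z` and costs one factor `1 - X²` of the polynomial.
Quantifying over all multiples of `(1 - X²)^n` makes the induction close under differentiation. -/
lemma exists_norm_pow_mul_expInt_le (n : ℕ) : ∀ p : ℂ[X], (1 - X ^ 2) ^ n ∣ p →
    ∃ C : ℝ, 0 ≤ C ∧ ∀ z, ‖z ^ n * expInt p z‖ ≤ C * Real.exp |z.im| := by
  induction n with
  | zero =>
    intro p _
    have hc : Continuous fun t : ℝ => p.eval (t : ℂ) := by fun_prop
    obtain ⟨C, hC⟩ := (isCompact_Icc (a := (-1 : ℝ)) (b := 1)).exists_bound_of_continuousOn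
      hc.continuousOn
    have hC0 : 0 ≤ C := (norm_nonneg _).trans (hC 0 (by norm_num))
    refine ⟨C * 2, by positivity, fun z => ?_⟩
    rw [pow_zero, one_mul]
    refine (intervalIntegral.norm_integral_le_of_norm_le_const (C := Real.exp |z.im| * C)
      fun t ht => ?_).trans (le_of_eq ?_)
    · rw [Set.uIoc_of_le (by norm_num)] at ht
      rw [norm_mul]
      exact mul_le_mul (norm_exp_le (abs_le.2 ⟨ht.1.le, ht.2⟩)) (hC t ⟨ht.1.le, ht.2⟩)
        (norm_nonneg _) (Real.exp_pos _).le
    · norm_num; ring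
  | succ n ih =>
    rintro _ ⟨q, rfl⟩
    set p := (1 - X ^ 2 : ℂ[X]) ^ (n + 1) * q with hp
    obtain ⟨C, hC0, hC⟩ := ih (derivative p) (by
      rw [hp, derivative_mul, derivative_pow_succ]
      refine dvd_add ?_ ?_
      · exact ⟨C (((n + 1 : ℕ) : ℂ)) * derivative (1 - X ^ 2) * q, by push_cast; ring⟩
      · exact ⟨(1 - X ^ 2) * derivative q, by ring⟩)
    refine ⟨C, hC0, fun z => ?_⟩
    rw [pow_succ, mul_assoc, mul_expInt (by simp [hp]) (by simp [hp])]
    have := hC z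
    rw [← mul_assoc, mul_comm _ Complex.I, mul_assoc, norm_mul, Complex.norm_I, one_mul]
    exact this

/-- `F_ℓ(z) = z^{-ℓ} j_ℓ(z)`. -/
def besselF (l : ℕ) (z : ℂ) : ℂ :=
  1 / (2 ^ (l + 1) * (l.factorial : ℂ)) * expInt ((1 - X ^ 2) ^ l) z

/-- `H_ℓ(z) = z^{ℓ+1} h_ℓ(z)`. -/
def hankelH (l : ℕ) (z : ℂ) : ℂ :=
  (-Complex.I) ^ (l + 1) * Complex.exp (Complex.I * z) *
    ∑ m ∈ Finset.range (l + 1), Complex.I ^ m / ((m.factorial : ℂ) * 2 ^ m) *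
      (((l + m).factorial : ℂ) / ((l - m).factorial : ℂ)) * z ^ (l - m)

lemma sphericalJ_eq (l : ℕ) (z : ℂ) : sphericalJ l z = z ^ l * besselF l z := by
  rw [sphericalJ, besselF, expInt]
  simp
  ring

lemma sphericalH_eq (l : ℕ) {z : ℂ} (hz : z ≠ 0) : sphericalH l z = hankelH l z / z ^ (l + 1) := by
  rw [sphericalH, hankelH, Finset.mul_sum, Finset.mul_sum, Finset.sum_div]
  refine Finset.sum_congr rfl fun m hm => ?_
  have hm' : m ≤ l := Nat.lt_succ_iff.1 (Finset.mem_range.1 hm)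
  have e : z ^ (l + 1) = z ^ (l - m) * z ^ m * z := by
    rw [← pow_add, Nat.sub_add_cancel hm', pow_succ]
  have h1 : (m.factorial : ℂ) ≠ 0 := by exact_mod_cast m.factorial_ne_zero
  have h2 : ((l - m).factorial : ℂ) ≠ 0 := by exact_mod_cast (l - m).factorial_ne_zero
  rw [e, mul_pow]
  field_simp

/-- Integrating the derivative of `t (1 - t²)^{l+1}` gives `(2l + 3) I_{l+1} = 2 (l + 1) I_l`. -/
lemma integral_one_sub_sq_pow (l : ℕ) :
    ∫ t in (-1 : ℝ)..1, (1 - t ^ 2) ^ l = 2 ^ (2 * l + 1) * (l.factorial : ℝ) ^ 2 / ((2 * l + 1).factorial : ℝ) := by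
  induction l with
  | zero => norm_num
  | succ l ih =>
    have hd : ∀ t ∈ Set.uIcc (-1 : ℝ) 1, HasDerivAt (fun t : ℝ => t * (1 - t ^ 2) ^ (l + 1))
        ((2 * l + 3) * (1 - t ^ 2) ^ (l + 1) - (2 * (l + 1)) * (1 - t ^ 2) ^ l) t := by
      intro t _
      have h1 : HasDerivAt (fun t : ℝ => 1 - t ^ 2) (-(2 * t)) t := by
        simpa using ((hasDerivAt_id t).pow 2).const_sub 1
      have h2 : HasDerivAt (fun t : ℝ => t * (1 - t ^ 2) ^ (l + 1))
          (1 * (1 - t ^ 2) ^ (l + 1) +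
            t * (((l + 1 : ℕ) : ℝ) * (1 - t ^ 2) ^ l * -(2 * t))) t :=
        (hasDerivAt_id t).mul (h1.pow (l + 1))
      refine h2.congr_deriv ?_
      push_cast
      ring
    have h := intervalIntegral.integral_eq_sub_of_hasDerivAt hd
      (Continuous.intervalIntegrable (by fun_prop) _ _)
    rw [intervalIntegral.integral_sub (Continuous.intervalIntegrable (by fun_prop) _ _)
      (Continuous.intervalIntegrable (by fun_prop) _ _), intervalIntegral.integral_const_mul,
      intervalIntegral.integral_const_mul, ih] at h
    have h0 : (1 : ℝ) * (1 - 1 ^ 2) ^ (l + 1) - -1 * (1 - (-1) ^ 2) ^ (l + 1) = 0 := by simp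
    rw [h0, sub_eq_zero] at h
    have h4 : ((2 * (l + 1) + 1).factorial : ℝ)
        = (2 * l + 3) * ((2 * l + 2) * ((2 * l + 1).factorial : ℝ)) := by
      rw [show 2 * (l + 1) + 1 = (2 * l + 1) + 1 + 1 by ring, Nat.factorial_succ,
        Nat.factorial_succ]
      push_cast; ring
    have h5 : ((2 * l + 1).factorial : ℝ) ≠ 0 := by exact_mod_cast Nat.factorial_ne_zero _
    rw [h4, Nat.factorial_succ]
    push_cast
    rw [eq_div_iff (by positivity)]
    have h6 := congrArg (fun x => x * ((2 * (l : ℝ) + 2) * ((2 * l + 1).factorial : ℝ))) h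
    field_simp at h6
    ring_nf at h6 ⊢
    linear_combination (2 * (l : ℝ) + 2) * h6

/-- This constant makes the value prescribed for `greenG` at `k = 0` the continuous extension. -/
lemma besselF_mul_hankelH_zero (l : ℕ) :
    besselF l 0 * hankelH l 0 = -Complex.I / (2 * l + 1) := by
  have h1 : expInt ((1 - X ^ 2) ^ l) 0 =
      2 ^ (2 * l + 1) * (l.factorial : ℂ) ^ 2 / ((2 * l + 1).factorial : ℂ) := by
    have : ((∫ t in (-1 : ℝ)..1, (1 - t ^ 2) ^ l : ℝ) : ℂ) = _ :=
      congrArg _ (integral_one_sub_sq_pow l)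
    rw [← intervalIntegral.integral_ofReal] at this
    rw [expInt]
    push_cast at this
    simpa using this
  have h2 : hankelH l 0 = (-Complex.I) ^ (l + 1) * (Complex.I ^ l / ((l.factorial : ℂ) * 2 ^ l) *
      ((2 * l).factorial : ℂ)) := by
    rw [hankelH, Finset.sum_range_succ, Finset.sum_eq_zero]
    · simp [two_mul]
    · intro m hm
      have : l - m ≠ 0 := by have := Finset.mem_range.1 hm; omega
      simp [this]
  rw [besselF, h1, h2, Nat.factorial_succ]
  have h3 : (l.factorial : ℂ) ≠ 0 := by exact_mod_cast l.factorial_ne_zero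
  have h4 : ((2 * l).factorial : ℂ) ≠ 0 := by exact_mod_cast (2 * l).factorial_ne_zero
  have h5 : (2 * (l : ℂ) + 1) ≠ 0 := by exact_mod_cast (2 * l).succ_ne_zero
  have h6 : (-Complex.I) ^ (l + 1) * Complex.I ^ l = -Complex.I := by
    rw [pow_succ, mul_right_comm, ← mul_pow]
    simp
  push_cast
  rw [show (2 : ℂ) ^ (2 * l + 1) = 2 ^ (l + 1) * 2 ^ l by rw [← pow_add]; congr 1; ring]
  field_simp
  linear_combination h6

/-- The Green function through the entire functions `F_ℓ` and `H_ℓ`. -/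
def greenE (l : ℕ) (k : ℂ) (R R' : ℝ) : ℂ :=
  -Complex.I * (((min R R' : ℝ) : ℂ) ^ (l + 1) / ((max R R' : ℝ) : ℂ) ^ l) *
    (besselF l (k * (min R R' : ℝ)) * hankelH l (k * (max R R' : ℝ)))

/-- After the powers `z^l` and `z^{-l-1}` are extracted from `j_ℓ` and `h_ℓ`, every factor `k`
outside `F_ℓ` and `H_ℓ` cancels, which exhibits the Green function as entire in `k`. -/
lemma greenG_eq (l : ℕ) (k : ℂ) {R R' : ℝ} (hR : 0 < R) (hR' : 0 < R') :
    greenG l k R R' = greenE l k R R' := by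
  have hs : ((max R R' : ℝ) : ℂ) ≠ 0 := by exact_mod_cast (lt_max_of_lt_left hR).ne'
  have hr : ((min R R' : ℝ) : ℂ) ≠ 0 := by exact_mod_cast (lt_min hR hR').ne'
  rw [greenG, greenE]
  split_ifs with hk
  · rw [hk, zero_mul, zero_mul, besselF_mul_hankelH_zero]
    have h5 : (2 * (l : ℂ) + 1) ≠ 0 := by exact_mod_cast (2 * l).succ_ne_zero
    have hI := Complex.I_mul_I
    field_simp
    rw [Complex.I_sq]
  · rw [sphericalJ_eq, sphericalH_eq _ (mul_ne_zero hk hs)]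
    have h : (R : ℂ) * R' = ((min R R' : ℝ) : ℂ) * ((max R R' : ℝ) : ℂ) := by
      rw [← Complex.ofReal_mul, ← Complex.ofReal_mul, min_mul_max]
    rw [mul_assoc _ (R : ℂ) (R' : ℂ), h, mul_pow, mul_pow]
    field_simp
    ring

lemma differentiable_besselF (l : ℕ) : Differentiable ℂ (besselF l) :=
  (differentiable_expInt _).const_mul _

lemma differentiable_hankelH (l : ℕ) : Differentiable ℂ (hankelH l) := by
  unfold hankelH
  fun_prop

lemma differentiable_greenE (l : ℕ) (R R' : ℝ) : Differentiable ℂ fun k => greenE l k R R' := by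
  unfold greenE
  refine Differentiable.const_mul ?_ _
  exact ((differentiable_besselF l).comp (by fun_prop)).mul
    ((differentiable_hankelH l).comp (by fun_prop))

lemma measurable_greenE (l : ℕ) (k : ℂ) : Measurable fun p : ℝ × ℝ => greenE l k p.1 p.2 := by
  have h1 : Measurable fun p : ℝ × ℝ => ((min p.1 p.2 : ℝ) : ℂ) :=
    Complex.measurable_ofReal.comp (measurable_fst.min measurable_snd)
  have h2 : Measurable fun p : ℝ × ℝ => ((max p.1 p.2 : ℝ) : ℂ) :=
    Complex.measurable_ofReal.comp (measurable_fst.max measurable_snd)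
  unfold greenE
  refine Measurable.mul (Measurable.const_mul ((h1.pow_const _).div (h2.pow_const _)) _) ?_
  exact ((differentiable_besselF l).continuous.measurable.comp (h1.const_mul k)).mul
    ((differentiable_hankelH l).continuous.measurable.comp (h2.const_mul k))

/-- The decay of order `l` is needed to absorb the polynomial growth of `H_ℓ`. It combines the bound
by `n = 0` integrations by parts, for small `z`, with that by `n = l`, for large `z`. -/
lemma exists_norm_besselF_le (l : ℕ) : ∃ C : ℝ, 0 ≤ C ∧
    ∀ z, (1 + ‖z‖) ^ l * ‖besselF l z‖ ≤ C * Real.exp |z.im| := by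
  obtain ⟨C₀, hC₀, h₀⟩ := exists_norm_pow_mul_expInt_le 0 ((1 - X ^ 2) ^ l) (by simp)
  obtain ⟨C₁, hC₁, h₁⟩ := exists_norm_pow_mul_expInt_le l ((1 - X ^ 2) ^ l) dvd_rfl
  set c : ℝ := ‖(1 / (2 ^ (l + 1) * (l.factorial : ℂ)) : ℂ)‖ with hc
  refine ⟨2 ^ l * (c * (C₀ + C₁)), by positivity, fun z => ?_⟩
  have e1 : (1 + ‖z‖) ^ l ≤ 2 ^ l * (1 + ‖z‖ ^ l) := by
    have h2 : 1 + ‖z‖ ≤ 2 * max 1 ‖z‖ := by linarith [le_max_left 1 ‖z‖, le_max_right 1 ‖z‖]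
    calc (1 + ‖z‖) ^ l ≤ (2 * max 1 ‖z‖) ^ l := by gcongr
      _ = 2 ^ l * (max 1 ‖z‖) ^ l := mul_pow _ _ _
      _ ≤ _ := by
        gcongr
        rcases max_cases 1 ‖z‖ with ⟨h, _⟩ | ⟨h, _⟩ <;> rw [h]
        · rw [one_pow]; linarith [pow_nonneg (norm_nonneg z) l]
        · linarith
  have a0 := h₀ z
  have a1 := h₁ z
  rw [pow_zero, one_mul] at a0
  rw [norm_mul, norm_pow] at a1
  calc (1 + ‖z‖) ^ l * ‖besselF l z‖ ≤ (2 ^ l * (1 + ‖z‖ ^ l)) * ‖besselF l z‖ := by gcongr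
    _ = 2 ^ l * (c * (‖expInt ((1 - X ^ 2) ^ l) z‖ + ‖z‖ ^ l * ‖expInt ((1 - X ^ 2) ^ l) z‖)) := by
        rw [besselF, norm_mul, ← hc]; ring
    _ ≤ 2 ^ l * (c * (C₀ * Real.exp |z.im| + C₁ * Real.exp |z.im|)) := by gcongr
    _ = _ := by ring

lemma exists_norm_hankelH_le (l : ℕ) : ∃ C : ℝ, 0 ≤ C ∧
    ∀ z, ‖hankelH l z‖ ≤ C * (1 + ‖z‖) ^ l * Real.exp (-z.im) := by
  set c : ℕ → ℂ := fun m => Complex.I ^ m / ((m.factorial : ℂ) * 2 ^ m) *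
      (((l + m).factorial : ℂ) / ((l - m).factorial : ℂ)) with hc
  refine ⟨∑ m ∈ Finset.range (l + 1), ‖c m‖, by positivity, fun z => ?_⟩
  rw [hankelH, norm_mul, norm_mul, norm_pow, norm_neg, Complex.norm_I, one_pow, one_mul,
    Complex.norm_exp, mul_comm]
  have e : (Complex.I * z).re = -z.im := by simp
  rw [e]
  gcongr
  refine (norm_sum_le _ _).trans ?_
  rw [Finset.sum_mul]
  refine Finset.sum_le_sum fun m _ => ?_
  rw [norm_mul, norm_pow]
  refine mul_le_mul_of_nonneg_left ?_ (norm_nonneg _)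
  calc ‖z‖ ^ (l - m) ≤ (1 + ‖z‖) ^ (l - m) := by gcongr; linarith
    _ ≤ (1 + ‖z‖) ^ l := pow_le_pow_right₀ (by linarith [norm_nonneg z]) (Nat.sub_le l m)

lemma exists_norm_greenE_le (l : ℕ) : ∃ C : ℝ, 0 ≤ C ∧ ∀ (k : ℂ) (R R' : ℝ), 0 < R → 0 < R' →
    ‖greenE l k R R'‖ ≤ C * min R R' * Real.exp (|k.im| * min R R' - k.im * max R R') := by
  obtain ⟨C₁, hC₁, h₁⟩ := exists_norm_besselF_le l
  obtain ⟨C₂, hC₂, h₂⟩ := exists_norm_hankelH_le l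
  refine ⟨C₁ * C₂, by positivity, fun k R R' hR hR' => ?_⟩
  set r := min R R' with hr
  set s := max R R' with hs
  have hr0 : 0 < r := lt_min hR hR'
  have hs0 : 0 < s := lt_max_of_lt_left hR
  have hrs : r ≤ s := min_le_max
  have a1 := h₁ (k * r)
  have a2 := h₂ (k * s)
  have n1 : ‖k * (r : ℂ)‖ = ‖k‖ * r := by
    rw [norm_mul, Complex.norm_real, Real.norm_of_nonneg hr0.le]
  have n2 : ‖k * (s : ℂ)‖ = ‖k‖ * s := by
    rw [norm_mul, Complex.norm_real, Real.norm_of_nonneg hs0.le]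
  have i1 : |(k * (r : ℂ)).im| = |k.im| * r := by
    rw [Complex.im_mul_ofReal, abs_mul, abs_of_pos hr0]
  have i2 : (k * (s : ℂ)).im = k.im * s := Complex.im_mul_ofReal _ _
  rw [n1, i1] at a1
  rw [n2, i2] at a2
  -- The prefactor `(r/s)^l` converts the growth of `H_ℓ` at `ks` into `(1 + |k| r)^l`, which the
  -- decay of `F_ℓ` at `kr` cancels. Hence the constant does not depend on `k`.
  have e1 : (r / s) ^ l * (1 + ‖k‖ * s) ^ l ≤ (1 + ‖k‖ * r) ^ l := by
    rw [← mul_pow]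
    refine pow_le_pow_left₀ (by positivity) ?_ l
    have : r / s ≤ 1 := (div_le_one hs0).2 hrs
    calc r / s * (1 + ‖k‖ * s) = r / s + ‖k‖ * r := by field_simp
      _ ≤ _ := by linarith
  have e0 : ‖greenE l k R R'‖ =
      r * (r / s) ^ l * (‖besselF l (k * r)‖ * ‖hankelH l (k * s)‖) := by
    rw [greenE, norm_mul, norm_mul, norm_mul, norm_neg, Complex.norm_I, norm_div, norm_pow,
      norm_pow, Complex.norm_real, Complex.norm_real, ← hr, ← hs, Real.norm_of_nonneg hr0.le,
      Real.norm_of_nonneg hs0.le, one_mul, div_pow, pow_succ]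
    ring
  rw [e0, sub_eq_add_neg, Real.exp_add]
  calc r * (r / s) ^ l * (‖besselF l (k * r)‖ * ‖hankelH l (k * s)‖)
      ≤ r * (r / s) ^ l * (‖besselF l (k * r)‖ *
          (C₂ * (1 + ‖k‖ * s) ^ l * Real.exp (-(k.im * s)))) := by gcongr
    _ = r * C₂ * Real.exp (-(k.im * s)) *
          (((r / s) ^ l * (1 + ‖k‖ * s) ^ l) * ‖besselF l (k * r)‖) := by ring
    _ ≤ r * C₂ * Real.exp (-(k.im * s)) * ((1 + ‖k‖ * r) ^ l * ‖besselF l (k * r)‖) := by gcongr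
    _ ≤ r * C₂ * Real.exp (-(k.im * s)) * (C₁ * Real.exp (|k.im| * r)) := by gcongr
    _ = _ := by ring

/-- For `Im k ≥ 0` the left side is at most zero; for `Im k < 0` it is `|Im k| (R + R')` with `|Im
k| ≤ α`. This is where the half-plane comes from. -/
lemma exponent_le {α : ℝ} {k : ℂ} (hk : -α ≤ k.im) {R R' : ℝ} (hR : 0 < R) (hR' : 0 < R')
    (hα : 0 < α) : |k.im| * min R R' - k.im * max R R' ≤ α * (R + R') := by
  have hr0 : 0 < min R R' := lt_min hR hR'
  have hrs : min R R' ≤ max R R' := min_le_max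
  rw [← min_add_max R R']
  rcases le_total 0 k.im with h | h
  · rw [abs_of_nonneg h]
    nlinarith
  · rw [abs_of_nonpos h]
    nlinarith

end

end NonlocalPotential

namespace NonlocalPotential

noncomputable section

/-! ### Partial potentials -/

lemma lintegral_plane_radial (f : ℝ → ℝ≥0∞) (hf : Measurable f) :
    ∫⁻ q : ℝ × ℝ, f (q.1 ^ 2 + q.2 ^ 2) =
      ENNReal.ofReal (2 * Real.pi) * ∫⁻ r in Ioi (0 : ℝ), ENNReal.ofReal r * f (r ^ 2) := by
  rw [← lintegral_comp_polarCoord_symm]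
  have e : ∀ p : ℝ × ℝ, ENNReal.ofReal p.1 • f ((polarCoord.symm p).1 ^ 2 + (polarCoord.symm p).2 ^ 2)
      = ENNReal.ofReal p.1 * f (p.1 ^ 2) * 1 := by
    intro p
    rw [polarCoord_symm_apply, smul_eq_mul, mul_one]
    congr 2
    have := Real.cos_sq_add_sin_sq p.2
    linear_combination p.1 ^ 2 * this
  simp only [e]
  rw [polarCoord_target, Measure.volume_eq_prod, ← Measure.prod_restrict,
    lintegral_prod_mul (f := fun r : ℝ => ENNReal.ofReal r * f (r ^ 2)) (g := fun _ => 1)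
      (by fun_prop) (by fun_prop), mul_comm]
  congr 1
  rw [lintegral_one, Measure.restrict_apply_univ, Real.volume_Ioo]
  congr 1
  ring

/-- Substitution `R² = x² + r²` with `R dR = r dr`, which passes from cylindrical to spherical
radius. -/
lemma lintegral_sqrt_substitution (x : ℝ) (f : ℝ → ℝ≥0∞) :
    ∫⁻ r in Ioi (0 : ℝ), ENNReal.ofReal r * f (Real.sqrt (x ^ 2 + r ^ 2)) =
      ∫⁻ R in Ioi |x|, ENNReal.ofReal R * f R := by
  have himg : (fun r : ℝ => Real.sqrt (x ^ 2 + r ^ 2)) '' Ioi 0 = Ioi |x| := by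
    ext R
    simp only [mem_image, mem_Ioi]
    constructor
    · rintro ⟨r, hr, rfl⟩
      exact Real.lt_sqrt_of_sq_lt (by rw [sq_abs]; nlinarith)
    · intro hR
      have hR0 : 0 < R := (abs_nonneg x).trans_lt hR
      have h : 0 < R ^ 2 - x ^ 2 := by nlinarith [sq_abs x, abs_nonneg x]
      refine ⟨Real.sqrt (R ^ 2 - x ^ 2), Real.sqrt_pos.2 h, ?_⟩
      rw [Real.sq_sqrt h.le, add_sub_cancel, Real.sqrt_sq hR0.le]
  have hpos : ∀ r ∈ Ioi (0 : ℝ), 0 < x ^ 2 + r ^ 2 := fun r hr => by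
    have : (0 : ℝ) < r := hr
    positivity
  have hd : ∀ r ∈ Ioi (0 : ℝ), HasDerivWithinAt (fun r : ℝ => Real.sqrt (x ^ 2 + r ^ 2))
      (r / Real.sqrt (x ^ 2 + r ^ 2)) (Ioi 0) r := by
    intro r hr
    have h1 : HasDerivAt (fun r : ℝ => x ^ 2 + r ^ 2) (2 * r) r := by
      simpa using ((hasDerivAt_id r).pow 2).const_add (x ^ 2)
    have h2 := (h1.sqrt (hpos r hr).ne').hasDerivWithinAt (s := Ioi 0)
    rwa [mul_div_mul_left _ _ two_ne_zero] at h2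
  have hinj : InjOn (fun r : ℝ => Real.sqrt (x ^ 2 + r ^ 2)) (Ioi 0) := by
    intro a ha b hb h
    have ha' : (0 : ℝ) < a := ha
    have hb' : (0 : ℝ) < b := hb
    have := (Real.sqrt_inj (hpos a ha).le (hpos b hb).le).1 h
    exact (pow_left_inj₀ ha'.le hb'.le two_ne_zero).1 (by linarith)
  rw [← himg, lintegral_image_eq_lintegral_abs_deriv_mul measurableSet_Ioi hd hinj]
  refine setLIntegral_congr_fun measurableSet_Ioi fun r hr => ?_
  have hr' : (0 : ℝ) < r := hr
  have hs : 0 < Real.sqrt (x ^ 2 + r ^ 2) := Real.sqrt_pos.2 (hpos r hr)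
  rw [← mul_assoc, ← ENNReal.ofReal_mul (abs_nonneg _), abs_of_pos (div_pos hr' hs),
    div_mul_cancel₀ _ hs.ne']

/-- Tonelli on the cone `|x| < R`, followed by `x = R t`; `t` is the cosine of the polar angle. -/
lemma lintegral_Ioi_abs (f : ℝ → ℝ → ℝ≥0∞) (hf : Measurable (Function.uncurry f)) :
    ∫⁻ x : ℝ, ∫⁻ R in Ioi |x|, f R x =
      ∫⁻ R in Ioi (0 : ℝ), ENNReal.ofReal R * ∫⁻ t in Ioc (-1 : ℝ) 1, f R (R * t) := by
  have hS : MeasurableSet {p : ℝ × ℝ | |p.1| < p.2} :=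
    measurableSet_lt measurable_fst.abs measurable_snd
  have hm : Measurable fun p : ℝ × ℝ => {p : ℝ × ℝ | |p.1| < p.2}.indicator
      (fun p => f p.2 p.1) p :=
    (hf.comp measurable_swap).indicator hS
  have e1 : ∀ x : ℝ, ∫⁻ R in Ioi |x|, f R x =
      ∫⁻ R, {p : ℝ × ℝ | |p.1| < p.2}.indicator (fun p => f p.2 p.1) (x, R) := by
    intro x
    rw [← lintegral_indicator measurableSet_Ioi]
    rfl
  simp only [e1]
  rw [lintegral_lintegral_swap hm.aemeasurable, ← lintegral_indicator measurableSet_Ioi]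
  refine lintegral_congr fun R => ?_
  have e2 : ∫⁻ x, {p : ℝ × ℝ | |p.1| < p.2}.indicator (fun p => f p.2 p.1) (x, R) =
      ∫⁻ x in Ioo (-R) R, f R x := by
    rw [← lintegral_indicator measurableSet_Ioo]
    refine lintegral_congr fun x => ?_
    simp only [indicator, mem_ofPred_eq, mem_Ioo, abs_lt]
  rw [e2]
  by_cases hR : 0 < R
  · rw [indicator_of_mem (show R ∈ Ioi (0 : ℝ) from hR)]
    have himg : (fun t : ℝ => R * t) '' Ioo (-1) 1 = Ioo (-R) R := by
      rw [image_mul_left_Ioo hR]; simp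
    rw [← himg, lintegral_image_eq_lintegral_abs_deriv_mul measurableSet_Ioo (f' := fun _ => R)
      (fun t _ => by simpa using ((hasDerivAt_id t).const_mul R).hasDerivWithinAt)
      (fun a _ b _ h => mul_left_cancel₀ hR.ne' h), abs_of_pos hR,
      lintegral_const_mul' _ _ ENNReal.ofReal_ne_top, restrict_Ioo_eq_restrict_Ioc]
  · rw [indicator_of_notMem (show R ∉ Ioi (0 : ℝ) from hR), Ioo_eq_empty (by linarith)]
    simp

lemma lintegral_E3_coord (f : ℝ → ℝ → ℝ → ℝ≥0∞)
    (hf : Measurable fun p : ℝ × ℝ × ℝ => f p.1 p.2.1 p.2.2) :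
    ∫⁻ y : E3, f (y 0) (y 1) (y 2) = ∫⁻ x : ℝ, ∫⁻ q : ℝ × ℝ, f x q.1 q.2 := by
  have h1 := PiLp.volume_preserving_ofLp (Fin 3)
  have h2 := volume_preserving_piFinSuccAbove (fun _ : Fin 3 => ℝ) 0
  have h3 := (MeasurePreserving.id (volume : Measure ℝ)).prod (volume_preserving_finTwoArrow ℝ)
  have h := h3.comp (h2.comp h1)
  rw [← lintegral_prod (fun p : ℝ × ℝ × ℝ => f p.1 p.2.1 p.2.2) hf.aemeasurable,
    ← h.lintegral_comp hf]
  rfl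

/-- Integration in spherical coordinates of a function of `|y|` and `y₁`. -/
lemma lintegral_E3 (f : ℝ → ℝ → ℝ≥0∞) (hf : Measurable (Function.uncurry f)) :
    ∫⁻ y : E3, f ‖y‖ (y 0) = ENNReal.ofReal (2 * Real.pi) *
      ∫⁻ R in Ioi (0 : ℝ), ENNReal.ofReal (R ^ 2) * ∫⁻ t in Ioc (-1 : ℝ) 1, f R (R * t) := by
  have e1 : ∀ y : E3, f ‖y‖ (y 0) =
      f (Real.sqrt ((y 0) ^ 2 + ((y 1) ^ 2 + (y 2) ^ 2))) (y 0) := by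
    intro y
    rw [EuclideanSpace.norm_eq, Fin.sum_univ_three]
    simp only [Real.norm_eq_abs, sq_abs, add_assoc]
  simp only [e1]
  have hm : Measurable fun p : ℝ × ℝ × ℝ =>
      f (Real.sqrt (p.1 ^ 2 + (p.2.1 ^ 2 + p.2.2 ^ 2))) p.1 :=
    hf.comp (Measurable.prodMk (by fun_prop) measurable_fst)
  rw [lintegral_E3_coord (fun a b c => f (Real.sqrt (a ^ 2 + (b ^ 2 + c ^ 2))) a) hm]
  have e2 : ∀ x : ℝ, ∫⁻ q : ℝ × ℝ, f (Real.sqrt (x ^ 2 + (q.1 ^ 2 + q.2 ^ 2))) x =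
      ENNReal.ofReal (2 * Real.pi) * ∫⁻ R in Ioi |x|, ENNReal.ofReal R * f R x := by
    intro x
    have hx : Measurable fun s => f (Real.sqrt (x ^ 2 + s)) x :=
      hf.comp (Measurable.prodMk (by fun_prop) measurable_const)
    rw [lintegral_plane_radial (fun s => f (Real.sqrt (x ^ 2 + s)) x) hx,
      lintegral_sqrt_substitution x fun R => f R x]
  simp only [e2]
  rw [lintegral_const_mul' _ _ ENNReal.ofReal_ne_top,
    lintegral_Ioi_abs (fun R x => ENNReal.ofReal R * f R x)
      ((ENNReal.measurable_ofReal.comp measurable_fst).mul hf)]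
  congr 1
  refine setLIntegral_congr_fun measurableSet_Ioi fun R hR => ?_
  have hR' : (0 : ℝ) < R := hR
  rw [lintegral_const_mul' _ _ ENNReal.ofReal_ne_top, ← mul_assoc,
    ← ENNReal.ofReal_mul hR'.le, sq]

lemma measurable_profile {V : E3 → E3 → ℝ} (hV : Measurable fun p : E3 × E3 => V p.1 p.2) :
    Measurable fun p : ℝ × ℝ × ℝ => profile V p.1 p.2.1 p.2.2 := by
  unfold profile
  refine hV.comp (f := fun p : ℝ × ℝ × ℝ =>
    ((!₂[p.1, 0, 0] : E3), (!₂[p.2.1 * p.2.2, p.2.1 * Real.sqrt (1 - p.2.2 ^ 2), 0] : E3))) ?_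
  refine Measurable.prodMk ?_ ?_
  · refine (PiLp.continuous_toLp 2 _).measurable.comp (measurable_pi_iff.2 fun i => ?_)
    fin_cases i <;> simp <;> fun_prop
  · refine (PiLp.continuous_toLp 2 _).measurable.comp (measurable_pi_iff.2 fun i => ?_)
    fin_cases i <;> simp <;> fun_prop

lemma continuous_legendreP (l : ℕ) : Continuous (legendreP l) := by
  unfold legendreP
  exact (Polynomial.continuous_aeval _).comp (by fun_prop)

lemma partialV_eq (V : E3 → E3 → ℝ) (l : ℕ) (R R' : ℝ) : partialV V l R R' =
    2 * Real.pi * R * R' * ∫ t in Ioc (-1 : ℝ) 1, profile V R R' t * legendreP l t := by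
  rw [partialV, intervalIntegral.integral_of_le (by norm_num)]

lemma measurable_partialV {V : E3 → E3 → ℝ} (hV : Measurable fun p : E3 × E3 => V p.1 p.2)
    (l : ℕ) : Measurable fun p : ℝ × ℝ => partialV V l p.1 p.2 := by
  simp only [partialV_eq]
  refine Measurable.mul (by fun_prop) ?_
  have h : Measurable fun q : (ℝ × ℝ) × ℝ => profile V q.1.1 q.1.2 q.2 * legendreP l q.2 :=
    ((measurable_profile hV).comp (f := fun q : (ℝ × ℝ) × ℝ => (q.1.1, q.1.2, q.2))
      (by fun_prop)).mul ((continuous_legendreP l).measurable.comp measurable_snd)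
  exact (h.stronglyMeasurable.integral_prod_right (ν := volume.restrict (Ioc (-1 : ℝ) 1))).measurable

/-- Cauchy–Schwarz in `t` against the Legendre polynomial. The factor `R² R'²` is the Jacobian of
spherical coordinates in both variables. -/
lemma exists_enorm_partialV_sq_le {V : E3 → E3 → ℝ}
    (hV : Measurable fun p : E3 × E3 => V p.1 p.2) (l : ℕ) :
    ∃ C : ℝ≥0∞, C ≠ ∞ ∧ ∀ R R' : ℝ, ‖(partialV V l R R' : ℂ)‖ₑ ^ 2 ≤
      C * (ENNReal.ofReal (R ^ 2) * (ENNReal.ofReal (R' ^ 2) *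
        ∫⁻ t in Ioc (-1 : ℝ) 1, ENNReal.ofReal (profile V R R' t ^ 2))) := by
  have hcL : Continuous fun t => ENNReal.ofReal (legendreP l t ^ 2) :=
    ENNReal.continuous_ofReal.comp ((continuous_legendreP l).pow 2)
  refine ⟨ENNReal.ofReal ((2 * Real.pi) ^ 2) *
    ∫⁻ t in Ioc (-1 : ℝ) 1, ENNReal.ofReal (legendreP l t ^ 2), ?_, fun R R' => ?_⟩
  · refine ENNReal.mul_ne_top ENNReal.ofReal_ne_top ?_
    have h : IntegrableOn (fun t => legendreP l t ^ 2) (Ioc (-1 : ℝ) 1) :=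
      (((continuous_legendreP l).pow 2).integrableOn_Icc).mono_set Ioc_subset_Icc_self
    exact (h.lintegral_lt_top).ne
  · have hsq : ∀ x : ℝ, ‖x‖ₑ ^ (2 : ℝ) = ENNReal.ofReal (x ^ 2) := by
      intro x
      rw [ENNReal.rpow_two, ← ofReal_norm, ← ENNReal.ofReal_pow (norm_nonneg _),
        Real.norm_eq_abs, sq_abs]
    have hmP : Measurable fun t => profile V R R' t :=
      (measurable_profile hV).comp (f := fun t : ℝ => (R, R', t)) (by fun_prop)
    have hH := ENNReal.lintegral_mul_le_Lp_mul_Lq (volume.restrict (Ioc (-1 : ℝ) 1))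
      Real.HolderConjugate.two_two (f := fun t => ‖profile V R R' t‖ₑ)
      (g := fun t => ‖legendreP l t‖ₑ) hmP.enorm.aemeasurable
      (continuous_legendreP l).measurable.enorm.aemeasurable
    simp only [hsq] at hH
    have h1 : ‖∫ t in Ioc (-1 : ℝ) 1, profile V R R' t * legendreP l t‖ₑ ^ (2 : ℝ) ≤
        (∫⁻ t in Ioc (-1 : ℝ) 1, ENNReal.ofReal (profile V R R' t ^ 2)) *
          ∫⁻ t in Ioc (-1 : ℝ) 1, ENNReal.ofReal (legendreP l t ^ 2) := by
      refine (ENNReal.rpow_le_rpow ((enorm_integral_le_lintegral_enorm _).trans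
        (le_of_eq_of_le ?_ hH)) (by norm_num)).trans (le_of_eq ?_)
      · simp only [enorm_mul, Pi.mul_apply]
      · rw [ENNReal.mul_rpow_of_nonneg _ _ (by norm_num), ← ENNReal.rpow_mul, ← ENNReal.rpow_mul]
        norm_num
    have h2 : ‖(partialV V l R R' : ℂ)‖ₑ = ‖partialV V l R R'‖ₑ := by
      rw [← ofReal_norm, ← ofReal_norm, Complex.norm_real]
    rw [h2, partialV_eq, enorm_mul, mul_pow, ← ENNReal.rpow_two, ← ENNReal.rpow_two, hsq,
      mul_pow, mul_pow, ENNReal.ofReal_mul (by positivity), ENNReal.ofReal_mul (by positivity)]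
    refine (mul_le_mul_right h1 _).trans (le_of_eq ?_)
    ring

/-- The integral over the second variable depends only on the length of the first. -/
lemma lintegral_rotation {V : E3 → E3 → ℝ}
    (hrot : ∀ x y x' y' : E3, ‖x‖ = ‖x'‖ → ‖y‖ = ‖y'‖ → inner ℝ x y = inner ℝ x' y' →
      V x y = V x' y') (d : ℝ → ℝ≥0∞) {x x' : E3} (h : ‖x‖ = ‖x'‖) :
    ∫⁻ y : E3, d ‖y‖ * ENNReal.ofReal (V x y ^ 2) =
      ∫⁻ y : E3, d ‖y‖ * ENNReal.ofReal (V x' y ^ 2) := by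
  -- Reflection in the hyperplane orthogonal to `x - x'` carries `x` to `x'`, since they have equal
  -- length, and preserves Lebesgue measure.
  set U : E3 ≃ₗᵢ[ℝ] E3 := Submodule.reflection (Submodule.span ℝ {x - x'})ᗮ with hU
  have hUx : U x = x' := Submodule.reflection_sub h
  refine Eq.trans ?_ (U.measurePreserving.lintegral_comp_emb
    U.toHomeomorph.measurableEmbedding fun y => d ‖y‖ * ENNReal.ofReal (V x' y ^ 2))
  refine lintegral_congr fun y => ?_
  rw [U.norm_map, hrot x y x' (U y) h (U.norm_map y).symm (by rw [← hUx, U.inner_map_map])]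

lemma lintegral_profile {V : E3 → E3 → ℝ} (hV : Measurable fun p : E3 × E3 => V p.1 p.2)
    (hrot : ∀ x y x' y' : E3, ‖x‖ = ‖x'‖ → ‖y‖ = ‖y'‖ → inner ℝ x y = inner ℝ x' y' →
      V x y = V x' y') {d : ℝ → ℝ≥0∞} (hd : Measurable d) {R : ℝ} :
    ∫⁻ y : E3, d ‖y‖ * ENNReal.ofReal (V !₂[R, 0, 0] y ^ 2) = ENNReal.ofReal (2 * Real.pi) *
      ∫⁻ R' in Ioi (0 : ℝ), ENNReal.ofReal (R' ^ 2) * (d R' *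
        ∫⁻ t in Ioc (-1 : ℝ) 1, ENNReal.ofReal (profile V R R' t ^ 2)) := by
  have hm : Measurable (Function.uncurry fun R' x : ℝ =>
      d R' * ENNReal.ofReal (profile V R R' (x / R') ^ 2)) := by
    refine (hd.comp measurable_fst).mul (ENNReal.measurable_ofReal.comp (Measurable.pow_const ?_ 2))
    exact (measurable_profile hV).comp (f := fun q : ℝ × ℝ => (R, q.1, q.2 / q.1)) (by fun_prop)
  -- The first coordinate over the length is the cosine of the angle with the first axis, so
  -- rotational invariance replaces `y` by a vector in the coordinate plane. At `y = 0` the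
  -- convention `0 / 0 = 0` is harmless.
  have e : ∀ y : E3, d ‖y‖ * ENNReal.ofReal (V !₂[R, 0, 0] y ^ 2) =
      d ‖y‖ * ENNReal.ofReal (profile V R ‖y‖ (y 0 / ‖y‖) ^ 2) := by
    intro y
    rw [profile]
    congr 3
    have hy : ‖y‖ * (y 0 / ‖y‖) = y 0 := by
      rcases eq_or_ne y 0 with rfl | h
      · simp
      · field_simp
    have ht : (y 0 / ‖y‖) ^ 2 ≤ 1 := by
      rw [sq_le_one_iff_abs_le_one, abs_div, abs_norm]
      exact div_le_one_of_le₀ (by simpa using PiLp.norm_apply_le y 0) (norm_nonneg _)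
    refine hrot _ _ _ _ rfl ?_ ?_
    · refine (pow_left_inj₀ (norm_nonneg _) (norm_nonneg _) two_ne_zero).1 ?_
      rw [EuclideanSpace.norm_sq_eq (!₂[_, _, _] : E3), Fin.sum_univ_three]
      change ‖y‖ ^ 2 = ‖‖y‖ * (y 0 / ‖y‖)‖ ^ 2 + ‖‖y‖ * Real.sqrt (1 - (y 0 / ‖y‖) ^ 2)‖ ^ 2 +
        ‖(0 : ℝ)‖ ^ 2
      rw [Real.norm_eq_abs, Real.norm_eq_abs, sq_abs, sq_abs, mul_pow, mul_pow,
        Real.sq_sqrt (by linarith), norm_zero]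
      ring
    · simp [PiLp.inner_apply, Fin.sum_univ_three]
      exact Or.inl hy.symm
  simp only [e]
  rw [lintegral_E3 _ hm]
  congr 1
  refine setLIntegral_congr_fun measurableSet_Ioi fun R' hR' => ?_
  have h : (R' : ℝ) ≠ 0 := (show (0 : ℝ) < R' from hR').ne'
  simp only [mul_div_cancel_left₀ _ h]
  rw [lintegral_const_mul]
  exact ENNReal.measurable_ofReal.comp (((measurable_profile hV).comp
    (f := fun t : ℝ => (R, R', t)) (by fun_prop)).pow_const 2)

lemma lintegral_potential {V : E3 → E3 → ℝ} (hV : Measurable fun p : E3 × E3 => V p.1 p.2)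
    (hrot : ∀ x y x' y' : E3, ‖x‖ = ‖x'‖ → ‖y‖ = ‖y'‖ → inner ℝ x y = inner ℝ x' y' →
      V x y = V x' y') {d : ℝ → ℝ≥0∞} (hd : Measurable d) :
    ∫⁻ x : E3, d ‖x‖ * ∫⁻ y : E3, d ‖y‖ * ENNReal.ofReal (V x y ^ 2) =
      ENNReal.ofReal (2 * Real.pi) * (2 * (ENNReal.ofReal (2 * Real.pi) *
        ∫⁻ R in Ioi (0 : ℝ), ENNReal.ofReal (R ^ 2) * (d R *
          ∫⁻ R' in Ioi (0 : ℝ), ENNReal.ofReal (R' ^ 2) * (d R' *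
            ∫⁻ t in Ioc (-1 : ℝ) 1, ENNReal.ofReal (profile V R R' t ^ 2))))) := by
  set Φ : ℝ → ℝ≥0∞ := fun R => d R * ∫⁻ y : E3, d ‖y‖ * ENNReal.ofReal (V !₂[R, 0, 0] y ^ 2) with hΦ
  have e : ∀ x : E3, d ‖x‖ * ∫⁻ y : E3, d ‖y‖ * ENNReal.ofReal (V x y ^ 2) = Φ ‖x‖ := by
    intro x
    rw [hΦ]
    dsimp only
    rw [lintegral_rotation hrot d (x := x) (x' := !₂[‖x‖, 0, 0])]
    rw [EuclideanSpace.norm_eq (!₂[‖x‖, 0, 0] : E3), Fin.sum_univ_three]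
    simp
  have hΦm : Measurable Φ := by
    refine hd.mul (Measurable.lintegral_prod_right' (f := fun p : ℝ × E3 =>
      d ‖p.2‖ * ENNReal.ofReal (V !₂[p.1, 0, 0] p.2 ^ 2)) ?_)
    refine (hd.comp (by fun_prop)).mul (ENNReal.measurable_ofReal.comp (Measurable.pow_const ?_ 2))
    refine hV.comp (f := fun p : ℝ × E3 => ((!₂[p.1, 0, 0] : E3), p.2)) (Measurable.prodMk ?_ measurable_snd)
    refine (PiLp.continuous_toLp 2 _).measurable.comp (measurable_pi_iff.2 fun i => ?_)
    fin_cases i <;> simp <;> fun_prop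
  simp only [e]
  rw [lintegral_E3 (fun R _ => Φ R) (hΦm.comp measurable_fst)]
  congr 1
  rw [← lintegral_const_mul' _ _ ENNReal.ofReal_ne_top, ← lintegral_const_mul' _ _ ENNReal.ofNat_ne_top]
  refine setLIntegral_congr_fun measurableSet_Ioi fun R _ => ?_
  -- The integrand does not depend on `t`, so the angular integral gives the length `2` of `[-1,
  -- 1]`.
  rw [lintegral_const, Measure.restrict_apply_univ, Real.volume_Ioc, hΦ]
  dsimp only
  rw [lintegral_profile hV hrot hd]
  norm_num
  ring

lemma lintegral_partialV_lt_top {ε α : ℝ} {V : E3 → E3 → ℝ} (hV : IsPotential ε α V) (l : ℕ) :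
    ∫⁻ p : ℝ × ℝ, dens ε α p.1 * (dens ε α p.2 * ‖(partialV V l p.1 p.2 : ℂ)‖ₑ ^ 2)
      ∂(halfLine.prod halfLine) < ∞ := by
  obtain ⟨C, hC, h⟩ := exists_enorm_partialV_sq_le hV.measurable l
  have hfin := hV.finite
  rw [lintegral_potential hV.measurable hV.rotation (dens_measurable ε α)] at hfin
  have hpi : ENNReal.ofReal (2 * Real.pi) ≠ 0 := by simpa using Real.pi_pos
  have h1 := ENNReal.lt_top_of_mul_ne_top_right (ENNReal.lt_top_of_mul_ne_top_right
    (ENNReal.lt_top_of_mul_ne_top_right hfin.ne hpi).ne two_ne_zero).ne hpi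
  have hm : Measurable fun p : ℝ × ℝ => ‖(partialV V l p.1 p.2 : ℂ)‖ₑ ^ 2 :=
    (Complex.measurable_ofReal.comp (measurable_partialV hV.measurable l)).enorm.pow_const 2
  have hd := dens_measurable ε α
  rw [lintegral_prod _ (by fun_prop)]
  refine lt_of_le_of_lt ?_ (ENNReal.mul_lt_top hC.lt_top h1)
  rw [← lintegral_const_mul' _ _ hC]
  refine lintegral_mono fun R => ?_
  have hA : dens ε α R * (C * ENNReal.ofReal (R ^ 2)) ≠ ∞ :=
    ENNReal.mul_ne_top (dens_ne_top ε α R) (ENNReal.mul_ne_top hC ENNReal.ofReal_ne_top)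
  calc ∫⁻ R', dens ε α R * (dens ε α R' * ‖(partialV V l R R' : ℂ)‖ₑ ^ 2) ∂halfLine
      ≤ ∫⁻ R', dens ε α R * (C * ENNReal.ofReal (R ^ 2)) * (ENNReal.ofReal (R' ^ 2) *
          (dens ε α R' * ∫⁻ t in Ioc (-1 : ℝ) 1, ENNReal.ofReal (profile V R R' t ^ 2)))
          ∂halfLine := by
        refine lintegral_mono fun R' => ?_
        refine (mul_le_mul_right (mul_le_mul_right (h R R') _) _).trans (le_of_eq ?_)
        ring
    _ = _ := by
        rw [lintegral_const_mul' _ _ hA, halfLine]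
        ring

end

end NonlocalPotential

namespace NonlocalPotential

noncomputable section

/-! ### Holomorphic families of square integrable functions -/

lemma norm_deriv_le_of_ball {f : ℂ → ℂ} {c : ℂ} {r M ρ : ℝ} (hr : 0 < r)
    (hf : DifferentiableOn ℂ f (Metric.ball c (ρ + r))) (hM : ∀ z ∈ Metric.ball c (ρ + r), ‖f z‖ ≤ M) :
    ∀ z ∈ Metric.ball c ρ, ‖deriv f z‖ ≤ M / r := by
  intro z hz
  have hsub : Metric.closedBall z r ⊆ Metric.ball c (ρ + r) := by
    intro w hw
    rw [Metric.mem_ball] at hz ⊢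
    rw [Metric.mem_closedBall] at hw
    linarith [dist_triangle w z c]
  refine Complex.norm_deriv_le_of_forall_mem_sphere_norm_le hr ?_
    fun w hw => hM w (hsub (Metric.sphere_subset_closedBall hw))
  exact (hf.mono (Metric.closure_ball_subset_closedBall.trans hsub)).diffContOnCl

/-- Two Cauchy estimates, each costing a margin `r` of radius, bound the second derivative by
`M/r²`; two mean value inequalities then bound the remainder. -/
lemma norm_taylor_one_le {f : ℂ → ℂ} {c : ℂ} {r M : ℝ} (hr : 0 < r)
    (hf : DifferentiableOn ℂ f (Metric.ball c (r + r + r)))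
    (hM : ∀ z ∈ Metric.ball c (r + r + r), ‖f z‖ ≤ M) {z : ℂ} (hz : z ∈ Metric.ball c r) :
    ‖f z - f c - (z - c) * deriv f c‖ ≤ M / r / r * ‖z - c‖ ^ 2 := by
  have h1 := norm_deriv_le_of_ball hr hf hM
  have hf' : DifferentiableOn ℂ (deriv f) (Metric.ball c (r + r)) :=
    (hf.deriv Metric.isOpen_ball).mono (Metric.ball_subset_ball (by linarith))
  have h2 := norm_deriv_le_of_ball hr hf' h1
  have hMr : 0 ≤ M / r / r := (norm_nonneg _).trans (h2 c (Metric.mem_ball_self hr))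
  have h3 : ∀ w ∈ Metric.ball c r, ‖deriv f w - deriv f c‖ ≤ M / r / r * ‖w - c‖ := by
    intro w hw
    exact (convex_ball c r).norm_image_sub_le_of_norm_deriv_le
      (fun x hx => (hf'.differentiableAt (Metric.isOpen_ball.mem_nhds
        (Metric.ball_subset_ball (by linarith) hx)))) h2 (Metric.mem_ball_self hr) hw
  have hseg : Metric.closedBall c ‖z - c‖ ⊆ Metric.ball c r := by
    refine Metric.closedBall_subset_ball ?_
    rwa [Metric.mem_ball, dist_eq_norm] at hz
  have hd : ∀ w ∈ Metric.ball c r, HasDerivAt (fun w => f w - (w - c) * deriv f c)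
      (deriv f w - deriv f c) w := by
    intro w hw
    have hw' : DifferentiableAt ℂ f w := hf.differentiableAt (Metric.isOpen_ball.mem_nhds
      (Metric.ball_subset_ball (by linarith) hw))
    have e := ((hasDerivAt_id w).sub_const c).mul_const (deriv f c)
    rw [one_mul] at e
    exact hw'.hasDerivAt.sub e
  have h4 := (convex_closedBall c ‖z - c‖).norm_image_sub_le_of_norm_hasDerivWithin_le
    (f := fun w => f w - (w - c) * deriv f c) (f' := fun w => deriv f w - deriv f c)
    (C := M / r / r * ‖z - c‖) (x := c) (y := z)
    (fun w hw => (hd w (hseg hw)).hasDerivWithinAt)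
    (fun w hw => (h3 w (hseg hw)).trans (by
      refine mul_le_mul_of_nonneg_left ?_ hMr
      rwa [Metric.mem_closedBall, dist_eq_norm] at hw))
    (Metric.mem_closedBall_self (norm_nonneg _)) (by rw [Metric.mem_closedBall, dist_eq_norm])
  simp only [sub_self, zero_mul, sub_zero] at h4
  calc _ = ‖f z - (z - c) * deriv f c - f c‖ := by congr 1; ring
    _ ≤ _ := h4
    _ = _ := by ring

/-- A square integrable majorant uniform in `k` bounds the second-order Taylor remainder at each `ω`
by a multiple of `|k - c|² |B(ω)|`. Taking `L²` norms makes the remainder `O(|k - c|²)`, so the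
pointwise derivative is the derivative in `L²`. -/
lemma differentiableOn_toLp {Ω : Type*} [MeasurableSpace Ω] {μ : Measure Ω} {f : ℂ → Ω → ℂ}
    {U : Set ℂ} (hU : IsOpen U) (hf : ∀ ω, DifferentiableOn ℂ (fun k => f k ω) U)
    (hm : ∀ k ∈ U, AEStronglyMeasurable (f k) μ) {B : Ω → ℂ} (hB : MemLp B 2 μ)
    (hb : ∀ᵐ ω ∂μ, ∀ k ∈ U, ‖f k ω‖ ≤ ‖B ω‖) {F : ℂ → Lp ℂ 2 μ}
    (hF : ∀ k ∈ U, F k =ᵐ[μ] f k) : DifferentiableOn ℂ F U := by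
  intro c hc
  obtain ⟨ρ, hρ, hball⟩ := Metric.isOpen_iff.1 hU c hc
  set r : ℝ := ρ / 3 with hr_def
  have hr : 0 < r := by positivity
  have hr3 : r + r + r = ρ := by rw [hr_def]; ring
  rw [← hr3] at hball
  set D : Ω → ℂ := fun ω => deriv (fun k => f k ω) c with hD
  have hder : ∀ ω, HasDerivAt (fun k => f k ω) (D ω) c := fun ω =>
    ((hf ω).differentiableAt (hU.mem_nhds hc)).hasDerivAt
  have hDb : ∀ᵐ ω ∂μ, ‖D ω‖ ≤ ‖((r⁻¹ : ℝ) : ℂ) * B ω‖ := by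
    filter_upwards [hb] with ω hω
    have := norm_deriv_le_of_ball (ρ := r + r) hr ((hf ω).mono hball)
      (fun k hk => hω k (hball hk)) c (Metric.mem_ball_self (by positivity))
    rw [norm_mul, Complex.norm_real, Real.norm_of_nonneg (by positivity)]
    rwa [div_eq_inv_mul] at this
  have hDm : AEStronglyMeasurable D μ := by
    -- The derivative is a pointwise limit of difference quotients along this sequence, hence
    -- measurable.
    set u : ℕ → ℂ := fun n => c + ((r / 2 * (1 / ((n : ℝ) + 1)) : ℝ) : ℂ) with hu
    have hun : ∀ n, ‖u n - c‖ < r := by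
      intro n
      rw [hu]
      simp only [add_sub_cancel_left]
      rw [Complex.norm_real, Real.norm_of_nonneg (by positivity)]
      have : 1 / ((n : ℝ) + 1) ≤ 1 := by
        rw [div_le_one (by positivity)]; linarith [n.cast_nonneg (α := ℝ)]
      nlinarith
    have huU : ∀ n, u n ∈ U := fun n => hball (by
      rw [Metric.mem_ball, dist_eq_norm]; linarith [hun n])
    have hut : Tendsto u atTop (𝓝[≠] c) := by
      refine tendsto_nhdsWithin_iff.2 ⟨?_, Eventually.of_forall fun n => ?_⟩
      · have h := (tendsto_one_div_add_atTop_nhds_zero_nat (𝕜 := ℝ)).const_mul (r / 2)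
        have h' := (Complex.continuous_ofReal.tendsto _).comp h
        simpa [hu, Function.comp_def] using h'.const_add c
      · rw [mem_compl_iff, mem_singleton_iff, hu]
        simp only [add_eq_left]
        have : (0 : ℝ) < r / 2 * (1 / ((n : ℝ) + 1)) := by positivity
        exact_mod_cast this.ne'
    refine aestronglyMeasurable_of_tendsto_ae atTop
      (f := fun n ω => (u n - c)⁻¹ * (f (u n) ω - f c ω)) (fun n => ?_)
      (Eventually.of_forall fun ω => ?_)
    · exact ((hm _ (huU n)).sub (hm c hc)).const_mul _
    · exact (hasDerivAt_iff_tendsto_slope.1 (hder ω)).comp hut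
  have hDL : MemLp D 2 μ := (hB.const_mul _).of_le hDm hDb
  have key : ∀ k ∈ Metric.ball c r, ‖F k - F c - (k - c) • hDL.toLp D‖ ≤
      (1 / r / r * ‖hB.toLp B‖) * ‖k - c‖ ^ 2 := by
    intro k hk
    have hkU : k ∈ U := hball (Metric.ball_subset_ball (by linarith) hk)
    have h : ‖F k - F c - (k - c) • hDL.toLp D‖ ≤ (1 / r / r * ‖k - c‖ ^ 2) * ‖hB.toLp B‖ := by
      refine Lp.norm_le_mul_norm_of_ae_le_mul ?_
      filter_upwards [hb, hF k hkU, hF c hc, Lp.coeFn_sub (F k) (F c),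
        Lp.coeFn_sub (F k - F c) ((k - c) • hDL.toLp D), Lp.coeFn_smul (k - c) (hDL.toLp D),
        hDL.coeFn_toLp, hB.coeFn_toLp] with ω h1 h2 h3 h4 h5 h6 h7 h8
      rw [h5, Pi.sub_apply, h4, Pi.sub_apply, h6, Pi.smul_apply, h7, h8, h2, h3, smul_eq_mul]
      have := norm_taylor_one_le hr ((hf ω).mono hball) (fun k hk => h1 k (hball hk)) hk
      refine this.trans (le_of_eq ?_)
      ring
    exact h.trans (le_of_eq (by ring))
  have : HasDerivAt F (hDL.toLp D) c := by
    rw [hasDerivAt_iff_isLittleO]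
    refine (Asymptotics.IsBigO.of_bound (1 / r / r * ‖hB.toLp B‖)
      (g := fun k : ℂ => ‖k - c‖ ^ 2) ?_).trans_isLittleO ?_
    · filter_upwards [Metric.ball_mem_nhds c hr] with k hk
      rw [Real.norm_of_nonneg (by positivity)]
      exact key k hk
    · have h0 : Tendsto (fun k : ℂ => k - c) (𝓝 c) (𝓝 0) := by
        simpa using (continuous_id.sub continuous_const).tendsto (f := fun k : ℂ => k - c) c
      exact (Asymptotics.isLittleO_norm_pow_id one_lt_two).comp_tendsto h0
  exact this.differentiableAt.differentiableWithinAt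

end

end NonlocalPotential

namespace NonlocalPotential

noncomputable section

variable {ε α : ℝ}

/-! ### The factors of `L_ℓ(k)` as Hilbert–Schmidt kernels -/

/-- `R^{1/2} e^{αR}`. -/
def halfExp (α R : ℝ) : ℝ := Real.sqrt R * Real.exp (α * R)

lemma measurable_halfExp (α : ℝ) : Measurable (halfExp α) := by unfold halfExp; fun_prop

lemma halfExp_pos (α : ℝ) {R : ℝ} (hR : 0 < R) : 0 < halfExp α R := by
  unfold halfExp; positivity

lemma weight_pos (ε : ℝ) {R : ℝ} (hR : 0 < R) : 0 < weight ε R := by unfold weight; positivity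

/-- Here `R / w = R^ε (1 + R)^{-1-2ε} ≤ (1 + R)^{-1-ε}`; positivity of `ε` gives integrability at
infinity. Both factors of the Green majorant have this integral as squared norm. -/
lemma lintegral_div_weight_lt_top (hε : 0 < ε) :
    ∫⁻ R, ENNReal.ofReal (R / weight ε R) ∂halfLine < ∞ := by
  have h : Integrable (fun x : ℝ => (1 + ‖x‖) ^ (-(1 + ε))) :=
    integrable_one_add_norm (by simp [hε])
  refine lt_of_le_of_lt ?_ (h.integrableOn (s := Ioi 0)).lintegral_lt_top
  refine lintegral_mono_ae (ae_halfLine_pos.mono fun R hR => ENNReal.ofReal_le_ofReal ?_)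
  have h1 : 0 < 1 + R := by linarith
  have e : R / weight ε R = R ^ ε * (1 + R) ^ (-(1 + 2 * ε)) := by
    rw [weight, Real.rpow_sub hR, Real.rpow_one, Real.rpow_neg h1.le]
    have := Real.rpow_pos_of_pos hR ε
    field_simp
  rw [e, Real.norm_of_nonneg hR.le, show -(1 + ε) = ε + -(1 + 2 * ε) by ring, Real.rpow_add h1]
  gcongr
  linarith

lemma dens_toReal {R : ℝ} (hR : 0 < R) :
    (dens ε α R).toReal = weight ε R * Real.exp (2 * α * R) :=
  ENNReal.toReal_ofReal (mul_pos (weight_pos ε hR) (Real.exp_pos _)).le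

lemma halfExp_sq (α : ℝ) {R : ℝ} (hR : 0 < R) : halfExp α R ^ 2 = R * Real.exp (2 * α * R) := by
  rw [halfExp, mul_pow, Real.sq_sqrt hR.le, ← Real.exp_nat_mul]
  congr 2; push_cast; ring

lemma enorm_ofReal_rpow_two (x : ℝ) : ‖(x : ℂ)‖ₑ ^ (2 : ℝ) = ENNReal.ofReal (x ^ 2) := by
  rw [ENNReal.rpow_two, ← ofReal_norm, ← ENNReal.ofReal_pow (norm_nonneg _), Complex.norm_real,
    Real.norm_eq_abs, sq_abs]

lemma eLpNorm_lt_top_of_sq {β : Type*} {m : MeasurableSpace β} {μ : Measure β} {f : β → ℂ}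
    (h : ∫⁻ x, ‖f x‖ₑ ^ (2 : ℝ) ∂μ < ∞) : eLpNorm f 2 μ < ∞ := by
  rw [← eLpNorm_two_sq] at h
  exact (ENNReal.rpow_lt_top_iff_of_pos (by norm_num)).1 h

lemma memLp_halfExp_div (hε : 0 < ε) :
    MemLp (fun R => ((halfExp α R / (dens ε α R).toReal : ℝ) : ℂ)) 2 (muX ε α) := by
  have hm : Measurable fun R => halfExp α R / (dens ε α R).toReal :=
    (measurable_halfExp α).div (dens_measurable ε α).ennreal_toReal
  refine ⟨(Complex.measurable_ofReal.comp hm).aestronglyMeasurable, eLpNorm_lt_top_of_sq ?_⟩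
  simp only [enorm_ofReal_rpow_two]
  rw [muX, lintegral_withDensity_eq_lintegral_mul _ (dens_measurable ε α) (by fun_prop)]
  refine lt_of_le_of_lt (le_of_eq (lintegral_congr_ae ?_)) (lintegral_div_weight_lt_top hε)
  filter_upwards [ae_halfLine_pos] with R hR
  have h1 := weight_pos ε hR
  rw [Pi.mul_apply, dens_toReal hR, dens, ← ENNReal.ofReal_mul (by positivity), div_pow,
    halfExp_sq α hR]
  congr 1
  field_simp

lemma memLp_halfExp (hε : 0 < ε) :
    MemLp (fun R => ((halfExp α R : ℝ) : ℂ)) 2 (muInv ε α) := by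
  have hm := measurable_halfExp α
  refine ⟨(Complex.measurable_ofReal.comp hm).aestronglyMeasurable, eLpNorm_lt_top_of_sq ?_⟩
  simp only [enorm_ofReal_rpow_two]
  have hd : Measurable fun R => (dens ε α R)⁻¹ := (dens_measurable ε α).inv
  rw [muInv, lintegral_withDensity_eq_lintegral_mul _ hd (by fun_prop)]
  refine lt_of_le_of_lt (le_of_eq (lintegral_congr_ae ?_)) (lintegral_div_weight_lt_top hε)
  filter_upwards [ae_halfLine_pos] with R hR
  have h1 := weight_pos ε hR
  rw [Pi.mul_apply, dens, ← ENNReal.ofReal_inv_of_pos (by positivity),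
    ← ENNReal.ofReal_mul (by positivity), halfExp_sq α hR]
  congr 1
  field_simp

/-- A square integrable majorant of the kernels `G_ℓ(k) / μ`. -/
def greenBound (ε α C : ℝ) (p : ℝ × ℝ) : ℂ :=
  (C : ℂ) * (((halfExp α p.1 / (dens ε α p.1).toReal : ℝ) : ℂ) * ((halfExp α p.2 : ℝ) : ℂ))

lemma memLp_greenBound (hε : 0 < ε) (C : ℝ) :
    MemLp (greenBound ε α C) 2 ((muX ε α).prod (muInv ε α)) := by
  have h1 := memLp_halfExp_div (α := α) hε
  have h2 := memLp_halfExp (α := α) hε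
  refine MemLp.const_mul (f := fun p : ℝ × ℝ =>
    ((halfExp α p.1 / (dens ε α p.1).toReal : ℝ) : ℂ) * ((halfExp α p.2 : ℝ) : ℂ)) ⟨?_, ?_⟩ _
  · exact h1.1.comp_fst.mul h2.1.comp_snd
  · rw [eLpNorm_prod_mul h1.1 h2.1]
    exact ENNReal.mul_lt_top h1.2 h2.2

/-- The kernel `G_ℓ(k;R,R') / μ(R)`. -/
def greenK (ε α : ℝ) (l : ℕ) (k : ℂ) (p : ℝ × ℝ) : ℂ :=
  greenE l k p.1 p.2 / ((dens ε α p.1).toReal : ℂ)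

lemma measurable_greenK (l : ℕ) (k : ℂ) : Measurable (greenK ε α l k) :=
  (measurable_greenE l k).div
    (Complex.measurable_ofReal.comp ((dens_measurable ε α).comp measurable_fst).ennreal_toReal)

lemma min_le_sqrt_mul_sqrt {R R' : ℝ} (hR : 0 < R) (hR' : 0 < R') :
    min R R' ≤ Real.sqrt R * Real.sqrt R' := by
  rw [← Real.sqrt_mul hR.le]
  refine Real.le_sqrt_of_sq_le ?_
  rw [sq]
  exact mul_le_mul (min_le_left _ _) (min_le_right _ _) (lt_min hR hR').le hR.le

/-- Since `min(R,R') ≤ √R √R'`, the bound on the Green function splits into a product of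
one-variable functions. The majorant is uniform over the closed half-plane, which serves both
holomorphy and dominated convergence. -/
lemma exists_norm_greenK_le (hα : 0 < α) (l : ℕ) : ∃ C : ℝ, 0 ≤ C ∧ ∀ k : ℂ, -α ≤ k.im →
    ∀ p : ℝ × ℝ, 0 < p.1 → 0 < p.2 → ‖greenK ε α l k p‖ ≤ ‖greenBound ε α C p‖ := by
  obtain ⟨C, hC, h⟩ := exists_norm_greenE_le l
  refine ⟨C, hC, fun k hk p h1 h2 => ?_⟩
  have hd := dens_toReal_pos (ε := ε) (α := α) h1
  have e1 := halfExp_pos α h1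
  have e2 := halfExp_pos α h2
  rw [greenK, greenBound, norm_div, norm_mul, norm_mul, Complex.norm_real, Complex.norm_real,
    Complex.norm_real, Complex.norm_real, Real.norm_of_nonneg hd.le, Real.norm_of_nonneg hC,
    Real.norm_of_nonneg (by positivity), Real.norm_of_nonneg e2.le]
  have h3 : ‖greenE l k p.1 p.2‖ ≤ C * (halfExp α p.1 * halfExp α p.2) := by
    refine (h k p.1 p.2 h1 h2).trans ?_
    calc _ ≤ C * (Real.sqrt p.1 * Real.sqrt p.2) * Real.exp (α * (p.1 + p.2)) := by
          gcongr
          · exact min_le_sqrt_mul_sqrt h1 h2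
          · exact exponent_le hk h1 h2 hα
      _ = _ := by rw [mul_add, Real.exp_add, halfExp, halfExp]; ring
  calc _ ≤ C * (halfExp α p.1 * halfExp α p.2) / (dens ε α p.1).toReal := by gcongr
    _ = _ := by ring

lemma memLp_greenK (hε : 0 < ε) (hα : 0 < α) (l : ℕ) {k : ℂ} (hk : -α ≤ k.im) :
    MemLp (greenK ε α l k) 2 ((muX ε α).prod (muInv ε α)) := by
  obtain ⟨C, -, h⟩ := exists_norm_greenK_le (ε := ε) hα l
  refine (memLp_greenBound hε C).of_le (measurable_greenK l k).aestronglyMeasurable ?_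
  filter_upwards [muX_prod_ac.ae_le ae_pos_prod] with p hp using h k hk p hp.1 hp.2

/-! ### The factorisation of `L_ℓ(k)` and its holomorphy in the Hilbert–Schmidt norm. -/

/-- The kernel `V_ℓ(R,R') μ(R')`. -/
def potentialK (ε α : ℝ) (V : E3 → E3 → ℝ) (l : ℕ) (p : ℝ × ℝ) : ℂ :=
  (partialV V l p.1 p.2 : ℂ) * ((dens ε α p.2).toReal : ℂ)

lemma memLp_potentialK {V : E3 → E3 → ℝ} (hV : IsPotential ε α V) (l : ℕ) :
    MemLp (potentialK ε α V l) 2 ((muX ε α).prod (muInv ε α)) := by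
  have hm : Measurable (potentialK ε α V l) :=
    (Complex.measurable_ofReal.comp (measurable_partialV hV.measurable l)).mul
      (Complex.measurable_ofReal.comp ((dens_measurable ε α).comp measurable_snd).ennreal_toReal)
  refine ⟨hm.aestronglyMeasurable, eLpNorm_lt_top_of_sq ?_⟩
  rw [muX_prod_eq, lintegral_withDensity_eq_lintegral_mul _ measurable_ratio
    (hm.enorm.pow_const _)]
  refine lt_of_le_of_lt (le_of_eq (lintegral_congr_ae ?_)) (lintegral_partialV_lt_top hV l)
  filter_upwards [ae_pos_prod] with p hp
  have h2 := dens_ne_zero ε α hp.2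
  have h2' := dens_ne_top ε α p.2
  have e : ‖((dens ε α p.2).toReal : ℂ)‖ₑ = dens ε α p.2 := by
    rw [← ofReal_norm, Complex.norm_real, Real.norm_of_nonneg ENNReal.toReal_nonneg,
      ENNReal.ofReal_toReal h2']
  rw [Pi.mul_apply, potentialK, enorm_mul, e, ENNReal.rpow_two, mul_pow]
  calc _ = dens ε α p.1 * (((dens ε α p.2)⁻¹ * dens ε α p.2) *
        (dens ε α p.2 * ‖(partialV V l p.1 p.2 : ℂ)‖ₑ ^ 2)) := by ring
    _ = _ := by rw [ENNReal.inv_mul_cancel h2 h2', one_mul]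

lemma potentialK_mul_greenK {V : E3 → E3 → ℝ} (l : ℕ) (k : ℂ) (R : ℝ) {s R' : ℝ} (hs : 0 < s)
    (hR' : 0 < R') : potentialK ε α V l (R, s) * greenK ε α l k (s, R') =
      (partialV V l R s : ℂ) * greenG l k s R' := by
  have hd : ((dens ε α s).toReal : ℂ) ≠ 0 := by
    exact_mod_cast (dens_toReal_pos (ε := ε) (α := α) hs).ne'
  rw [potentialK, greenK, greenG_eq l k hs hR']
  field_simp

lemma kernelL_eq {V : E3 → E3 → ℝ} (l : ℕ) (k : ℂ) (R : ℝ) {R' : ℝ} (hR' : 0 < R') :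
    kernelL V l k R R' = compFn (potentialK ε α V l) (greenK ε α l k) (R, R') :=
  integral_congr_ae (ae_halfLine_pos.mono fun _ hs => (potentialK_mul_greenK l k R hs hR').symm)

lemma isHS_kernelL (hε : 0 < ε) (hα : 0 < α) {V : E3 → E3 → ℝ} (hV : IsPotential ε α V) (l : ℕ)
    {k : ℂ} (hk : -α ≤ k.im) : IsHS ε α (kernelL V l k) := by
  refine (memLp_congr_ae (muX_prod_ac.ae_le ?_)).1
    (memLp_compFn (memLp_potentialK hV l) (memLp_greenK hε hα l hk))
  filter_upwards [ae_pos_prod] with p hp using (kernelL_eq l k p.1 hp.2).symm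

/-- The exceptional null set comes only from the rows of `V_ℓ`. The bound on the Green kernel is
pointwise, so each of its columns is square integrable and every `R' > 0` is admitted. -/
lemma integrable_kernelL (hε : 0 < ε) (hα : 0 < α) {V : E3 → E3 → ℝ} (hV : IsPotential ε α V)
    (l : ℕ) {k : ℂ} (hk : -α ≤ k.im) : ∀ᵐ R ∂halfLine, ∀ R' : ℝ, 0 < R' →
      Integrable (fun R'' => (partialV V l R R'' : ℂ) * greenG l k R'' R') halfLine := by
  obtain ⟨C, hC, hb⟩ := exists_norm_greenK_le (ε := ε) hα l
  have h1 := memLp_potentialK hV l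
  have hrow : ∀ᵐ R ∂halfLine, MemLp (fun s => potentialK ε α V l (R, s)) 2 (muInv ε α) := by
    filter_upwards [HS_row_memLp (h1.toLp _), Measure.ae_ae_of_ae_prod
      (ac_muX_prod.ae_le h1.coeFn_toLp)] with R hR hR'
    exact (memLp_congr_ae ((muInv_ac_halfLine ε α).ae_le hR')).1 hR
  filter_upwards [hrow] with R hR R' hR'
  have hG : Measurable fun s => greenK ε α l k (s, R') :=
    (measurable_greenK l k).comp (by fun_prop)
  have hcol : MemLp (fun s => greenK ε α l k (s, R')) 2 (muX ε α) := by
    refine (((memLp_halfExp_div (α := α) hε).mul_const (halfExp α R' : ℂ)).const_mul (C : ℂ)).of_le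
      hG.aestronglyMeasurable ?_
    filter_upwards [(muX_ac_halfLine ε α).ae_le ae_halfLine_pos] with s hs
    exact hb k hk (s, R') hs hR'
  have hm := hR.1.mono_ac (halfLine_ac_muInv ε α)
  have h2 : Integrable (fun s => potentialK ε α V l (R, s) * greenK ε α l k (s, R')) halfLine :=
    ⟨hm.mul hG.aestronglyMeasurable, (schwarz ε α _ _ hm hG.aestronglyMeasurable).trans_lt
      (ENNReal.mul_lt_top hR.2 hcol.2)⟩
  exact h2.congr (ae_halfLine_pos.mono fun _ hs => potentialK_mul_greenK l k R hs hR')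

open Classical in
/-- `G_ℓ(k) / μ` in the Hilbert–Schmidt space, for `Im k ≥ -α`. -/
def greenHS (ε α : ℝ) (l : ℕ) (k : ℂ) : HSSp ε α :=
  if h : MemLp (greenK ε α l k) 2 ((muX ε α).prod (muInv ε α)) then h.toLp _ else 0

lemma coeFn_greenHS (hε : 0 < ε) (hα : 0 < α) (l : ℕ) {k : ℂ} (hk : -α ≤ k.im) :
    greenHS ε α l k =ᵐ[(muX ε α).prod (muInv ε α)] greenK ε α l k := by
  rw [greenHS, dif_pos (memLp_greenK hε hα l hk)]
  exact MemLp.coeFn_toLp _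

/-- The density cancels in the composition, so `L_ℓ(k)` is a fixed bounded linear map applied to the
Green factor. Holomorphy and decay pass from the latter to `L_ℓ(k)`. -/
lemma opL_eq (hε : 0 < ε) (hα : 0 < α) {V : E3 → E3 → ℝ} (hV : IsPotential ε α V) (l : ℕ)
    {k : ℂ} (hk : -α ≤ k.im) :
    opL ε α V l k = compL ε α ((memLp_potentialK hV l).toLp _) (greenHS ε α l k) := by
  rw [compL_apply]
  refine toHS_eq_of_ae ((coeFn_comp _ _).trans ((compFn_congr
    (ac_muX_prod.ae_le (MemLp.coeFn_toLp _))
    (ac_muX_prod.ae_le (coeFn_greenHS hε hα l hk))).trans ?_))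
  filter_upwards [ae_pos_prod] with p hp using (kernelL_eq l k p.1 hp.2).symm

lemma isOpen_halfPlane (α : ℝ) : IsOpen (halfPlane α) := isOpen_lt continuous_const Complex.continuous_im

lemma im_of_mem_closure {k : ℂ} (hk : k ∈ closure (halfPlane α)) : -α ≤ k.im :=
  closure_lt_subset_le continuous_const Complex.continuous_im hk

lemma differentiableOn_greenHS (hε : 0 < ε) (hα : 0 < α) (l : ℕ) :
    DifferentiableOn ℂ (greenHS ε α l) (halfPlane α) := by
  obtain ⟨C, -, hb⟩ := exists_norm_greenK_le (ε := ε) hα l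
  refine differentiableOn_toLp (f := fun k p => greenK ε α l k p) (isOpen_halfPlane α)
    (fun p => ((differentiable_greenE l p.1 p.2).div_const _).differentiableOn)
    (fun k _ => (measurable_greenK l k).aestronglyMeasurable) (memLp_greenBound hε C) ?_
    fun k hk => coeFn_greenHS hε hα l (le_of_lt hk)
  filter_upwards [muX_prod_ac.ae_le ae_pos_prod] with p hp k hk
    using hb k (le_of_lt hk) p hp.1 hp.2

lemma differentiableOn_opL (hε : 0 < ε) (hα : 0 < α) {V : E3 → E3 → ℝ} (hV : IsPotential ε α V)
    (l : ℕ) : DifferentiableOn ℂ (opL ε α V l) (halfPlane α) :=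
  ((compL ε α ((memLp_potentialK hV l).toLp _)).differentiable.comp_differentiableOn
    (differentiableOn_greenHS hε hα l)).congr fun _ hk => opL_eq hε hα hV l (le_of_lt hk)

/-! ### Decay along the positive imaginary axis -/

lemma ae_ne_prod : ∀ᵐ p : ℝ × ℝ ∂halfLine.prod halfLine, p.1 ≠ p.2 := by
  have : NullSingletonClass halfLine := by unfold halfLine; infer_instance
  refine (Measure.ae_prod_iff_ae_ae (p := fun p : ℝ × ℝ => p.1 ≠ p.2)
    (measurableSet_eq_fun measurable_fst measurable_snd).compl).2 ?_
  refine Eventually.of_forall fun R => ?_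
  have h : ∀ᵐ s ∂halfLine, s ≠ R := Measure.ae_ne halfLine R
  exact h.mono fun s hs => hs.symm

/-- At `k = in` the exponent in the bound is `-n (max - min)`, negative off the diagonal; the
diagonal is a null set. -/
lemma tendsto_greenK (l : ℕ) {p : ℝ × ℝ} (h1 : 0 < p.1) (h2 : 0 < p.2) (hne : p.1 ≠ p.2) :
    Tendsto (fun n : ℕ => greenK ε α l ((n : ℂ) * Complex.I) p) atTop (𝓝 0) := by
  obtain ⟨C, hC, h⟩ := exists_norm_greenE_le l
  have hd : 0 < max p.1 p.2 - min p.1 p.2 := by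
    rw [max_sub_min_eq_abs]; exact abs_pos.2 (sub_ne_zero.2 hne.symm)
  have e : Tendsto (fun n : ℕ => greenE l ((n : ℂ) * Complex.I) p.1 p.2) atTop (𝓝 0) := by
    refine squeeze_zero_norm (a := fun n : ℕ => C * min p.1 p.2 *
      Real.exp (-((n : ℝ) * (max p.1 p.2 - min p.1 p.2)))) (fun n => ?_) ?_
    · refine (h _ p.1 p.2 h1 h2).trans (le_of_eq ?_)
      have : ((n : ℂ) * Complex.I).im = n := by simp
      rw [this, abs_of_nonneg n.cast_nonneg]
      congr 2; ring
    · have t1 : Tendsto (fun n : ℕ => (n : ℝ) * (max p.1 p.2 - min p.1 p.2)) atTop atTop :=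
        tendsto_natCast_atTop_atTop.atTop_mul_const hd
      simpa using (Real.tendsto_exp_neg_atTop_nhds_zero.comp t1).const_mul (C * min p.1 p.2)
  simpa [greenK] using e.div_const ((dens ε α p.1).toReal : ℂ)

lemma tendsto_greenHS (hε : 0 < ε) (hα : 0 < α) (l : ℕ) :
    Tendsto (fun n : ℕ => greenHS ε α l ((n : ℂ) * Complex.I)) atTop (𝓝 0) := by
  obtain ⟨C, -, hb⟩ := exists_norm_greenK_le (ε := ε) hα l
  have him : ∀ n : ℕ, -α ≤ ((n : ℂ) * Complex.I).im := by
    intro n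
    have : ((n : ℂ) * Complex.I).im = n := by simp
    rw [this]
    linarith [n.cast_nonneg (α := ℝ)]
  have hB := memLp_greenBound (α := α) hε C
  have hBfin : ∫⁻ p, ‖greenBound ε α C p‖ₑ ^ (2 : ℝ) ∂((muX ε α).prod (muInv ε α)) ≠ ∞ := by
    rw [← eLpNorm_two_sq]
    exact ENNReal.rpow_ne_top_of_nonneg (by norm_num) hB.2.ne
  have key : Tendsto (fun n : ℕ => ∫⁻ p, ‖greenK ε α l ((n : ℂ) * Complex.I) p‖ₑ ^ (2 : ℝ)
      ∂((muX ε α).prod (muInv ε α))) atTop (𝓝 0) := by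
    have := tendsto_lintegral_of_dominated_convergence'
      (μ := (muX ε α).prod (muInv ε α)) (f := fun _ => 0)
      (F := fun (n : ℕ) p => ‖greenK ε α l ((n : ℂ) * Complex.I) p‖ₑ ^ (2 : ℝ))
      (fun p => ‖greenBound ε α C p‖ₑ ^ (2 : ℝ))
      (fun n => ((measurable_greenK l _).enorm.pow_const _).aemeasurable)
      (fun n => by
        filter_upwards [muX_prod_ac.ae_le ae_pos_prod] with p hp
        exact ENNReal.rpow_le_rpow (enorm_le_iff_norm_le.2 (hb _ (him n) p hp.1 hp.2))
          (by norm_num)) hBfin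
      (by
        filter_upwards [muX_prod_ac.ae_le ae_pos_prod, muX_prod_ac.ae_le ae_ne_prod] with p hp hne
        have h := ((tendsto_greenK (ε := ε) (α := α) l hp.1 hp.2 hne).enorm).ennrpow_const 2
        simpa using h)
    simpa using this
  rw [tendsto_zero_iff_norm_tendsto_zero]
  have e : ∀ n : ℕ, ‖greenHS ε α l ((n : ℂ) * Complex.I)‖ =
      ((∫⁻ p, ‖greenK ε α l ((n : ℂ) * Complex.I) p‖ₑ ^ (2 : ℝ)
        ∂((muX ε α).prod (muInv ε α))) ^ (1 / 2 : ℝ)).toReal := by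
    intro n
    rw [Lp.norm_def, eLpNorm_congr_ae (coeFn_greenHS hε hα l (him n)), ← eLpNorm_two_sq,
      ← ENNReal.rpow_mul]
    norm_num
  simp only [e]
  have h := key.ennrpow_const (1 / 2)
  rw [ENNReal.zero_rpow_of_pos (by norm_num)] at h
  exact (ENNReal.tendsto_toReal ENNReal.zero_ne_top).comp h

lemma tendsto_opL (hε : 0 < ε) (hα : 0 < α) {V : E3 → E3 → ℝ} (hV : IsPotential ε α V) (l : ℕ) :
    Tendsto (fun n : ℕ => opL ε α V l ((n : ℂ) * Complex.I)) atTop (𝓝 0) := by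
  have h := ((compL ε α ((memLp_potentialK hV l).toLp _)).continuous.tendsto 0).comp
    (tendsto_greenHS hε hα l)
  rw [map_zero] at h
  refine h.congr fun n => (opL_eq hε hα hV l ?_).symm
  have : ((n : ℂ) * Complex.I).im = n := by simp
  rw [this]
  linarith [n.cast_nonneg (α := ℝ)]

end

end NonlocalPotential

namespace NonlocalPotential

noncomputable section

/-! ### The resolvents in the half-plane -/

section Resolvent

variable {ε α : ℝ} (hε : 0 < ε) (hα : 0 < α) {V : E3 → E3 → ℝ} (hV : IsPotential ε α V) (l : ℕ)

include hε hα hV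

lemma sigmaL_eq {k : ℂ} (hk : -α ≤ k.im) (g : ℂ) :
    sigmaL V l k g = (hsAlgebra ε α).sigma (opL ε α V l k, g) :=
  sigma_eq (isHS_kernelL hε hα hV l hk) g

lemma nL_eq {k : ℂ} (hk : -α ≤ k.im) (g : ℂ) :
    nL ε α V l k g = (hsAlgebra ε α).numer (opL ε α V l k, g) :=
  nSeries_eq (isHS_kernelL hε hα hV l hk) g

lemma resolvent_of_sigmaL_ne_zero {k : ℂ} (hk : -α ≤ k.im) {g : ℂ} (hs : sigmaL V l k g ≠ 0) :
    IsUnit (1 - g • toOp (opL ε α V l k)) ∧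
    fullResolvent ε α V l k g = 1 + g • toOp (resolventTr ε α V l k g) ∧
    toOp (resolventTr ε α V l k g) = toOp (opL ε α V l k)
      + g • (toOp (opL ε α V l k) ∘L toOp (resolventTr ε α V l k g)) := by
  rw [sigmaL_eq hε hα hV l hk] at hs
  rw [resolventTr, sigmaL_eq hε hα hV l hk, nL_eq hε hα hV l hk]
  exact resolvent_of_sigma_ne_zero _ hs

lemma differentiableOn_pair (g : ℂ) :
    DifferentiableOn ℂ (fun k => (opL ε α V l k, g)) (halfPlane α) :=
  (differentiableOn_opL hε hα hV l).prodMk (differentiableOn_const g)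

lemma differentiableOn_sigmaL (g : ℂ) : DifferentiableOn ℂ (fun k => sigmaL V l k g) (halfPlane α) :=
  ((hsAlgebra ε α).differentiable_sigma.comp_differentiableOn
    (differentiableOn_pair hε hα hV l g)).congr fun _ hk => sigmaL_eq hε hα hV l (le_of_lt hk) g

lemma differentiableOn_nL (g : ℂ) : DifferentiableOn ℂ (fun k => nL ε α V l k g) (halfPlane α) :=
  ((hsAlgebra ε α).differentiable_numer.comp_differentiableOn
    (differentiableOn_pair hε hα hV l g)).congr fun _ hk => nL_eq hε hα hV l (le_of_lt hk) g

/-- As `L_ℓ(in)` tends to zero, continuity of `σ` in the kernel gives `σ_ℓ(in; g) → σ(0; g) = 1`. -/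
lemma exists_sigmaL_ne_zero (g : ℂ) : ∃ k ∈ halfPlane α, sigmaL V l k g ≠ 0 := by
  have h1 : Tendsto (fun n : ℕ => (hsAlgebra ε α).sigma (opL ε α V l ((n : ℂ) * Complex.I), g))
      atTop (𝓝 1) := by
    have h := ((hsAlgebra ε α).differentiable_sigma.continuous.tendsto (0, g)).comp
      ((tendsto_opL hε hα hV l).prodMk_nhds tendsto_const_nhds)
    rwa [TraceAlgebra.sigma_zero_left] at h
  obtain ⟨n, hn⟩ := (h1.eventually_ne one_ne_zero).exists
  have him : ((n : ℂ) * Complex.I).im = n := by simp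
  have hk : -α < ((n : ℂ) * Complex.I).im := by
    rw [him]; linarith [n.cast_nonneg (α := ℝ)]
  exact ⟨_, hk, by rwa [sigmaL_eq hε hα hV l hk.le]⟩

/-- Identity theorem on the connected half-plane: vanishing near one point would force `σ_ℓ(·; g)`
to vanish identically. -/
lemma eventually_sigmaL_ne_zero (g : ℂ) {k₀ : ℂ} (hk₀ : k₀ ∈ halfPlane α) :
    ∀ᶠ k in 𝓝[≠] k₀, sigmaL V l k g ≠ 0 := by
  have ha : AnalyticOnNhd ℂ (fun k => sigmaL V l k g) (halfPlane α) :=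
    (differentiableOn_sigmaL hε hα hV l g).analyticOnNhd (isOpen_halfPlane α)
  have hc : IsPreconnected (halfPlane α) := (convex_halfSpace_im_gt (-α)).isPreconnected
  refine (ha k₀ hk₀).eventually_eq_zero_or_eventually_ne_zero.resolve_left fun h => ?_
  obtain ⟨k, hk, hne⟩ := exists_sigmaL_ne_zero hε hα hV l g
  exact hne (ha.eqOn_zero_of_preconnected_of_eventuallyEq_zero hc hk₀ h hk)

lemma differentiableOn_resolventTr (g : ℂ) : DifferentiableOn ℂ (fun k => resolventTr ε α V l k g)
    {k ∈ halfPlane α | sigmaL V l k g ≠ 0} :=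
  (((differentiableOn_sigmaL hε hα hV l g).mono fun _ hk => hk.1).inv fun _ hk => hk.2).smul
    ((differentiableOn_nL hε hα hV l g).mono fun _ hk => hk.1)

lemma differentiableOn_fullResolvent (g : ℂ) :
    DifferentiableOn ℂ (fun k => fullResolvent ε α V l k g)
      {k ∈ halfPlane α | sigmaL V l k g ≠ 0} := by
  have h : DifferentiableOn ℂ (fun k => toOpL ε α (resolventTr ε α V l k g))
      {k ∈ halfPlane α | sigmaL V l k g ≠ 0} :=
    (toOpL ε α).differentiable.comp_differentiableOn (differentiableOn_resolventTr hε hα hV l g)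
  exact ((differentiableOn_const _).add (h.const_smul g)).congr fun k hk =>
    (resolvent_of_sigmaL_ne_zero hε hα hV l (le_of_lt hk.1) hk.2).2.1

/-! ### Joint meromorphy in `(k, g)`. -/

lemma differentiableOn_pair_prod :
    DifferentiableOn ℂ (fun q : ℂ × ℂ => (opL ε α V l q.1, q.2)) (halfPlane α ×ˢ univ) :=
  ((differentiableOn_opL hε hα hV l).comp differentiableOn_fst fun _ hq => hq.1).prodMk
    differentiableOn_snd

lemma differentiableOn_sigmaL_prod :
    DifferentiableOn ℂ (fun q : ℂ × ℂ => sigmaL V l q.1 q.2) (halfPlane α ×ˢ univ) :=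
  ((hsAlgebra ε α).differentiable_sigma.comp_differentiableOn
    (differentiableOn_pair_prod hε hα hV l)).congr
      fun q hq => sigmaL_eq hε hα hV l (le_of_lt hq.1) q.2

lemma differentiableOn_nL_prod :
    DifferentiableOn ℂ (fun q : ℂ × ℂ => nL ε α V l q.1 q.2) (halfPlane α ×ˢ univ) :=
  ((hsAlgebra ε α).differentiable_numer.comp_differentiableOn
    (differentiableOn_pair_prod hε hα hV l)).congr
      fun q hq => nL_eq hε hα hV l (le_of_lt hq.1) q.2

/-- The determinant is a global denominator, so one neighbourhood, the whole domain, serves every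
point. -/
lemma isMeromorphicOn_of_numer {E : Type*} [NormedAddCommGroup E] [NormedSpace ℂ E]
    {f h : ℂ × ℂ → E} (hh : DifferentiableOn ℂ h (halfPlane α ×ˢ univ))
    (hf : ∀ k ∈ halfPlane α, ∀ g, sigmaL V l k g ≠ 0 → f (k, g) = (sigmaL V l k g)⁻¹ • h (k, g)) :
    IsMeromorphicOn f (halfPlane α ×ˢ univ) := by
  intro p hp
  refine ⟨_, (isOpen_halfPlane α).prod isOpen_univ, hp, h, fun q => sigmaL V l q.1 q.2, hh, ?_, ?_,
    fun q hq hs => hf q.1 hq.1 q.2 hs⟩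
  · exact differentiableOn_sigmaL_prod hε hα hV l
  · rintro ⟨k, g⟩ hq
    -- The zeros are isolated in `k` for each fixed `g`, so moving `k` alone leaves the zero set.
    refine mem_closure_of_tendsto (b := 𝓝[≠] k) (f := fun k => (k, g))
      ((tendsto_id.mono_left nhdsWithin_le_nhds).prodMk_nhds tendsto_const_nhds) ?_
    filter_upwards [eventually_sigmaL_ne_zero hε hα hV l g hq.1,
      nhdsWithin_le_nhds ((isOpen_halfPlane α).mem_nhds hq.1)] with k' h1 h2
      using ⟨⟨h2, mem_univ _⟩, h1⟩

lemma isMeromorphicOn_resolventTr :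
    IsMeromorphicOn (fun p : ℂ × ℂ => resolventTr ε α V l p.1 p.2) (halfPlane α ×ˢ univ) :=
  isMeromorphicOn_of_numer hε hα hV l (differentiableOn_nL_prod hε hα hV l) fun _ _ _ _ => rfl

lemma isMeromorphicOn_fullResolvent :
    IsMeromorphicOn (fun p : ℂ × ℂ => fullResolvent ε α V l p.1 p.2) (halfPlane α ×ˢ univ) := by
  have h1 : DifferentiableOn ℂ (fun q : ℂ × ℂ => toOpL ε α (nL ε α V l q.1 q.2))
      (halfPlane α ×ˢ univ) :=
    (toOpL ε α).differentiable.comp_differentiableOn (differentiableOn_nL_prod hε hα hV l)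
  -- Multiplying `1 + g N/σ` by `σ` gives the holomorphic numerator `σ · 1 + g N`.
  refine isMeromorphicOn_of_numer hε hα hV l (h := fun q => sigmaL V l q.1 q.2 •
    (1 : XSp ε α →L[ℂ] XSp ε α) + q.2 • toOpL ε α (nL ε α V l q.1 q.2))
    (((differentiableOn_sigmaL_prod hε hα hV l).smul_const _).add (differentiableOn_snd.smul h1))
    fun k hk g hs => ?_
  dsimp only
  rw [(resolvent_of_sigmaL_ne_zero hε hα hV l (le_of_lt hk) hs).2.1, smul_add, smul_smul,
    inv_mul_cancel₀ hs, one_smul, smul_comm, ← map_smul, toOpL_apply]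
  rfl

end Resolvent

end

end NonlocalPotential

theorem mainTheorem7 (ε α : ℝ) (hε : 0 < ε) (hα : 0 < α) (V : E3 → E3 → ℝ)
    (hV : IsPotential ε α V) (l : ℕ) :
    -- the objects are well defined on the closed half-plane `Im k ≥ -α`
    (∀ k ∈ closure (halfPlane α),
      (∀ᵐ R ∂halfLine, ∀ R' : ℝ, 0 < R' →
        Integrable (fun R'' => (partialV V l R R'' : ℂ) * greenG l k R'' R') halfLine) ∧
      (∀ n : ℕ, IsHS ε α (kerPow (kernelL V l k) n)) ∧
      ∀ g : ℂ, (Summable fun n => sigmaCoeff (kernelL V l k) n * g ^ n) ∧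
        Summable fun n => g ^ n • toHS ε α (nCoeff (kernelL V l k) n)) ∧
    -- existence of the resolvents off the zeros of `σ_ℓ`
    (∀ k ∈ closure (halfPlane α), ∀ g : ℂ, sigmaL V l k g ≠ 0 →
      IsUnit (1 - g • toOp (opL ε α V l k)) ∧
      fullResolvent ε α V l k g = 1 + g • toOp (resolventTr ε α V l k g) ∧
      toOp (resolventTr ε α V l k g) = toOp (opL ε α V l k)
        + g • (toOp (opL ε α V l k) ∘L toOp (resolventTr ε α V l k g))) ∧
    -- for fixed `g`, the zeros of `σ_ℓ(·;g)` have no accumulation point in `Π_α`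
    (∀ g : ℂ, ∀ k₀ ∈ halfPlane α, ∀ᶠ k in 𝓝[≠] k₀, sigmaL V l k g ≠ 0) ∧
    -- the truncated resolvent, with values in the Hilbert–Schmidt space
    IsMeromorphicOn (fun p : ℂ × ℂ => resolventTr ε α V l p.1 p.2) (halfPlane α ×ˢ univ) ∧
    (∀ g : ℂ, DifferentiableOn ℂ (fun k => resolventTr ε α V l k g)
      {k ∈ halfPlane α | sigmaL V l k g ≠ 0}) ∧
    -- the full resolvent, with values in the bounded operators
    IsMeromorphicOn (fun p : ℂ × ℂ => fullResolvent ε α V l p.1 p.2) (halfPlane α ×ˢ univ) ∧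
    (∀ g : ℂ, DifferentiableOn ℂ (fun k => fullResolvent ε α V l k g)
      {k ∈ halfPlane α | sigmaL V l k g ≠ 0}) := by
  refine ⟨fun k hk => ?_, fun k hk g hs => resolvent_of_sigmaL_ne_zero hε hα hV l
    (im_of_mem_closure hk) hs, fun g k₀ hk₀ => eventually_sigmaL_ne_zero hε hα hV l g hk₀,
    isMeromorphicOn_resolventTr hε hα hV l, differentiableOn_resolventTr hε hα hV l,
    isMeromorphicOn_fullResolvent hε hα hV l, differentiableOn_fullResolvent hε hα hV l⟩
  have hk' := im_of_mem_closure hk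
  have hK := isHS_kernelL hε hα hV l hk'
  refine ⟨integrable_kernelL hε hα hV l hk', isHS_kerPow hK, fun g => ⟨?_, ?_⟩⟩
  · simp only [sigmaCoeff_eq hK]
    exact (hsAlgebra ε α).summable_sigma _ g
  · simp only [toHS_nCoeff hK]
    exact (hsAlgebra ε α).summable_numer _ g
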